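/- **Setting.** Let $\mu$ be a probability measure on $\mathbb R$ that is not a point mass, let $H=([v],E(H))$ be a finite simple graph with $v\ge 2$ vertices and maximum degree $\Delta$, and let $p\in[v,\infty]$ be such that $\int e^{\lambda|x|^p}\,d\mu(x)<\infty$ for all $\lambda>0$ (for $p=\infty$: $\mu$ has compact support). Let $W:[0,1]^2\to\mathbb R$ be symmetric and integrable with $\|W\|_{q\Delta}<\infty$ for some $q>1$ with $\frac1p+\frac1q\le 1$. Put $\alpha(t)=\log\int e^{tx}\,d\mu(x)$, $d\mu_t/d\mu(x)=e^{tx-\alpha(t)}$ and $\mathcal N=\alpha'(\mathbb R)$, an open interval. Let $\beta:\mathrm{cl}(\mathcal N)\to[-\infty,\infty]$ be the inverse of $\alpha'$ on $\mathcal N$, with value $+\infty$ at $\sup\mathcal N$ and $-\infty$ at $\inf\mathcal N$ when these are finite. Let $\gamma(t)=D(\mu_t\|\mu)$ (relative entropy) for $t\in\mathbb R$, $\gamma(+\infty)=D(\delta_{\sup\mathcal N}\|\mu)$ and $\gamma(-\infty)=D(\delta_{\inf\mathcal N}\|\mu)$. Call $\mu$ *stochastically non-negative* if for every $t>0$ with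 $-t\in\mathcal N$ one has $t\in\mathcal N$ and $\gamma(\beta(t))\le\gamma(\beta(-t))$. Let $\mathcal L$ be the set of measurable $f:[0,1]\to\mathrm{cl}(\mathcal N)$ with $\int_0^1|f|^p<\infty$ (for $p=\infty$: $f$ essentially bounded), and put $$G_W(f)=\int_{[0,1]^v}\prod_{(a,b)\in E(H)}W(x_a,x_b)\prod_{a=1}^v f(x_a)\,dx_a,\qquad \mathrm{Sym}[W](x_1,\dots,x_v)=\frac1{v!}\sum_{\sigma\in S_v}\prod_{(a,b)\in E(H)}W(x_{\sigma(a)},x_{\sigma(b)}),$$ $$\mathcal T[\mathrm{Sym}[W]](x)=\int_{[0,1]^{v-1}}\mathrm{Sym}[W](x,x_2,\dots,x_v)\,dx_2\cdots dx_v.$$ For $\theta,B\in\mathbb R$ consider the problem $$\sup_{f\in\mathcal L:\ \int_0^1\gamma(\beta(f(x)))dx<\infty}\Big\{\theta\,G_W(f)+B\int_0^1 f(x)\,dx-\int_0^1\gamma(\beta(f(x)))\,dx\Big\}.\tag{$*$}$$ **Theorem.** (i) For every $f\in\mathcal L$ the integral defining $G_W(f)$ and, for a.e. $x$, the integral in the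 display below converge absolutely. For all $\theta,B\in\mathbb R$ the supremum in $(*)$ is attained, and every maximizer $f$ satisfies, for a.e. $x\in[0,1]$, $$f(x)=\alpha'\Big(\theta v\int_{[0,1]^{v-1}}\mathrm{Sym}[W](x,x_2,\dots,x_v)\prod_{a=2}^v f(x_a)\,dx_a+B\Big).$$ For (ii) and (iii) assume that $W>0$ a.e., that $\mathcal T[\mathrm{Sym}[W]]$ is a.e. equal to a constant $c$, and that $v$ is even or $\mu$ is stochastically non-negative. (ii) If $\theta,B\ge 0$, then every maximizer of $(*)$ is a.e. equal to a constant, and any such constant $x$ satisfies $x=\alpha'(\theta v\,c\,x^{v-1}+B)$; in particular $x=\alpha'(\theta v x^{v-1}+B)$ in the normalized case $c=1$. (iii) Assume moreover that $\mu$ is supported on $[-1,1]$. (a) For each $\theta\ge 0$ there is a $B_0$, depending only on $\mu$, $v$, $\theta$ and $c$ (and not otherwise on $H$ or $W$), such that for every $B>B_0$ the problem $(*)$ has exactly one maximizer up to a.e. equality. (b) If $\alpha'(0)=0$, there is a $\theta_c\in(0,\infty)$, depending only on $\mu$, $v$ and $c$, such that for $B=0$: if $0\le\theta<\theta_c$,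 then $f\equiv 0$ is the unique maximizer of $(*)$ up to a.e. equality; if $\theta>\theta_c$, then $f\equiv 0$ is not a maximizer of $(*)$. -/

import Mathlib

open MeasureTheory ProbabilityTheory Set
open scoped ENNReal

namespace MultilinearGibbs

noncomputable section

/-! ### The base measure: exponential tilts, the inverse mean map and the relative entropy -/

/-- `μ` has finite exponential moments of `|x| ^ p` of all orders `l > 0`; for `p = ∞` this means
that `μ` has compact support. -/
def TailCondition (μ : Measure ℝ) (p : ℝ≥0∞) : Prop :=
  if p = ⊤ then ∃ K : ℝ, ∀ᵐ x ∂μ, |x| ≤ K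
  else ∀ l : ℝ, 0 < l → Integrable (fun x : ℝ => Real.exp (l * |x| ^ p.toReal)) μ

/-- The log-Laplace transform `α(t) = log ∫ exp (t x) dμ(x)`. -/
def logLaplace (μ : Measure ℝ) : ℝ → ℝ := cgf id μ

/-- The exponential tilt `μ_t`, with `dμ_t / dμ (x) = exp (t x - α(t))`. -/
def expTilt (μ : Measure ℝ) (t : ℝ) : Measure ℝ := μ.tilted (fun x => t * x)

/-- The set `𝒩 = α'(ℝ)` of means of the exponential tilts. -/
def meanRange (μ : Measure ℝ) : Set ℝ := range (deriv (logLaplace μ))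

open Classical in
/-- The map `β : cl 𝒩 → [-∞, ∞]`: the inverse of `α'` on `𝒩`, `+∞` at a finite supremum of `𝒩`, and
`-∞` at a finite infimum of `𝒩`. (Values outside `cl 𝒩` are never used.) -/
def tiltParam (μ : Measure ℝ) (x : ℝ) : EReal :=
  if x ∈ meanRange μ then ((Function.invFun (deriv (logLaplace μ)) x : ℝ) : EReal)
  else if IsLUB (meanRange μ) x then ⊤
  else ⊥

open Classical in
/-- The map `γ`: `γ(t) = D(μ_t ‖ μ)` for real `t`, and `γ(±∞) = D(δ_s ‖ μ)` where `s` is the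
supremum, respectively the infimum, of `𝒩`. -/
def tiltEntropy (μ : Measure ℝ) (t : EReal) : ℝ≥0∞ :=
  if t = ⊤ then InformationTheory.klDiv (Measure.dirac (sSup (meanRange μ))) μ
  else if t = ⊥ then InformationTheory.klDiv (Measure.dirac (sInf (meanRange μ))) μ
  else InformationTheory.klDiv (expTilt μ t.toReal) μ

/-- Stochastic non-negativity of `μ`. -/
def StochNonneg (μ : Measure ℝ) : Prop :=
  ∀ t : ℝ, 0 < t → -t ∈ meanRange μ →
    t ∈ meanRange μ ∧ tiltEntropy μ (tiltParam μ t) ≤ tiltEntropy μ (tiltParam μ (-t))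

/-- The space `ℒ` of measurable functions `f : [0,1] → cl 𝒩` with `∫ |f| ^ p < ∞`. -/
def funSpace (μ : Measure ℝ) (p : ℝ≥0∞) : Set (unitInterval → ℝ) :=
  {f | Measurable f ∧ (∀ u, f u ∈ closure (meanRange μ)) ∧ MemLp f p volume}

/-- The entropy term `∫ γ(β(f(x))) dx ∈ [0, ∞]`. -/
def entropyTerm (μ : Measure ℝ) (f : unitInterval → ℝ) : ℝ≥0∞ :=
  ∫⁻ u, tiltEntropy μ (tiltParam μ (f u))

/-! ### The interaction: a graph `H` on `v = k + 1` labelled vertices and a kernel `W` -/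

variable {k : ℕ}

/-- The product of `W (x a) (x b)` over the edges `{a, b}` of `H`, each edge taken once. -/
def edgeProd (H : SimpleGraph (Fin (k + 1))) [DecidableRel H.Adj]
    (W : unitInterval → unitInterval → ℝ) (x : Fin (k + 1) → unitInterval) : ℝ :=
  ∏ e : Fin (k + 1) × Fin (k + 1) with e.1 < e.2 ∧ H.Adj e.1 e.2, W (x e.1) (x e.2)

/-- The symmetrised tensor `Sym[W](x_1, …, x_v)`. -/
def symTensor (H : SimpleGraph (Fin (k + 1))) [DecidableRel H.Adj]
    (W : unitInterval → unitInterval → ℝ) (x : Fin (k + 1) → unitInterval) : ℝ :=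
  (1 / ((k + 1).factorial : ℝ)) * ∑ σ : Equiv.Perm (Fin (k + 1)), edgeProd H W (fun a => x (σ a))

/-- The function `𝒯[Sym[W]](x) = ∫ Sym[W](x, x_2, …, x_v) dx_2 ⋯ dx_v`. -/
def symDegree (H : SimpleGraph (Fin (k + 1))) [DecidableRel H.Adj]
    (W : unitInterval → unitInterval → ℝ) (x : unitInterval) : ℝ :=
  ∫ y : Fin k → unitInterval, symTensor H W (Fin.cons x y)

/-- The integrand of `G_W(f)`. -/
def interactionIntegrand (H : SimpleGraph (Fin (k + 1))) [DecidableRel H.Adj]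
    (W : unitInterval → unitInterval → ℝ) (f : unitInterval → ℝ)
    (x : Fin (k + 1) → unitInterval) : ℝ :=
  edgeProd H W x * ∏ a, f (x a)

/-- The functional `G_W(f)`. -/
def interaction (H : SimpleGraph (Fin (k + 1))) [DecidableRel H.Adj]
    (W : unitInterval → unitInterval → ℝ) (f : unitInterval → ℝ) : ℝ :=
  ∫ x, interactionIntegrand H W f x

/-- The integrand, in `(x_2, …, x_v)`, of the local field at `x`. -/
def fieldIntegrand (H : SimpleGraph (Fin (k + 1))) [DecidableRel H.Adj]
    (W : unitInterval → unitInterval → ℝ) (f : unitInterval → ℝ) (x : unitInterval)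
    (y : Fin k → unitInterval) : ℝ :=
  symTensor H W (Fin.cons x y) * ∏ a, f (y a)

/-- The local field `∫ Sym[W](x, x_2, …, x_v) ∏_{a ≥ 2} f(x_a) dx_a`. -/
def localField (H : SimpleGraph (Fin (k + 1))) [DecidableRel H.Adj]
    (W : unitInterval → unitInterval → ℝ) (f : unitInterval → ℝ) (x : unitInterval) : ℝ :=
  ∫ y, fieldIntegrand H W f x y

/-- `W` is a symmetric integrable kernel with `‖W‖_{q Δ} < ∞` for some `q > 1` such that
`1/p + 1/q ≤ 1`, where `Δ` is the maximum degree of `H`. -/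
def IsKernel (H : SimpleGraph (Fin (k + 1))) [DecidableRel H.Adj] (p : ℝ≥0∞)
    (W : unitInterval → unitInterval → ℝ) : Prop :=
  (∀ x y, W x y = W y x) ∧ Integrable (Function.uncurry W) ∧
    ∃ q : ℝ≥0∞, 1 < q ∧ 1 / p + 1 / q ≤ 1 ∧
      MemLp (Function.uncurry W) (q * (H.maxDegree : ℝ≥0∞)) volume

/-- `W` is a.e. strictly positive, and `𝒯[Sym[W]]` is a.e. equal to the constant `c`. -/
def IsPosRegular (H : SimpleGraph (Fin (k + 1))) [DecidableRel H.Adj]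
    (W : unitInterval → unitInterval → ℝ) (c : ℝ) : Prop :=
  (∀ᵐ z : unitInterval × unitInterval, 0 < W z.1 z.2) ∧ ∀ᵐ x, symDegree H W x = c

/-! ### The variational problem -/

/-- The objective `θ G_W(f) + B ∫ f - ∫ γ(β(f))`. -/
def objective (μ : Measure ℝ) (H : SimpleGraph (Fin (k + 1))) [DecidableRel H.Adj]
    (W : unitInterval → unitInterval → ℝ) (θ B : ℝ) (f : unitInterval → ℝ) : ℝ :=
  θ * interaction H W f + B * (∫ u, f u) - (entropyTerm μ f).toReal

/-- `f` is a (global) maximizer of the objective over all `g ∈ ℒ` with `∫ γ(β(g)) < ∞`. -/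
def IsMaximizer (μ : Measure ℝ) (p : ℝ≥0∞) (H : SimpleGraph (Fin (k + 1))) [DecidableRel H.Adj]
    (W : unitInterval → unitInterval → ℝ) (θ B : ℝ) (f : unitInterval → ℝ) : Prop :=
  f ∈ {g ∈ funSpace μ p | entropyTerm μ g < ⊤} ∧
    IsMaxOn (objective μ H W θ B) {g ∈ funSpace μ p | entropyTerm μ g < ⊤} f

end

end MultilinearGibbs

open MultilinearGibbs

/-!
Write `v = k + 1` and let `α = logLaplace μ`.

*The entropy is a Legendre transform.* On `cl 𝒩` the function `γ ∘ β` equals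
`rateFn μ x = sup_t (t x - α(t))` (`tiltEntropy_tiltParam`); at a finite end point `s` of `𝒩` both
are `-log μ{s}`. Hence the entropy is convex, lower semicontinuous and infinite off `cl 𝒩`, and
satisfies the Fenchel-Young inequality, with equality exactly when `x = α'(t)`. The tail condition
makes it grow faster than every multiple of `|x| ^ p` (`rpow_le_rateFn_add`).

*Existence.* Finner's inequality puts the edge product of `W` into `L^q` with `q` conjugate to `p`
(`memLp_edgeProd`), so Hölder's inequality bounds `G_W(f)` by a multiple of `‖f‖_p ^ v`. As `v ≤ p`,
the entropy absorbs this bound, and maximizing sequences stay bounded in `L^p`. A subsequence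
converges weakly in `L²`; along it the entropy is lower semicontinuous, being a supremum of affine
functionals, and `G_W` converges, because by Stone-Weierstrass the edge product is an `L^q` limit of
sums of products of functions of one variable (`exists_isMaximizer`).

*Fixed point equation.* The derivative of `G_W` at `f` is integration against `v` times the local
field. By convexity of the entropy a maximizer `f` also maximizes the linearized functional
`g ↦ ∫ (h g - γ(β(g)))` with `h = θ v (local field) + B`. Comparing `f` with `α'(h)`, the pointwise
maximizer, gives equality in Fenchel-Young, that is `f = α'(h)` (`IsMaximizer.fixedPoint`).

*Replica symmetry.* For a positive `W` of constant degree `c`, the arithmetic-geometric mean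
inequality gives `G_W(f) ≤ c ∫ |f| ^ v`. The parity or positivity assumption provides for each `x` a
constant function worth at least `θ c |x| ^ v + B x - γ(β(x))`. Therefore, if `θ > 0`, a
maximizer has equality in the mean inequality almost everywhere, which forces it to be constant
(`IsMaximizer.ae_const`); if `θ = 0`, the fixed point equation already says so.
The problem is thereby reduced to the maximization of `θ c x ^ v + B x - γ(β(x))` over `x`.

*Bounded support.* If `μ` lives on `[-1, 1]`, then `α''(s) → 0` as `s → ∞`, so that
`x ↦ α'(θ v c x ^ (v - 1) + B)` is a contraction for large `B` and its fixed point is unique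
(`exists_fixedPoint_unique`). If moreover `α'(0) = 0`, then `θ_c` is the supremum of the couplings
for which `θ c x ^ v ≤ γ(β(x))` for all `x`; it is positive by Hoeffding's lemma
(`mem_subcriticalCouplings`), and finite because `𝒩` contains a positive point
(`subcriticalCouplings_bddAbove`).
-/

namespace MultilinearGibbs

open Filter Topology

/-! ### The log-Laplace transform and its exponential tilts -/

section LogLaplace

variable {μ : Measure ℝ}

theorem mem_interior_integrableExpSet
    (hexp : ∀ t : ℝ, Integrable (fun x => Real.exp (t * x)) μ) (t : ℝ) :
    t ∈ interior (integrableExpSet id μ) := by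
  have h : integrableExpSet id μ = univ := eq_univ_of_forall fun t => hexp t
  simp [h]

theorem deriv_logLaplace_mem_meanRange (t : ℝ) : deriv (logLaplace μ) t ∈ meanRange μ :=
  mem_range_self t

theorem analyticAt_logLaplace (hexp : ∀ t : ℝ, Integrable (fun x => Real.exp (t * x)) μ) (t : ℝ) :
    AnalyticAt ℝ (logLaplace μ) t :=
  analyticAt_cgf (mem_interior_integrableExpSet hexp t)

theorem hasDerivAt_logLaplace (hexp : ∀ t : ℝ, Integrable (fun x => Real.exp (t * x)) μ) (t : ℝ) :
    HasDerivAt (logLaplace μ) (deriv (logLaplace μ) t) t :=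
  (analyticAt_logLaplace hexp t).differentiableAt.hasDerivAt

theorem continuous_logLaplace (hexp : ∀ t : ℝ, Integrable (fun x => Real.exp (t * x)) μ) :
    Continuous (logLaplace μ) :=
  continuous_iff_continuousAt.2 fun t => (analyticAt_logLaplace hexp t).continuousAt

theorem continuous_deriv_logLaplace
    (hexp : ∀ t : ℝ, Integrable (fun x => Real.exp (t * x)) μ) :
    Continuous (deriv (logLaplace μ)) :=
  continuous_iff_continuousAt.2 fun t => (analyticAt_logLaplace hexp t).deriv.continuousAt

theorem integral_expTilt (hexp : ∀ t : ℝ, Integrable (fun x => Real.exp (t * x)) μ) (t : ℝ) :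
    ∫ x, x ∂(expTilt μ t) = deriv (logLaplace μ) t :=
  integral_tilted_mul_self (X := id) (mem_interior_integrableExpSet hexp t)

theorem integrable_expTilt (hexp : ∀ t : ℝ, Integrable (fun x => Real.exp (t * x)) μ) (t : ℝ) :
    Integrable (fun x : ℝ => x) (expTilt μ t) := by
  have := memLp_tilted_mul (X := id) (mem_interior_integrableExpSet hexp t) 1
  exact memLp_one_iff_integrable.1 this

theorem variance_expTilt (hexp : ∀ t : ℝ, Integrable (fun x => Real.exp (t * x)) μ) (t : ℝ) :
    variance (fun x : ℝ => x) (expTilt μ t) = deriv (deriv (logLaplace μ)) t := by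
  have := variance_tilted_mul (X := id) (mem_interior_integrableExpSet hexp t)
  rw [iteratedDeriv_succ, iteratedDeriv_one] at this
  exact this

theorem monotone_deriv_logLaplace
    (hexp : ∀ t : ℝ, Integrable (fun x => Real.exp (t * x)) μ) :
    Monotone (deriv (logLaplace μ)) := by
  refine monotone_of_deriv_nonneg
    (fun t => (analyticAt_logLaplace hexp t).deriv.differentiableAt) fun t => ?_
  rw [← variance_expTilt hexp t]
  exact variance_nonneg _ _

/-- The tangent line inequality for the convex function `α`. -/
theorem logLaplace_tangent_le
    (hexp : ∀ t : ℝ, Integrable (fun x => Real.exp (t * x)) μ) (s t : ℝ) :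
    logLaplace μ t + deriv (logLaplace μ) t * (s - t) ≤ logLaplace μ s := by
  have hc : ConvexOn ℝ univ (logLaplace μ) :=
    (monotone_deriv_logLaplace hexp).convexOn_univ_of_deriv
      fun t => (analyticAt_logLaplace hexp t).differentiableAt
  have hd := hasDerivAt_logLaplace hexp t
  rcases lt_trichotomy s t with h | h | h
  · have := hc.slope_le_of_hasDerivAt (mem_univ s) (mem_univ t) h hd
    rw [slope_def_field, div_le_iff₀ (by linarith)] at this
    linarith
  · simp [h]
  · have := hc.le_slope_of_hasDerivAt (mem_univ t) (mem_univ s) h hd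
    rw [slope_def_field, le_div_iff₀ (by linarith)] at this
    linarith

theorem ordConnected_meanRange (hexp : ∀ t : ℝ, Integrable (fun x => Real.exp (t * x)) μ) :
    (meanRange μ).OrdConnected :=
  (isPreconnected_range (continuous_deriv_logLaplace hexp)).ordConnected

theorem isLUB_or_isGLB_of_mem_closure_meanRange
    (hexp : ∀ t : ℝ, Integrable (fun x => Real.exp (t * x)) μ) {x : ℝ}
    (hx : x ∈ closure (meanRange μ)) (hx' : x ∉ meanRange μ) :
    IsLUB (meanRange μ) x ∨ IsGLB (meanRange μ) x := by
  by_contra! h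
  have h1 : ∃ y ∈ meanRange μ, x < y := by
    by_contra! h1
    exact h.1 (isLUB_of_mem_closure h1 hx)
  have h2 : ∃ y ∈ meanRange μ, y < x := by
    by_contra! h2
    exact h.2 (isGLB_of_mem_closure h2 hx)
  obtain ⟨y, hy, hxy⟩ := h1
  obtain ⟨z, hz, hzx⟩ := h2
  exact hx' ((ordConnected_meanRange hexp).out hz hy ⟨hzx.le, hxy.le⟩)

variable [IsProbabilityMeasure μ]

theorem logLaplace_zero : logLaplace μ 0 = 0 := cgf_zero

theorem exp_logLaplace (hexp : ∀ t : ℝ, Integrable (fun x => Real.exp (t * x)) μ) (t : ℝ) :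
    Real.exp (logLaplace μ t) = ∫ x, Real.exp (t * x) ∂μ :=
  exp_cgf (X := id) (hexp t)

theorem isProbabilityMeasure_expTilt
    (hexp : ∀ t : ℝ, Integrable (fun x => Real.exp (t * x)) μ) (t : ℝ) :
    IsProbabilityMeasure (expTilt μ t) :=
  isProbabilityMeasure_tilted (hexp t)

theorem deriv_deriv_logLaplace_pos
    (hexp : ∀ t : ℝ, Integrable (fun x => Real.exp (t * x)) μ)
    (hμ : ∀ a : ℝ, μ ≠ Measure.dirac a) (t : ℝ) :
    0 < deriv (deriv (logLaplace μ)) t := by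
  have := isProbabilityMeasure_expTilt hexp t
  rw [← variance_expTilt hexp t]
  refine lt_of_le_of_ne (variance_nonneg _ _) fun h0 => ?_
  have hL : MemLp (fun x : ℝ => x) 2 (expTilt μ t) := by
    have := memLp_tilted_mul (X := id) (mem_interior_integrableExpSet hexp t) 2
    exact this
  have h1 : evariance (fun x : ℝ => x) (expTilt μ t) = 0 := by
    rw [← hL.ofReal_variance_eq, ← h0, ENNReal.ofReal_zero]
  rw [evariance_eq_zero_iff aemeasurable_id'] at h1
  have h2 : ∀ᵐ x ∂μ, x = ∫ y, y ∂(expTilt μ t) := (absolutelyContinuous_tilted (hexp t)).ae_le h1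
  -- zero variance under the equivalent measure `μ_t` makes `μ` a point mass
  refine hμ (∫ y, y ∂(expTilt μ t)) ?_
  have h3 : μ.map id = μ.map (fun _ => ∫ y, y ∂(expTilt μ t)) := Measure.map_congr h2
  simpa using h3

theorem strictMono_deriv_logLaplace
    (hexp : ∀ t : ℝ, Integrable (fun x => Real.exp (t * x)) μ)
    (hμ : ∀ a : ℝ, μ ≠ Measure.dirac a) : StrictMono (deriv (logLaplace μ)) :=
  strictMono_of_deriv_pos (deriv_deriv_logLaplace_pos hexp hμ)

/-- `μ` charges no point above an upper bound of `𝒩` (Chernoff's bound). -/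
theorem ae_le_of_mem_upperBounds
    (hexp : ∀ t : ℝ, Integrable (fun x => Real.exp (t * x)) μ) {s : ℝ}
    (hs : s ∈ upperBounds (meanRange μ)) : ∀ᵐ x ∂μ, x ≤ s := by
  have key : ∀ ε : ℝ, 0 < ε → μ.real {x : ℝ | s + ε ≤ x} = 0 := by
    intro ε hε
    refine le_antisymm ?_ measureReal_nonneg
    have hle : ∀ t : ℝ, 0 ≤ t → μ.real {x : ℝ | s + ε ≤ x} ≤ Real.exp (-(t * ε)) := by
      intro t ht
      refine (measure_ge_le_exp_cgf (X := id) (s + ε) ht (hexp t)).trans ?_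
      rw [Real.exp_le_exp]
      have h1 := logLaplace_tangent_le hexp 0 t
      rw [logLaplace_zero] at h1
      have h2 : deriv (logLaplace μ) t ≤ s := hs (mem_range_self t)
      have h3 : cgf id μ t = logLaplace μ t := rfl
      nlinarith
    have hlim : Tendsto (fun t : ℝ => Real.exp (-(t * ε))) atTop (𝓝 0) :=
      Real.tendsto_exp_neg_atTop_nhds_zero.comp (tendsto_id.atTop_mul_const hε)
    exact ge_of_tendsto hlim ((eventually_ge_atTop 0).mono hle)
  have h2 : ∀ n : ℕ, ∀ᵐ x ∂μ, x < s + 1 / ((n : ℝ) + 1) := by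
    intro n
    have := key (1 / ((n : ℝ) + 1)) (by positivity)
    rw [measureReal_eq_zero_iff] at this
    rw [ae_iff]
    simpa using this
  filter_upwards [ae_all_iff.2 h2] with x hx
  refine le_of_forall_pos_lt_add fun ε hε => ?_
  obtain ⟨n, hn⟩ := exists_nat_one_div_lt hε
  linarith [hx n]

/-- `μ` charges no point below a lower bound of `𝒩` (Chernoff's bound). -/
theorem ae_ge_of_mem_lowerBounds
    (hexp : ∀ t : ℝ, Integrable (fun x => Real.exp (t * x)) μ) {s : ℝ}
    (hs : s ∈ lowerBounds (meanRange μ)) : ∀ᵐ x ∂μ, s ≤ x := by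
  have key : ∀ ε : ℝ, 0 < ε → μ.real {x : ℝ | x ≤ s - ε} = 0 := by
    intro ε hε
    refine le_antisymm ?_ measureReal_nonneg
    have hle : ∀ t : ℝ, 0 ≤ t → μ.real {x : ℝ | x ≤ s - ε} ≤ Real.exp (-(t * ε)) := by
      intro t ht
      refine (measure_le_le_exp_cgf (X := id) (s - ε) (neg_nonpos.2 ht) (hexp _)).trans ?_
      rw [Real.exp_le_exp]
      have h1 := logLaplace_tangent_le hexp 0 (-t)
      rw [logLaplace_zero] at h1
      have h2 : s ≤ deriv (logLaplace μ) (-t) := hs (mem_range_self (-t))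
      have h3 : cgf id μ (-t) = logLaplace μ (-t) := rfl
      nlinarith
    have hlim : Tendsto (fun t : ℝ => Real.exp (-(t * ε))) atTop (𝓝 0) :=
      Real.tendsto_exp_neg_atTop_nhds_zero.comp (tendsto_id.atTop_mul_const hε)
    exact ge_of_tendsto hlim ((eventually_ge_atTop 0).mono hle)
  have h2 : ∀ n : ℕ, ∀ᵐ x ∂μ, s - 1 / ((n : ℝ) + 1) < x := by
    intro n
    have := key (1 / ((n : ℝ) + 1)) (by positivity)
    rw [measureReal_eq_zero_iff] at this
    rw [ae_iff]
    simpa using this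
  filter_upwards [ae_all_iff.2 h2] with x hx
  refine le_of_forall_pos_lt_add fun ε hε => ?_
  obtain ⟨n, hn⟩ := exists_nat_one_div_lt hε
  linarith [hx n]

end LogLaplace

/-! ### The Legendre transform of the log-Laplace transform -/

section RateFunction

/-- The Legendre transform `sup_t (t x - α(t))` of the log-Laplace transform; it takes values in
`[0, ∞]` because `t = 0` contributes `0`. -/
noncomputable def rateFn (μ : Measure ℝ) (x : ℝ) : ℝ≥0∞ :=
  ⨆ t : ℝ, ENNReal.ofReal (t * x - logLaplace μ t)

variable {μ : Measure ℝ}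

theorem ofReal_le_rateFn (t x : ℝ) : ENNReal.ofReal (t * x - logLaplace μ t) ≤ rateFn μ x :=
  le_iSup (fun t : ℝ => ENNReal.ofReal (t * x - logLaplace μ t)) t

theorem rateFn_le_ofReal {x C : ℝ} (h : ∀ t : ℝ, t * x - logLaplace μ t ≤ C) :
    rateFn μ x ≤ ENNReal.ofReal C :=
  iSup_le fun t => ENNReal.ofReal_le_ofReal (h t)

theorem lowerSemicontinuous_rateFn : LowerSemicontinuous (rateFn μ) :=
  lowerSemicontinuous_iSup fun _ =>
    (ENNReal.continuous_ofReal.comp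
      ((continuous_const.mul continuous_id).sub continuous_const)).lowerSemicontinuous

theorem measurable_rateFn : Measurable (rateFn μ) :=
  lowerSemicontinuous_rateFn.measurable

theorem rateFn_convex {a b : ℝ} (ha : 0 ≤ a) (hb : 0 ≤ b) (hab : a + b = 1) (x y : ℝ) :
    rateFn μ (a * x + b * y) ≤ ENNReal.ofReal a * rateFn μ x + ENNReal.ofReal b * rateFn μ y := by
  refine iSup_le fun t => ?_
  calc ENNReal.ofReal (t * (a * x + b * y) - logLaplace μ t)
      = ENNReal.ofReal (a * (t * x - logLaplace μ t) + b * (t * y - logLaplace μ t)) := by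
        congr 1
        linear_combination logLaplace μ t * hab
    _ ≤ ENNReal.ofReal (a * (t * x - logLaplace μ t))
        + ENNReal.ofReal (b * (t * y - logLaplace μ t)) := ENNReal.ofReal_add_le
    _ ≤ _ := by
        rw [ENNReal.ofReal_mul ha, ENNReal.ofReal_mul hb]
        gcongr <;> exact ofReal_le_rateFn _ _

/-- The Fenchel-Young inequality. -/
theorem fenchel_young {x : ℝ} (hx : rateFn μ x ≠ ⊤) (t : ℝ) :
    t * x - logLaplace μ t ≤ (rateFn μ x).toReal := by
  have h := ENNReal.toReal_mono hx (ofReal_le_rateFn (μ := μ) t x)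
  exact (Real.le_coe_toNNReal _).trans h

/-- The equality case of the Fenchel-Young inequality. -/
theorem eq_deriv_logLaplace_of_fenchel_young_eq
    (hexp : ∀ t : ℝ, Integrable (fun x => Real.exp (t * x)) μ) {x t : ℝ} (hx : rateFn μ x ≠ ⊤)
    (h : (rateFn μ x).toReal ≤ t * x - logLaplace μ t) : x = deriv (logLaplace μ) t := by
  -- `t` maximizes the differentiable function `s ↦ s x - α(s)`
  have hmax : IsLocalMax (fun s => s * x - logLaplace μ s) t :=
    Eventually.of_forall fun s => (fenchel_young hx s).trans h
  have hd : HasDerivAt (fun s => s * x - logLaplace μ s) (1 * x - deriv (logLaplace μ) t) t :=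
    ((hasDerivAt_id t).mul_const x).sub (hasDerivAt_logLaplace hexp t)
  have := hmax.hasDerivAt_eq_zero hd
  linarith

theorem rateFn_deriv_logLaplace
    (hexp : ∀ t : ℝ, Integrable (fun x => Real.exp (t * x)) μ) (t : ℝ) :
    rateFn μ (deriv (logLaplace μ) t)
      = ENNReal.ofReal (t * deriv (logLaplace μ) t - logLaplace μ t) := by
  refine le_antisymm (rateFn_le_ofReal fun s => ?_) (ofReal_le_rateFn _ _)
  have := logLaplace_tangent_le hexp s t
  nlinarith

theorem rateFn_deriv_logLaplace_ne_top
    (hexp : ∀ t : ℝ, Integrable (fun x => Real.exp (t * x)) μ) (t : ℝ) :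
    rateFn μ (deriv (logLaplace μ) t) ≠ ⊤ := by
  rw [rateFn_deriv_logLaplace hexp]; exact ENNReal.ofReal_ne_top

/-- A linear lower bound with arbitrarily large slope forces `rateFn` to be infinite. -/
theorem rateFn_eq_top_of_linear {x δ : ℝ} (hδ : 0 < δ) (σ : ℝ)
    (h : ∀ t : ℝ, 0 ≤ t → t * δ ≤ (σ * t) * x - logLaplace μ (σ * t)) : rateFn μ x = ⊤ := by
  refine ENNReal.eq_top_of_forall_nnreal_le fun r => ?_
  refine le_trans ?_ (ofReal_le_rateFn (σ * (r / δ)) x)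
  have := h (r / δ) (by positivity)
  rw [div_mul_cancel₀ _ hδ.ne'] at this
  calc (r : ℝ≥0∞) = ENNReal.ofReal r := by simp
    _ ≤ _ := ENNReal.ofReal_le_ofReal this

variable [IsProbabilityMeasure μ]

theorem toReal_rateFn_deriv_logLaplace
    (hexp : ∀ t : ℝ, Integrable (fun x => Real.exp (t * x)) μ) (t : ℝ) :
    (rateFn μ (deriv (logLaplace μ) t)).toReal
      = t * deriv (logLaplace μ) t - logLaplace μ t := by
  rw [rateFn_deriv_logLaplace hexp, ENNReal.toReal_ofReal]
  have := logLaplace_tangent_le hexp 0 t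
  rw [logLaplace_zero] at this
  linarith

theorem rateFn_mean (hexp : ∀ t : ℝ, Integrable (fun x => Real.exp (t * x)) μ) :
    rateFn μ (deriv (logLaplace μ) 0) = 0 := by
  rw [rateFn_deriv_logLaplace hexp, logLaplace_zero]; simp

/-- The Legendre transform is infinite off the closure of `𝒩`. -/
theorem mem_closure_meanRange_of_rateFn_ne_top
    (hexp : ∀ t : ℝ, Integrable (fun x => Real.exp (t * x)) μ) {x : ℝ} (hx : rateFn μ x ≠ ⊤) :
    x ∈ closure (meanRange μ) := by
  by_contra hcl
  obtain ⟨δ, hδ, hball⟩ := Metric.isOpen_iff.1 isClosed_closure.isOpen_compl x hcl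
  have hfar : ∀ y ∈ meanRange μ, δ ≤ |y - x| := by
    intro y hy
    by_contra! h
    exact hball (by rwa [Metric.mem_ball, Real.dist_eq]) (subset_closure hy)
  have hside : (∀ y ∈ meanRange μ, y ≤ x - δ) ∨ (∀ y ∈ meanRange μ, x + δ ≤ y) := by
    by_contra! h
    obtain ⟨⟨y, hy, hy'⟩, z, hz, hz'⟩ := h
    have h1 : x < y := by
      rcases le_abs'.1 (hfar y hy) with h | h <;> linarith
    have h2 : z < x := by
      rcases le_abs'.1 (hfar z hz) with h | h <;> linarith
    exact hcl (subset_closure ((ordConnected_meanRange hexp).out hz hy ⟨h2.le, h1.le⟩))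
  rcases hside with h | h
  · refine hx (rateFn_eq_top_of_linear hδ 1 fun t ht => ?_)
    have h1 := logLaplace_tangent_le hexp 0 (1 * t)
    rw [logLaplace_zero] at h1
    have h2 := h _ (mem_range_self (1 * t))
    nlinarith
  · refine hx (rateFn_eq_top_of_linear hδ (-1) fun t ht => ?_)
    have h1 := logLaplace_tangent_le hexp 0 (-1 * t)
    rw [logLaplace_zero] at h1
    have h2 := h _ (mem_range_self (-1 * t))
    nlinarith

end RateFunction

/-! ### Relative entropy as a Legendre transform -/

section Entropy

variable {μ : Measure ℝ} [IsProbabilityMeasure μ]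

theorem klDiv_expTilt (hexp : ∀ t : ℝ, Integrable (fun x => Real.exp (t * x)) μ) (t : ℝ) :
    InformationTheory.klDiv (expTilt μ t) μ
      = ENNReal.ofReal (t * deriv (logLaplace μ) t - logLaplace μ t) := by
  have := isProbabilityMeasure_expTilt hexp t
  have hac : expTilt μ t ≪ μ := tilted_absolutelyContinuous _ _
  have hl : llr (expTilt μ t) μ =ᵐ[expTilt μ t] fun x => t * x - logLaplace μ t :=
    hac.ae_le (log_rnDeriv_tilted_left_self (hexp t))
  have hint := integrable_expTilt hexp t
  have hi : Integrable (fun x : ℝ => t * x - logLaplace μ t) (expTilt μ t) :=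
    (hint.const_mul t).sub (integrable_const _)
  rw [InformationTheory.klDiv_of_ac_of_integrable hac (hi.congr hl.symm), integral_congr_ae hl,
    integral_sub (hint.const_mul t) (integrable_const _), integral_const_mul,
    integral_expTilt hexp]
  simp

/-- If `μ` is carried by one side of `s` (by `(-∞, s]` for `σ > 0`, by `[s, ∞)` for `σ < 0`), then
the relative entropy of the point mass at `s` and the Legendre transform at `s` are both
`-log μ{s}`. The sign `σ` treats the two end points of `𝒩` at once. -/
theorem klDiv_dirac_eq_rateFn (hexp : ∀ t : ℝ, Integrable (fun x => Real.exp (t * x)) μ)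
    {s σ : ℝ} (hσ : σ ≠ 0) (hs : ∀ᵐ x ∂μ, σ * (x - s) ≤ 0) :
    InformationTheory.klDiv (Measure.dirac s) μ = rateFn μ s := by
  -- for an atom of mass `m` the entropy is `-log m`
  have hatom : ∀ (_ : μ {s} ≠ 0),
      InformationTheory.klDiv (Measure.dirac s) μ = ENNReal.ofReal (-Real.log (μ.real {s})) := by
    intro hm
    have hac : Measure.dirac s ≪ μ := by
      refine Measure.AbsolutelyContinuous.mk fun A hA hA0 => ?_
      rw [Measure.dirac_apply' _ hA]
      by_cases hsA : s ∈ A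
      · exact absurd (measure_mono_null (singleton_subset_iff.2 hsA) hA0) hm
      · simp [hsA]
    have hrn : (Measure.dirac s).rnDeriv μ s * μ {s} = 1 := by
      have := Measure.setLIntegral_rnDeriv hac {s}
      rw [lintegral_singleton] at this
      rw [this]
      simp
    have hrn' : (Measure.dirac s).rnDeriv μ s = (μ {s})⁻¹ :=
      ENNReal.eq_inv_of_mul_eq_one_left hrn
    rw [InformationTheory.klDiv_of_ac_of_integrable hac (integrable_dirac (by simp))]
    simp [llr, hrn', Measure.real]
  have hlow : ∀ t : ℝ, Real.exp (t * s) * μ.real {s} ≤ Real.exp (logLaplace μ t) := by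
    intro t
    rw [exp_logLaplace hexp]
    calc Real.exp (t * s) * μ.real {s} = ∫ x in {s}, Real.exp (t * x) ∂μ := by
          rw [integral_singleton, smul_eq_mul, mul_comm]
      _ ≤ _ := setIntegral_le_integral (hexp t) (Eventually.of_forall fun x => (Real.exp_pos _).le)
  refine le_antisymm ?_ ?_
  · by_cases htop : rateFn μ s = ⊤
    · rw [htop]; exact le_top
    -- `exp (-C)` is at most `E exp (σ n (X - s))`, which decreases to `μ{s}` as `n → ∞`
    set C := (rateFn μ s).toReal with hC
    have hbd : ∀ n : ℕ, Real.exp (-C) ≤ ∫ x, Real.exp ((σ * n) * (x - s)) ∂μ := by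
      intro n
      have h1 := fenchel_young htop (σ * n)
      have h2 : ∫ x, Real.exp ((σ * n) * (x - s)) ∂μ
          = Real.exp (logLaplace μ (σ * n) - (σ * n) * s) := by
        rw [Real.exp_sub, exp_logLaplace hexp, ← integral_div]
        congr with x
        rw [← Real.exp_sub]
        congr 1
        ring
      rw [h2, Real.exp_le_exp]
      linarith
    have hlim : Tendsto (fun n : ℕ => ∫ x, Real.exp ((σ * n) * (x - s)) ∂μ) atTop
        (𝓝 (∫ x, indicator {s} (fun _ => (1 : ℝ)) x ∂μ)) := by
      refine tendsto_integral_of_dominated_convergence (fun _ => 1)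
        (fun n => (by fun_prop : Measurable _).aestronglyMeasurable) (integrable_const _)
        (fun n => ?_) ?_
      · filter_upwards [hs] with x hx
        rw [Real.norm_eq_abs, Real.abs_exp, Real.exp_le_one_iff]
        have : (0 : ℝ) ≤ n := n.cast_nonneg
        nlinarith
      · filter_upwards [hs] with x hx
        by_cases hxs : x = s
        · simp [hxs]
        · have hneg : σ * (x - s) < 0 :=
            lt_of_le_of_ne hx (mul_ne_zero hσ (sub_ne_zero.2 hxs))
          rw [indicator_of_notMem (by simpa using hxs)]
          have h3 : Tendsto (fun n : ℕ => (n : ℝ) * (σ * (x - s))) atTop atBot :=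
            tendsto_natCast_atTop_atTop.atTop_mul_const_of_neg hneg
          refine (Real.tendsto_exp_atBot.comp h3).congr fun n => ?_
          simp only [Function.comp]
          congr 1
          ring
    rw [integral_indicator_const _ (measurableSet_singleton s), smul_eq_mul, mul_one] at hlim
    have hm : Real.exp (-C) ≤ μ.real {s} := ge_of_tendsto hlim (Eventually.of_forall hbd)
    have hpos : 0 < μ.real {s} := (Real.exp_pos _).trans_le hm
    rw [hatom (fun h => by simp [Measure.real, h] at hpos), ← ENNReal.ofReal_toReal htop]
    refine ENNReal.ofReal_le_ofReal ?_
    have := (Real.le_log_iff_exp_le hpos).2 hm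
    linarith
  -- conversely `α(t) ≥ t s + log μ{s}` for all `t`
  · by_cases hm : μ {s} = 0
    · rw [InformationTheory.klDiv_of_not_ac]
      · exact le_top
      · intro hac
        have := hac hm
        simp at this
    · rw [hatom hm]
      refine rateFn_le_ofReal fun t => ?_
      have hpos : 0 < μ.real {s} := by
        rw [measureReal_def]; exact ENNReal.toReal_pos hm (measure_ne_top _ _)
      have h1 := Real.log_le_log (by positivity) (hlow t)
      rw [Real.log_mul (Real.exp_pos _).ne' hpos.ne', Real.log_exp, Real.log_exp] at h1
      linarith

/-- On the closure of `𝒩`, the entropy `γ(β(x))` is the Legendre transform of `α`. -/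
theorem tiltEntropy_tiltParam (hexp : ∀ t : ℝ, Integrable (fun x => Real.exp (t * x)) μ)
    {x : ℝ} (hx : x ∈ closure (meanRange μ)) :
    tiltEntropy μ (tiltParam μ x) = rateFn μ x := by
  by_cases hxN : x ∈ meanRange μ
  · have hinv : deriv (logLaplace μ) (Function.invFun (deriv (logLaplace μ)) x) = x :=
      Function.invFun_eq hxN
    rw [tiltParam, if_pos hxN, tiltEntropy, if_neg (EReal.coe_ne_top _),
      if_neg (EReal.coe_ne_bot _), EReal.toReal_coe, klDiv_expTilt hexp,
      ← rateFn_deriv_logLaplace hexp, hinv]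
  by_cases hlub : IsLUB (meanRange μ) x
  · rw [tiltParam, if_neg hxN, if_pos hlub, tiltEntropy, if_pos rfl,
      hlub.csSup_eq (range_nonempty _)]
    refine klDiv_dirac_eq_rateFn hexp one_ne_zero ?_
    filter_upwards [ae_le_of_mem_upperBounds hexp hlub.1] with y hy
    linarith
  · have hglb := (isLUB_or_isGLB_of_mem_closure_meanRange hexp hx hxN).resolve_left hlub
    rw [tiltParam, if_neg hxN, if_neg hlub, tiltEntropy, if_neg bot_ne_top, if_pos rfl,
      hglb.csInf_eq (range_nonempty _)]
    refine klDiv_dirac_eq_rateFn hexp (neg_ne_zero.2 one_ne_zero) ?_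
    filter_upwards [ae_ge_of_mem_lowerBounds hexp hglb.1] with y hy
    linarith

end Entropy

/-! ### Growth of the Legendre transform -/

section Growth

variable {μ : Measure ℝ}

theorem integrable_exp_of_tailCondition [IsProbabilityMeasure μ] {p : ℝ≥0∞} (hp : 1 ≤ p)
    (htail : TailCondition μ p) (t : ℝ) : Integrable (fun x => Real.exp (t * x)) μ := by
  have hmeas : AEStronglyMeasurable (fun x => Real.exp (t * x)) μ :=
    (by fun_prop : Measurable _).aestronglyMeasurable
  by_cases htop : p = ⊤
  · rw [TailCondition, if_pos htop] at htail
    obtain ⟨K, hK⟩ := htail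
    refine Integrable.of_bound hmeas (Real.exp (|t| * K)) ?_
    filter_upwards [hK] with x hx
    rw [Real.norm_eq_abs, Real.abs_exp, Real.exp_le_exp]
    calc t * x ≤ |t * x| := le_abs_self _
      _ = |t| * |x| := abs_mul _ _
      _ ≤ _ := by gcongr
  · rw [TailCondition, if_neg htop] at htail
    have hp1 : 1 ≤ p.toReal := by
      simpa using ENNReal.toReal_mono htop hp
    refine Integrable.mono' ((htail (|t| + 1) (by positivity)).const_mul (Real.exp |t|)) hmeas ?_
    refine Eventually.of_forall fun x => ?_
    rw [Real.norm_eq_abs, Real.abs_exp, ← Real.exp_add, Real.exp_le_exp]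
    have h0 : (0 : ℝ) ≤ |x| ^ p.toReal := by positivity
    have h1 : |x| ≤ 1 + |x| ^ p.toReal := by
      rcases le_total |x| 1 with h | h
      · linarith
      · have := Real.self_le_rpow_of_one_le h hp1
        linarith
    calc t * x ≤ |t * x| := le_abs_self _
      _ = |t| * |x| := abs_mul _ _
      _ ≤ |t| * (1 + |x| ^ p.toReal) := by gcongr
      _ ≤ _ := by linarith

theorem abs_deriv_logLaplace_le [IsProbabilityMeasure μ]
    (hexp : ∀ t : ℝ, Integrable (fun x => Real.exp (t * x)) μ) {K : ℝ}
    (hK : ∀ᵐ x ∂μ, |x| ≤ K) (t : ℝ) : |deriv (logLaplace μ) t| ≤ K := by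
  have := isProbabilityMeasure_expTilt hexp t
  rw [← integral_expTilt hexp]
  have hac : expTilt μ t ≪ μ := tilted_absolutelyContinuous _ _
  have := norm_integral_le_of_norm_le_const (μ := expTilt μ t) (f := fun x => x) (C := K)
    (hac.ae_le hK)
  simpa using this

theorem closure_meanRange_subset [IsProbabilityMeasure μ]
    (hexp : ∀ t : ℝ, Integrable (fun x => Real.exp (t * x)) μ) {K : ℝ}
    (hK : ∀ᵐ x ∂μ, |x| ≤ K) : closure (meanRange μ) ⊆ Icc (-K) K := by
  refine closure_minimal ?_ isClosed_Icc
  rintro _ ⟨t, rfl⟩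
  exact abs_le.1 (abs_deriv_logLaplace_le hexp hK t)

/-- Young's inequality in the form of a tangent inequality for the convex function `|·| ^ r`. -/
theorem young_tangent_abs_rpow {r : ℝ} (hr : 1 < r) (x y : ℝ) :
    r * |x| ^ (r - 1) * |y| ≤ |y| ^ r + (r - 1) * |x| ^ r := by
  have hc := Real.HolderConjugate.conjExponent hr
  have h := Real.young_inequality_of_nonneg (abs_nonneg y)
    (by positivity : (0 : ℝ) ≤ |x| ^ (r - 1)) hc
  have h1 : (|x| ^ (r - 1)) ^ r.conjExponent = |x| ^ r := by
    rw [← Real.rpow_mul (abs_nonneg x)]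
    congr 1
    rw [Real.conjExponent]
    field_simp [(by linarith : r - 1 ≠ 0)]
  rw [h1] at h
  have h2 : r / r.conjExponent = r - 1 := by
    rw [Real.conjExponent]
    have : r - 1 ≠ 0 := by linarith
    field_simp
  have hr0 : 0 < r := by linarith
  calc r * |x| ^ (r - 1) * |y| = r * (|y| * |x| ^ (r - 1)) := by ring
    _ ≤ r * (|y| ^ r / r + |x| ^ r / r.conjExponent) := by gcongr
    _ = r / r * |y| ^ r + r / r.conjExponent * |x| ^ r := by ring
    _ = _ := by rw [h2, div_self hr0.ne', one_mul]

/-- The Legendre transform grows faster than any multiple of `|x| ^ p`. The test point is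
`t = l p |x| ^ (p - 1) sign x`, at which `α(t)` is controlled by Young's inequality. -/
theorem rpow_le_rateFn_add [IsProbabilityMeasure μ] {p : ℝ≥0∞} (hp : 1 < p) (hptop : p ≠ ⊤)
    (htail : TailCondition μ p) {l : ℝ} (hl : 0 < l) :
    ∃ C : ℝ, 0 ≤ C ∧ ∀ x : ℝ, rateFn μ x ≠ ⊤ →
      l * |x| ^ p.toReal ≤ (rateFn μ x).toReal + C := by
  have hexp := integrable_exp_of_tailCondition hp.le htail
  rw [TailCondition, if_neg hptop] at htail
  set r := p.toReal with hr
  have hr1 : 1 < r := by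
    simpa using ENNReal.toReal_strict_mono hptop hp
  set M := ∫ y, Real.exp (l * |y| ^ r) ∂μ with hM
  have hMpos : 0 < M := integral_exp_pos (htail l hl)
  refine ⟨|Real.log M|, abs_nonneg _, fun x hx => ?_⟩
  set t : ℝ := l * (r * |x| ^ (r - 1)) * SignType.sign x with ht
  have htx : t * x = l * r * |x| ^ r := by
    have h1 : (SignType.sign x : ℝ) * x = |x| := by
      rw [mul_comm]; exact self_mul_sign x
    rw [ht, mul_assoc, h1]
    rcases eq_or_ne x 0 with h0 | h0
    · simp [h0, Real.zero_rpow (by linarith : r ≠ 0)]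
    · have : |x| ^ r = |x| ^ (r - 1) * |x| := by
        rw [← Real.rpow_add_one (abs_ne_zero.2 h0)]; congr 1; ring
      rw [this]; ring
  have hty : ∀ y : ℝ, t * y ≤ l * |y| ^ r + l * (r - 1) * |x| ^ r := by
    intro y
    have hs : |(SignType.sign x : ℝ)| ≤ 1 := by
      rcases lt_trichotomy x 0 with h | h | h <;> simp [h]
    calc t * y ≤ |t * y| := le_abs_self _
      _ = (l * (r * |x| ^ (r - 1))) * |(SignType.sign x : ℝ)| * |y| := by
          rw [ht, abs_mul, abs_mul, abs_of_nonneg (by positivity : 0 ≤ l * (r * |x| ^ (r - 1)))]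
      _ ≤ (l * (r * |x| ^ (r - 1))) * 1 * |y| := by gcongr
      _ = l * (r * |x| ^ (r - 1) * |y|) := by ring
      _ ≤ l * (|y| ^ r + (r - 1) * |x| ^ r) := by
          gcongr; exact young_tangent_abs_rpow hr1 x y
      _ = _ := by ring
  have hα : logLaplace μ t ≤ l * (r - 1) * |x| ^ r + Real.log M := by
    rw [← Real.exp_le_exp, exp_logLaplace hexp, Real.exp_add, Real.exp_log hMpos, mul_comm, hM,
      ← integral_mul_const]
    refine integral_mono (hexp t) ((htail l hl).mul_const _) fun y => ?_
    rw [← Real.exp_add, Real.exp_le_exp]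
    exact hty y
  have hfy := fenchel_young hx t
  have := le_abs_self (Real.log M)
  nlinarith

end Growth

/-! ### Finner's inequality -/

section Finner

variable {ι E Ω : Type*} [MeasurableSpace Ω] {ν : Measure Ω} [IsProbabilityMeasure ν]

/-- Hölder's inequality on a probability space with at most `D` factors, each raised to the
power `1 / D`. -/
theorem lintegral_prod_rpow_inv_le (s : Finset E) {D : ℕ} (hD : 0 < D) (hs : s.card ≤ D)
    {g : E → Ω → ℝ≥0∞} (hg : ∀ e, Measurable (g e)) :
    ∫⁻ y, ∏ e ∈ s, g e y ^ (1 / (D : ℝ)) ∂ν ≤ ∏ e ∈ s, (∫⁻ y, g e y ∂ν) ^ (1 / (D : ℝ)) := by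
  have hD' : (0 : ℝ) < D := by exact_mod_cast hD
  have hs' : (s.card : ℝ) ≤ D := by exact_mod_cast hs
  have h := ENNReal.lintegral_mul_prod_norm_pow_le (μ := ν) s (g := fun _ => 1) (f := g)
    aemeasurable_const (fun e _ => (hg e).aemeasurable) (1 - s.card / D)
    (p := fun _ => 1 / (D : ℝ)) (by rw [Finset.sum_const, nsmul_eq_mul]; ring)
    (by rw [sub_nonneg, div_le_one hD']; exact hs') (fun _ _ => by positivity)
  simpa using h

variable [Fintype ι] [DecidableEq ι]

/-- Finner's inequality (a generalized Hölder inequality): functions `F e` depending on the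
coordinates in `A e`, where each coordinate belongs to at most `D` of the sets `A e`. -/
theorem lintegral_prod_le_prod_lintegral_pow (s : Finset E) (A : E → Finset ι) {D : ℕ}
    (hD : 0 < D) (hdeg : ∀ i, (s.filter fun e => i ∈ A e).card ≤ D) {F : E → (ι → Ω) → ℝ≥0∞}
    (hF : ∀ e, Measurable (F e))
    (hdep : ∀ e x y, (∀ i ∈ A e, x i = y i) → F e x = F e y) :
    ∫⁻ x, ∏ e ∈ s, F e x ∂(Measure.pi fun _ => ν)
      ≤ ∏ e ∈ s, (∫⁻ x, F e x ^ (D : ℝ) ∂(Measure.pi fun _ => ν)) ^ (1 / (D : ℝ)) := by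
  have hD' : (D : ℝ) ≠ 0 := by exact_mod_cast hD.ne'
  have hFD : ∀ e, Measurable fun x => F e x ^ (D : ℝ) := fun e => (hF e).pow_const _
  have hprod : Measurable fun x => ∏ e ∈ s, F e x := Finset.measurable_fun_prod _ fun e _ => hF e
  -- integrate out the coordinates one at a time
  have key : ∀ (S : Finset ι) (x : ι → Ω),
      (∫⋯∫⁻_S, (fun x => ∏ e ∈ s, F e x) ∂(fun _ => ν)) x
        ≤ ∏ e ∈ s, ((∫⋯∫⁻_S, (fun x => F e x ^ (D : ℝ)) ∂(fun _ => ν)) x) ^ (1 / (D : ℝ)) := by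
    intro S
    induction S using Finset.induction with
    | empty =>
      intro x
      simp only [lmarginal_empty]
      refine (Finset.prod_congr rfl fun e _ => ?_).le
      rw [← ENNReal.rpow_mul, mul_one_div_cancel hD', ENNReal.rpow_one]
    | insert i S hi ih =>
      intro x
      set K : E → (ι → Ω) → ℝ≥0∞ := fun e => ∫⋯∫⁻_S, (fun x => F e x ^ (D : ℝ)) ∂(fun _ => ν)
        with hK
      have hKm : ∀ e, Measurable (K e) := fun e => (hFD e).lmarginal _
      have hindep : ∀ e, i ∉ A e → ∀ y, K e (Function.update x i y) = K e x := by
        intro e hie y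
        simp only [hK, lmarginal]
        refine lintegral_congr fun z => ?_
        rw [hdep e (Function.updateFinset (Function.update x i y) S z)
          (Function.updateFinset x S z)]
        intro j hj
        have hji : j ≠ i := fun h => hie (h ▸ hj)
        simp only [Function.updateFinset]
        split_ifs
        · rfl
        · rw [Function.update_of_ne hji]
      have hins : ∀ e, (∫⋯∫⁻_(insert i S), (fun x => F e x ^ (D : ℝ)) ∂(fun _ => ν)) x
          = ∫⁻ y, K e (Function.update x i y) ∂ν := fun e => lmarginal_insert _ (hFD e) hi x
      rw [lmarginal_insert _ hprod hi]
      calc ∫⁻ y, (∫⋯∫⁻_S, (fun x => ∏ e ∈ s, F e x) ∂(fun _ => ν)) (Function.update x i y) ∂ν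
          ≤ ∫⁻ y, ∏ e ∈ s, K e (Function.update x i y) ^ (1 / (D : ℝ)) ∂ν :=
            lintegral_mono fun y => ih _
        _ = ∫⁻ y, (∏ e ∈ s.filter (fun e => i ∈ A e), K e (Function.update x i y) ^ (1 / (D : ℝ)))
              * ∏ e ∈ s.filter (fun e => ¬ i ∈ A e), K e x ^ (1 / (D : ℝ)) ∂ν := by
            refine lintegral_congr fun y => ?_
            rw [← Finset.prod_filter_mul_prod_filter_not s (fun e => i ∈ A e)]
            congr 1
            refine Finset.prod_congr rfl fun e he => ?_
            rw [hindep e (Finset.mem_filter.1 he).2]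
        _ = (∫⁻ y, ∏ e ∈ s.filter (fun e => i ∈ A e),
                K e (Function.update x i y) ^ (1 / (D : ℝ)) ∂ν)
              * ∏ e ∈ s.filter (fun e => ¬ i ∈ A e), K e x ^ (1 / (D : ℝ)) := by
            refine lintegral_mul_const _ (Finset.measurable_fun_prod _ fun e _ => ?_)
            exact ((hKm e).comp (measurable_update x)).pow_const _
        _ ≤ (∏ e ∈ s.filter (fun e => i ∈ A e),
                (∫⁻ y, K e (Function.update x i y) ∂ν) ^ (1 / (D : ℝ)))
              * ∏ e ∈ s.filter (fun e => ¬ i ∈ A e), K e x ^ (1 / (D : ℝ)) := by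
            gcongr
            exact lintegral_prod_rpow_inv_le _ hD (hdeg i)
              fun e => (hKm e).comp (measurable_update x)
        _ = ∏ e ∈ s, ((∫⋯∫⁻_(insert i S), (fun x => F e x ^ (D : ℝ)) ∂(fun _ => ν)) x)
              ^ (1 / (D : ℝ)) := by
            rw [← Finset.prod_filter_mul_prod_filter_not s (fun e => i ∈ A e)
              (fun e => ((∫⋯∫⁻_(insert i S), (fun x => F e x ^ (D : ℝ)) ∂(fun _ => ν)) x)
                ^ (1 / (D : ℝ)))]
            congr 1
            · exact Finset.prod_congr rfl fun e _ => by rw [hins e]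
            · refine Finset.prod_congr rfl fun e he => ?_
              rw [hins e]
              simp_rw [hindep e (Finset.mem_filter.1 he).2]
              simp
  obtain ⟨ω⟩ : Nonempty Ω := ν.nonempty_of_neZero
  have := key Finset.univ fun _ => ω
  simpa only [lmarginal_univ] using this

end Finner

/-! ### Multilinear forms on product spaces -/

section Product

variable {ι Ω : Type*} [Fintype ι] [MeasurableSpace Ω] {ν : Measure Ω} [IsProbabilityMeasure ν]

theorem ae_eval_of_ae {Q : Ω → Prop} (h : ∀ᵐ u ∂ν, Q u) (a : ι) :
    ∀ᵐ x ∂(Measure.pi fun _ : ι => ν), Q (x a) :=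
  (measurePreserving_eval (fun _ : ι => ν) a).quasiMeasurePreserving.ae h

theorem measurePreserving_eval_pair {i j : ι} (hij : i ≠ j) :
    MeasurePreserving (fun x : ι → Ω => (x i, x j)) (Measure.pi fun _ => ν) (ν.prod ν) := by
  have hind : iIndepFun (fun (i : ι) (x : ι → Ω) => x i) (Measure.pi fun _ => ν) :=
    iIndepFun_pi (X := fun _ => id) fun _ => aemeasurable_id
  refine ⟨by fun_prop, ?_⟩
  rw [(indepFun_iff_map_prod_eq_prod_map_map (measurable_pi_apply i).aemeasurable
      (measurable_pi_apply j).aemeasurable).1 (hind.indepFun hij),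
    (measurePreserving_eval (fun _ : ι => ν) i).map_eq,
    (measurePreserving_eval (fun _ : ι => ν) j).map_eq]

theorem prod_eval_ae_eq {F F' : ι → Ω → ℝ} (h : ∀ a, F a =ᵐ[ν] F' a) :
    (fun x : ι → Ω => ∏ a, F a (x a)) =ᵐ[Measure.pi fun _ => ν] fun x => ∏ a, F' a (x a) := by
  have h1 := ae_all_iff.2 fun a => ae_eval_of_ae (ι := ι) (h a) a
  filter_upwards [h1] with x hx
  exact Finset.prod_congr rfl fun a _ => hx a

theorem aestronglyMeasurable_prod_eval {F : ι → Ω → ℝ} (hF : ∀ a, AEStronglyMeasurable (F a) ν) :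
    AEStronglyMeasurable (fun x : ι → Ω => ∏ a, F a (x a)) (Measure.pi fun _ => ν) :=
  Finset.aestronglyMeasurable_fun_prod _ fun a _ =>
    (hF a).comp_measurePreserving (measurePreserving_eval (fun _ : ι => ν) a)

/-- The `L^p` norm of `x ↦ ∏ F a (x a)` is at most (in fact equal to) the product of the norms; for
finite `p` this is Finner's inequality for singletons. -/
theorem eLpNorm_prod_eval_le {p : ℝ≥0∞} (hp : p ≠ 0) {F : ι → Ω → ℝ}
    (hF : ∀ a, AEStronglyMeasurable (F a) ν) :
    eLpNorm (fun x : ι → Ω => ∏ a, F a (x a)) p (Measure.pi fun _ => ν)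
      ≤ ∏ a, eLpNorm (F a) p ν := by
  classical
  by_cases htop : p = ⊤
  · subst htop
    simp only [eLpNorm_exponent_top]
    refine essSup_le_of_ae_le _ ?_
    have h1 := ae_all_iff.2 fun a =>
      ae_eval_of_ae (ι := ι) (enorm_ae_le_eLpNormEssSup (F a) ν) a
    filter_upwards [h1] with x hx
    rw [← ofReal_norm, norm_prod, ENNReal.ofReal_prod_of_nonneg fun _ _ => norm_nonneg _]
    refine Finset.prod_le_prod' fun a _ => ?_
    rw [ofReal_norm]
    exact hx a
  -- pass to measurable representatives
  set G : ι → Ω → ℝ := fun a => (hF a).mk (F a) with hG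
  have hGm : ∀ a, Measurable (G a) := fun a => (hF a).stronglyMeasurable_mk.measurable
  rw [eLpNorm_congr_ae (prod_eval_ae_eq fun a => (hF a).ae_eq_mk)]
  rw [Finset.prod_congr rfl fun a _ => eLpNorm_congr_ae (p := p) (hF a).ae_eq_mk]
  have hp0 : 0 < p.toReal := ENNReal.toReal_pos hp htop
  simp only [eLpNorm_eq_lintegral_rpow_enorm_toReal hp htop]
  rw [ENNReal.prod_rpow_of_nonneg (by positivity)]
  gcongr
  have h := lintegral_prod_le_prod_lintegral_pow (ν := ν) (Finset.univ : Finset ι)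
    (fun a => {a}) (D := 1) one_pos (fun i => by
      refine Finset.card_le_one.2 fun a ha b hb => ?_
      simp only [Finset.mem_filter, Finset.mem_univ, true_and, Finset.mem_singleton] at ha hb
      exact ha.symm.trans hb)
    (F := fun a x => ‖G a (x a)‖ₑ ^ p.toReal)
    (fun a => (((hGm a).comp (measurable_pi_apply a)).enorm).pow_const _)
    (fun a x y hxy => by simp only [hxy a (Finset.mem_singleton_self a)])
  simp only [Nat.cast_one, ENNReal.rpow_one, div_one] at h
  refine le_trans (le_of_eq ?_) (h.trans (le_of_eq ?_))
  · refine lintegral_congr fun x => ?_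
    rw [ENNReal.prod_rpow_of_nonneg hp0.le, ← ofReal_norm, norm_prod,
      ENNReal.ofReal_prod_of_nonneg fun _ _ => norm_nonneg _]
    simp only [ofReal_norm, hG]
  · refine Finset.prod_congr rfl fun a _ => ?_
    exact (measurePreserving_eval (fun _ : ι => ν) a).lintegral_comp
      ((hGm a).enorm.pow_const _)

theorem memLp_prod_eval {p : ℝ≥0∞} (hp : p ≠ 0) {F : ι → Ω → ℝ} (hF : ∀ a, MemLp (F a) p ν) :
    MemLp (fun x : ι → Ω => ∏ a, F a (x a)) p (Measure.pi fun _ => ν) :=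
  ⟨aestronglyMeasurable_prod_eval fun a => (hF a).1,
    (eLpNorm_prod_eval_le hp fun a => (hF a).1).trans_lt
      (ENNReal.prod_lt_top fun a _ => (hF a).2)⟩

variable {p q : ℝ≥0∞} [ENNReal.HolderTriple p q 1] {P : (ι → Ω) → ℝ} {F : ι → Ω → ℝ}

theorem integrable_mul_prod_eval (hp : p ≠ 0) (hP : MemLp P q (Measure.pi fun _ => ν))
    (hF : ∀ a, MemLp (F a) p ν) :
    Integrable (fun x => P x * ∏ a, F a (x a)) (Measure.pi fun _ => ν) := by
  have : ENNReal.HolderTriple q p 1 := ENNReal.HolderTriple.symm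
  exact memLp_one_iff_integrable.1 ((memLp_prod_eval hp hF).mul hP)

/-- The Hölder bound for the multilinear form `∫ P ∏ F a (x a)`. -/
theorem abs_integral_mul_prod_eval_le (hp : p ≠ 0) (hP : MemLp P q (Measure.pi fun _ => ν))
    (hF : ∀ a, MemLp (F a) p ν) :
    |∫ x, P x * ∏ a, F a (x a) ∂(Measure.pi fun _ => ν)|
      ≤ (eLpNorm P q (Measure.pi fun _ => ν)).toReal * ∏ a, (eLpNorm (F a) p ν).toReal := by
  have : ENNReal.HolderTriple q p 1 := ENNReal.HolderTriple.symm
  have h1 : eLpNorm (fun x => P x * ∏ a, F a (x a)) 1 (Measure.pi fun _ => ν)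
      ≤ eLpNorm P q (Measure.pi fun _ => ν) * ∏ a, eLpNorm (F a) p ν := by
    have := eLpNorm_smul_le_mul_eLpNorm (p := q) (q := p) (r := 1) (memLp_prod_eval hp hF).1 hP.1
    refine le_trans this ?_
    gcongr
    exact eLpNorm_prod_eval_le hp fun a => (hF a).1
  have h2 : ENNReal.ofReal |∫ x, P x * ∏ a, F a (x a) ∂(Measure.pi fun _ => ν)|
      ≤ eLpNorm P q (Measure.pi fun _ => ν) * ∏ a, eLpNorm (F a) p ν := by
    refine le_trans ?_ h1
    rw [eLpNorm_one_eq_lintegral_enorm, ← Real.norm_eq_abs, ofReal_norm]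
    exact enorm_integral_le_lintegral_enorm _
  have hfin : eLpNorm P q (Measure.pi fun _ => ν) * ∏ a, eLpNorm (F a) p ν ≠ ⊤ :=
    ENNReal.mul_ne_top hP.2.ne (ENNReal.prod_ne_top fun a _ => (hF a).2.ne)
  have h3 := ENNReal.toReal_mono hfin h2
  rwa [ENNReal.toReal_ofReal (abs_nonneg _), ENNReal.toReal_mul, ENNReal.toReal_prod] at h3

end Product

/-! ### Integrability of the edge product -/

section Kernel

variable {k : ℕ} {H : SimpleGraph (Fin (k + 1))} [DecidableRel H.Adj]
  {W : unitInterval → unitInterval → ℝ}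

/-- The exponent conjugate to `p`; unlike the exponent `q` in `IsKernel` it is always finite when
`p > 1`, also for `p = ∞`. -/
noncomputable def conjExp (p : ℝ≥0∞) : ℝ≥0∞ := (1 - p⁻¹)⁻¹

theorem holderTriple_conjExp {p : ℝ≥0∞} (hp : 1 ≤ p) : ENNReal.HolderTriple p (conjExp p) 1 := by
  refine ⟨?_⟩
  rw [conjExp, inv_inv, inv_one]
  exact add_tsub_cancel_of_le (ENNReal.inv_le_one.2 hp)

theorem conjExp_ne_top {p : ℝ≥0∞} (hp : 1 < p) : conjExp p ≠ ⊤ := by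
  rw [conjExp, Ne, ENNReal.inv_eq_top, tsub_eq_zero_iff_le, not_le]
  exact ENNReal.inv_lt_one.2 hp

theorem one_le_conjExp (p : ℝ≥0∞) : 1 ≤ conjExp p := by
  rw [conjExp, ENNReal.one_le_inv]
  exact tsub_le_self

theorem conjExp_le {p q : ℝ≥0∞} (hpq : 1 / p + 1 / q ≤ 1) : conjExp p ≤ q := by
  rw [one_div, one_div] at hpq
  rw [conjExp, ENNReal.inv_le_iff_inv_le]
  refine ENNReal.le_sub_of_add_le_left ?_ hpq
  exact (lt_of_le_of_lt (le_self_add.trans hpq) ENNReal.one_lt_top).ne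

/-- A vertex lies on at most `Δ` edges, an edge being listed once, with its smaller end first. -/
theorem card_edges_le_maxDegree (i : Fin (k + 1)) :
    (((Finset.univ : Finset (Fin (k + 1) × Fin (k + 1))).filter
      fun e => e.1 < e.2 ∧ H.Adj e.1 e.2).filter
        fun e => i ∈ ({e.1, e.2} : Finset (Fin (k + 1)))).card ≤ H.maxDegree := by
  refine le_trans ?_ (H.degree_le_maxDegree i)
  rw [← H.card_neighborFinset_eq_degree]
  -- send an edge at `i` to its other endpoint
  refine Finset.card_le_card_of_injOn (fun e => if e.1 = i then e.2 else e.1) ?_ ?_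
  · rintro ⟨a, b⟩ he
    simp only [Finset.coe_filter, Finset.mem_filter, Finset.mem_univ, true_and,
      Finset.mem_insert, Finset.mem_singleton, mem_ofPred_eq] at he
    obtain ⟨⟨_, hab⟩, h⟩ := he
    simp only [Finset.mem_coe, SimpleGraph.mem_neighborFinset]
    split_ifs with h1
    · exact h1 ▸ hab
    · rcases h with h | h
      · exact absurd h.symm h1
      · exact h ▸ hab.symm
  · rintro ⟨a, b⟩ he ⟨a', b'⟩ he' h
    simp only [Finset.coe_filter, Finset.mem_filter, Finset.mem_univ, true_and,
      Finset.mem_insert, Finset.mem_singleton, mem_ofPred_eq] at he he' h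
    grind

theorem edgeProd_ae_eq {W' : unitInterval → unitInterval → ℝ}
    (h : Function.uncurry W =ᵐ[volume] Function.uncurry W') :
    edgeProd H W =ᵐ[volume] edgeProd H W' := by
  have h1 : ∀ e : Fin (k + 1) × Fin (k + 1), e.1 < e.2 →
      ∀ᵐ x : Fin (k + 1) → unitInterval, W (x e.1) (x e.2) = W' (x e.1) (x e.2) := by
    intro e he
    exact (measurePreserving_eval_pair (ν := (volume : Measure unitInterval))
      he.ne).quasiMeasurePreserving.ae h
  have h2 : ∀ e : Fin (k + 1) × Fin (k + 1),
      ∀ᵐ x : Fin (k + 1) → unitInterval, e.1 < e.2 → W (x e.1) (x e.2) = W' (x e.1) (x e.2) := by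
    intro e
    by_cases he : e.1 < e.2
    · filter_upwards [h1 e he] with x hx _ using hx
    · exact Eventually.of_forall fun x h => absurd h he
  filter_upwards [ae_all_iff.2 h2] with x hx
  exact Finset.prod_congr rfl fun e he => hx e (Finset.mem_filter.1 he).2.1

theorem measurable_edgeProd (hW : Measurable (Function.uncurry W)) : Measurable (edgeProd H W) := by
  refine Finset.measurable_fun_prod _ fun e _ => ?_
  have h : Measurable fun x : Fin (k + 1) → unitInterval => (x e.1, x e.2) :=
    (measurable_pi_apply e.1).prodMk (measurable_pi_apply e.2)
  exact hW.comp h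

/-- The edge product belongs to `L^q` with `q` conjugate to `p`: by Finner's inequality its `L^q`
norm is at most a power of the `L^{qΔ}` norm of `W`. -/
theorem memLp_edgeProd {p : ℝ≥0∞} (hp : 1 < p) (hW : IsKernel H p W) :
    MemLp (edgeProd H W) (conjExp p) volume := by
  obtain ⟨-, hint, q, -, hpq, hLp⟩ := hW
  set r := conjExp p with hr
  have hrtop : r ≠ ⊤ := conjExp_ne_top hp
  have hr0 : r ≠ 0 := (zero_lt_one.trans_le (one_le_conjExp p)).ne'
  have hr0' : 0 < r.toReal := ENNReal.toReal_pos hr0 hrtop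
  have hLr : MemLp (Function.uncurry W) (r * (H.maxDegree : ℝ≥0∞)) volume := by
    refine hLp.mono_exponent ?_
    gcongr
    exact conjExp_le hpq
  set V : unitInterval × unitInterval → ℝ := hint.1.mk _ with hV
  have hVm : Measurable V := hint.1.stronglyMeasurable_mk.measurable
  have hWV : Function.uncurry W =ᵐ[volume] V := hint.1.ae_eq_mk
  have hVr : MemLp V (r * (H.maxDegree : ℝ≥0∞)) volume := hLr.ae_eq hWV
  set W' : unitInterval → unitInterval → ℝ := fun x y => V (x, y) with hW'
  have hWW' : edgeProd H W =ᵐ[volume] edgeProd H W' := edgeProd_ae_eq hWV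
  refine MemLp.ae_eq hWW'.symm ⟨(measurable_edgeProd (W := W') hVm).aestronglyMeasurable, ?_⟩
  set s := (Finset.univ : Finset (Fin (k + 1) × Fin (k + 1))).filter
    fun e => e.1 < e.2 ∧ H.Adj e.1 e.2 with hs
  rw [eLpNorm_lt_top_iff_lintegral_rpow_enorm_lt_top hr0 hrtop]
  rcases Nat.eq_zero_or_pos H.maxDegree with hΔ | hΔ
  -- for `Δ = 0` there are no edges, and the hypothesis on `‖W‖_{qΔ}` is void
  · have hse : s = ∅ := by
      rw [Finset.eq_empty_iff_forall_notMem]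
      rintro ⟨a, b⟩ he
      have h1 : 0 < H.degree a := (H.degree_pos_iff_exists_adj a).2
        ⟨b, (Finset.mem_filter.1 he).2.2⟩
      have h2 := H.degree_le_maxDegree a
      omega
    have : ∀ x, edgeProd H W' x = 1 := by
      intro x
      have : edgeProd H W' x = ∏ e ∈ s, W' (x e.1) (x e.2) := rfl
      rw [this, hse, Finset.prod_empty]
    simp [this]
  · refine lt_of_le_of_lt (le_trans (le_of_eq ?_)
      (lintegral_prod_le_prod_lintegral_pow (ν := (volume : Measure unitInterval)) s
        (fun e => ({e.1, e.2} : Finset (Fin (k + 1)))) hΔ card_edges_le_maxDegree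
        (F := fun e x => ‖V (x e.1, x e.2)‖ₑ ^ r.toReal) (fun e => ?_) (fun e x y hxy => ?_))) ?_
    · refine lintegral_congr fun x => ?_
      rw [ENNReal.prod_rpow_of_nonneg hr0'.le, ← ofReal_norm, edgeProd, norm_prod,
        ENNReal.ofReal_prod_of_nonneg fun _ _ => norm_nonneg _]
      simp only [ofReal_norm, hW', hs]
    · exact ((hVm.comp ((measurable_pi_apply e.1).prodMk
        (measurable_pi_apply e.2))).enorm).pow_const _
    · simp only [hxy e.1 (by simp), hxy e.2 (by simp)]
    · refine ENNReal.prod_lt_top fun e he => ?_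
      refine ENNReal.rpow_lt_top_of_nonneg (by positivity) (ne_of_lt ?_)
      have hΔ' : (H.maxDegree : ℝ≥0∞) ≠ 0 := by exact_mod_cast hΔ.ne'
      have h2 : ∫⁻ z, ‖V z‖ₑ ^ (r * (H.maxDegree : ℝ≥0∞)).toReal ∂(volume.prod volume) < ⊤ :=
        (eLpNorm_lt_top_iff_lintegral_rpow_enorm_lt_top (mul_ne_zero hr0 hΔ')
        (ENNReal.mul_ne_top hrtop (ENNReal.natCast_ne_top _))).1 hVr.2
      have hmp := measurePreserving_eval_pair (ν := (volume : Measure unitInterval))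
        (Finset.mem_filter.1 he).2.1.ne
      rw [ENNReal.toReal_mul, ENNReal.toReal_natCast] at h2
      rw [← hmp.lintegral_comp (hVm.enorm.pow_const _)] at h2
      refine lt_of_le_of_lt (le_of_eq ?_) h2
      refine lintegral_congr fun x => ?_
      rw [ENNReal.rpow_mul]

theorem measurePreserving_permute (σ : Equiv.Perm (Fin (k + 1))) :
    MeasurePreserving (fun (x : Fin (k + 1) → unitInterval) a => x (σ a)) := by
  have h := volume_measurePreserving_piCongrLeft (fun _ : Fin (k + 1) => unitInterval) σ.symm
  have h1 : (MeasurableEquiv.piCongrLeft (fun _ : Fin (k + 1) => unitInterval) σ.symm :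
      (Fin (k + 1) → unitInterval) → Fin (k + 1) → unitInterval) = fun x a => x (σ a) := by
    ext x a
    have := MeasurableEquiv.piCongrLeft_apply_apply σ.symm (β := fun _ => unitInterval) x (σ a)
    rw [Equiv.symm_apply_apply] at this
    rw [this]
  rwa [h1] at h

theorem symTensor_permute (τ : Equiv.Perm (Fin (k + 1))) (x : Fin (k + 1) → unitInterval) :
    symTensor H W (fun a => x (τ a)) = symTensor H W x := by
  unfold symTensor
  congr 1
  exact Fintype.sum_equiv (Equiv.mulLeft τ) _ _ fun σ => rfl

theorem memLp_symTensor {p : ℝ≥0∞} (hp : 1 < p) (hW : IsKernel H p W) :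
    MemLp (symTensor H W) (conjExp p) volume := by
  refine MemLp.const_mul ?_ _
  refine memLp_finsetSum _ fun σ _ => ?_
  exact (memLp_edgeProd hp hW).comp_measurePreserving (measurePreserving_permute σ)

end Kernel

/-! ### Weak compactness in `L²` -/

section WeakConvergence

/-- Weak convergence in `L²([0,1])`, phrased for functions rather than classes. -/
def WeakTendsto (f : ℕ → unitInterval → ℝ) (g : unitInterval → ℝ) : Prop :=
  ∀ φ : unitInterval → ℝ, MemLp φ 2 volume →
    Tendsto (fun n => ∫ u, φ u * f n u) atTop (𝓝 (∫ u, φ u * g u))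

/-- Sequential weak compactness of balls of `L²([0,1])`, with measurable limits. -/
theorem exists_weakTendsto_subseq {f : ℕ → unitInterval → ℝ} (hf : ∀ n, MemLp (f n) 2 volume)
    {R : ℝ≥0∞} (hR : R ≠ ⊤) (hfR : ∀ n, eLpNorm (f n) 2 volume ≤ R) :
    ∃ g : unitInterval → ℝ, Measurable g ∧ MemLp g 2 volume ∧
      ∃ ψ : ℕ → ℕ, StrictMono ψ ∧ WeakTendsto (fun n => f (ψ n)) g := by
  have : Fact ((2 : ℝ≥0∞) ≠ ⊤) := ⟨by simp⟩
  let X := Lp ℝ 2 (volume : Measure unitInterval)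
  let F : ℕ → X := fun n => (hf n).toLp
  let L : ℕ → WeakDual ℝ X := fun n =>
    StrongDual.toWeakDual (InnerProductSpace.toDual ℝ X (F n))
  have hL : ∀ n, L n ∈ WeakDual.toStrongDual (𝕜 := ℝ) (E := X) ⁻¹'
      Metric.closedBall 0 R.toReal := by
    intro n
    have h1 : ‖InnerProductSpace.toDual ℝ X (F n)‖ ≤ R.toReal := by
      rw [LinearIsometryEquiv.norm_map, Lp.norm_toLp]
      exact ENNReal.toReal_mono hR (hfR n)
    have h2 : WeakDual.toStrongDual (L n) = InnerProductSpace.toDual ℝ X (F n) := rfl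
    rw [mem_preimage, mem_closedBall_zero_iff, h2]
    exact h1
  obtain ⟨ℓ, -, ψ, hψ, hlim⟩ := WeakDual.isSeqCompact_closedBall ℝ X 0 R.toReal hL
  let G : X := (InnerProductSpace.toDual ℝ X).symm (WeakDual.toStrongDual ℓ)
  have hGm := (Lp.memLp G)
  refine ⟨hGm.1.mk _, hGm.1.stronglyMeasurable_mk.measurable, hGm.ae_eq hGm.1.ae_eq_mk, ψ, hψ,
    fun φ hφ => ?_⟩
  have h1 : Tendsto (fun n => L (ψ n) hφ.toLp) atTop (𝓝 (ℓ hφ.toLp)) :=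
    ((WeakDual.eval_continuous (hφ.toLp)).tendsto ℓ).comp hlim
  have h2 : ∀ n, L n hφ.toLp = ∫ u, φ u * f n u := by
    intro n
    have : L n hφ.toLp = inner ℝ (F n) hφ.toLp := rfl
    rw [this, L2.inner_def]
    refine integral_congr_ae ?_
    filter_upwards [(hf n).coeFn_toLp, hφ.coeFn_toLp] with u h1 h2
    rw [h2, h1]
    rfl
  have h3 : ℓ hφ.toLp = ∫ u, φ u * hGm.1.mk _ u := by
    have h4 : ℓ hφ.toLp = inner ℝ G hφ.toLp :=
      (InnerProductSpace.toDual_symm_apply (𝕜 := ℝ) (y := WeakDual.toStrongDual ℓ)).symm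
    rw [h4, L2.inner_def]
    refine integral_congr_ae ?_
    filter_upwards [hGm.1.ae_eq_mk, hφ.coeFn_toLp] with u h1 h2
    rw [h2, ← h1]
    rfl
  simp only [h2, h3] at h1
  exact h1

end WeakConvergence

/-! ### Weak continuity of multilinear forms -/

section WeakContinuity

variable {ι : Type*} [Fintype ι]

/-- The products `x ↦ ∏ φ a (x a)` of continuous functions of one variable. -/
def productFunctions (ι : Type*) [Fintype ι] : Submonoid C(ι → unitInterval, ℝ) where
  carrier := {P | ∃ φ : ι → C(unitInterval, ℝ), ∀ x, P x = ∏ a, φ a (x a)}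
  one_mem' := ⟨fun _ => 1, fun x => by simp⟩
  mul_mem' := by
    rintro P Q ⟨φ, hφ⟩ ⟨ψ, hψ⟩
    exact ⟨fun a => φ a * ψ a, fun x => by simp [hφ, hψ, Finset.prod_mul_distrib]⟩

/-- Sums of products of continuous functions of one variable are uniformly dense
(Stone-Weierstrass). -/
theorem exists_span_productFunctions_near (P : C(ι → unitInterval, ℝ)) {ε : ℝ} (hε : 0 < ε) :
    ∃ Q ∈ Submodule.span ℝ (productFunctions ι : Set C(ι → unitInterval, ℝ)), ‖Q - P‖ < ε := by
  classical
  have hsep :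
      (Algebra.adjoin ℝ (productFunctions ι : Set C(ι → unitInterval, ℝ))).SeparatesPoints := by
    intro x y hxy
    obtain ⟨a, ha⟩ := Function.ne_iff.1 hxy
    let P : C(ι → unitInterval, ℝ) := ⟨fun x => (x a : ℝ), by fun_prop⟩
    refine ⟨P, ⟨P, Algebra.subset_adjoin ⟨fun b => if b = a then ⟨fun u => (u : ℝ), by fun_prop⟩
      else 1, fun z => ?_⟩, rfl⟩, fun h => ha (Subtype.ext h)⟩
    rw [Finset.prod_eq_single a]
    · simp [P]
    · intro b _ hb; simp [hb]
    · simp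
  obtain ⟨Q, hQ⟩ := ContinuousMap.exists_mem_subalgebra_near_continuousMap_of_separatesPoints _
    hsep P ε hε
  refine ⟨Q, ?_, hQ⟩
  have := Q.2
  rw [← Subalgebra.mem_toSubmodule, Algebra.adjoin_eq_span, Submonoid.closure_eq] at this
  exact this

variable {p q : ℝ≥0∞} [ENNReal.HolderTriple p q 1]

/-- The multilinear form `∫ P ∏ f (x a)` is continuous along bounded sequences of `L^p` that
converge weakly: it suffices to check this for sums of products, which are dense in `L^q`. -/
theorem tendsto_integral_mul_prod_eval (hp : 2 ≤ p) (hq : q ≠ ⊤)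
    {f : ℕ → unitInterval → ℝ} {g : unitInterval → ℝ} (hf : ∀ n, MemLp (f n) p volume)
    (hg : MemLp g p volume) {R : ℝ} (hfR : ∀ n, (eLpNorm (f n) p volume).toReal ≤ R)
    (hgR : (eLpNorm g p volume).toReal ≤ R) (hw : WeakTendsto f g)
    {P : (ι → unitInterval) → ℝ} (hP : MemLp P q volume) :
    Tendsto (fun n => ∫ x, P x * ∏ a, f n (x a)) atTop (𝓝 (∫ x, P x * ∏ a, g (x a))) := by
  have hp0 : p ≠ 0 := (lt_of_lt_of_le (by norm_num) hp).ne'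
  have hR : 0 ≤ R := ENNReal.toReal_nonneg.trans hgR
  set M : ℝ := R ^ Fintype.card ι with hM
  have hM0 : 0 ≤ M := by positivity
  have hbound : ∀ {Q : (ι → unitInterval) → ℝ} {h : unitInterval → ℝ}, MemLp Q q volume →
      MemLp h p volume → (eLpNorm h p volume).toReal ≤ R →
      |∫ x, Q x * ∏ a, h (x a)| ≤ (eLpNorm Q q volume).toReal * M := by
    intro Q h hQ hh hhR
    refine (abs_integral_mul_prod_eval_le (ν := (volume : Measure unitInterval)) hp0 hQ
      (F := fun _ : ι => h) fun _ => hh).trans ?_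
    rw [Finset.prod_const, Finset.card_univ, hM]
    refine mul_le_mul_of_nonneg_left ?_ ENNReal.toReal_nonneg
    gcongr
  have hint : ∀ {Q : (ι → unitInterval) → ℝ} {h : unitInterval → ℝ}, MemLp Q q volume →
      MemLp h p volume → Integrable (fun x : ι → unitInterval => Q x * ∏ a, h (x a)) :=
    fun hQ hh => integrable_mul_prod_eval (ν := (volume : Measure unitInterval)) hp0 hQ
      fun _ => hh
  -- closing the claim under `L^q` limits
  have hclose : ∀ {P : (ι → unitInterval) → ℝ}, MemLp P q volume →
      (∀ ε : ℝ, 0 < ε → ∃ Q : (ι → unitInterval) → ℝ, MemLp Q q volume ∧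
        eLpNorm (P - Q) q volume ≤ ENNReal.ofReal ε ∧
        Tendsto (fun n => ∫ x, Q x * ∏ a, f n (x a)) atTop (𝓝 (∫ x, Q x * ∏ a, g (x a)))) →
      Tendsto (fun n => ∫ x, P x * ∏ a, f n (x a)) atTop (𝓝 (∫ x, P x * ∏ a, g (x a))) := by
    intro P hP h
    rw [Metric.tendsto_atTop]
    intro η hη
    obtain ⟨Q, hQ, hPQ, hlim⟩ := h (η / (4 * (M + 1))) (by positivity)
    rw [Metric.tendsto_atTop] at hlim
    obtain ⟨N, hN⟩ := hlim (η / 2) (by positivity)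
    refine ⟨N, fun n hn => ?_⟩
    have hdiff : ∀ {h : unitInterval → ℝ}, MemLp h p volume →
        (eLpNorm h p volume).toReal ≤ R →
        |(∫ x, P x * ∏ a, h (x a)) - ∫ x, Q x * ∏ a, h (x a)| < η / 4 := by
      intro h hh hhR
      rw [← integral_sub (hint hP hh) (hint hQ hh)]
      have h1 : ∀ x : ι → unitInterval, P x * ∏ a, h (x a) - Q x * ∏ a, h (x a)
          = (P - Q) x * ∏ a, h (x a) := fun x => by rw [Pi.sub_apply]; ring
      simp only [h1]
      have h3 : (eLpNorm (P - Q) q volume).toReal ≤ η / (4 * (M + 1)) :=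
        ENNReal.toReal_le_of_le_ofReal (by positivity) hPQ
      calc _ ≤ (eLpNorm (P - Q) q volume).toReal * M := hbound (hP.sub hQ) hh hhR
        _ ≤ η / (4 * (M + 1)) * M := by gcongr
        _ < η / (4 * (M + 1)) * (M + 1) := by gcongr; linarith
        _ = η / 4 := by field_simp
    have h1 := abs_lt.1 (hdiff (hf n) (hfR n))
    have h2 := abs_lt.1 (hdiff hg hgR)
    have h3 := hN n hn
    rw [Real.dist_eq, abs_lt] at h3 ⊢
    constructor <;> linarith
  have hcont : ∀ Q : C(ι → unitInterval, ℝ), MemLp Q q volume := fun Q =>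
    MemLp.of_bound Q.continuous.aestronglyMeasurable ‖Q‖
      (Eventually.of_forall fun x => Q.norm_coe_le_norm x)
  have hspan : ∀ Q ∈ Submodule.span ℝ (productFunctions ι : Set C(ι → unitInterval, ℝ)),
      Tendsto (fun n => ∫ x, Q x * ∏ a, f n (x a)) atTop (𝓝 (∫ x, Q x * ∏ a, g (x a))) := by
    intro Q hQ
    induction hQ using Submodule.span_induction with
    | mem Q hQ =>
      obtain ⟨φ, hφ⟩ := hQ
      have hfac : ∀ h : unitInterval → ℝ,
          ∫ x, Q x * ∏ a, h (x a) = ∏ a, ∫ u, φ a u * h u := by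
        intro h
        rw [← integral_fintype_prod_volume_eq_prod]
        refine integral_congr_ae (Eventually.of_forall fun x => ?_)
        simp only [hφ, Finset.prod_mul_distrib]
      simp only [hfac]
      refine tendsto_finsetProd _ fun a _ => hw _ ?_
      exact MemLp.of_bound (φ a).continuous.aestronglyMeasurable ‖φ a‖
        (Eventually.of_forall fun x => (φ a).norm_coe_le_norm x)
    | zero => simp
    | add Q Q' _ _ h h' =>
      have hadd : ∀ {h : unitInterval → ℝ}, MemLp h p volume →
          ∫ x, (Q + Q') x * ∏ a, h (x a)
            = (∫ x, Q x * ∏ a, h (x a)) + ∫ x, Q' x * ∏ a, h (x a) := by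
        intro h hh
        rw [← integral_add (hint (hcont Q) hh) (hint (hcont Q') hh)]
        simp only [ContinuousMap.add_apply, add_mul]
      rw [hadd hg]
      exact (h.add h').congr fun n => (hadd (hf n)).symm
    | smul c Q _ h =>
      simp only [ContinuousMap.smul_apply, smul_eq_mul, mul_assoc, integral_const_mul]
      exact h.const_mul c
  refine hclose hP fun ε hε => ?_
  obtain ⟨Q, hPQ, hQ⟩ := hP.exists_boundedContinuous_eLpNorm_sub_le hq
    (ε := ENNReal.ofReal ε) (by simpa using hε)
  refine ⟨Q, hQ, hPQ, hclose hQ fun δ hδ => ?_⟩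
  obtain ⟨S, hS, hSQ⟩ := exists_span_productFunctions_near Q.toContinuousMap hδ
  refine ⟨S, hcont S, ?_, hspan S hS⟩
  refine (eLpNorm_le_of_ae_bound (C := δ) (Eventually.of_forall fun x => ?_)).trans ?_
  · have := (S - Q.toContinuousMap).norm_coe_le_norm x
    rw [Pi.sub_apply, norm_sub_rev]
    exact this.trans hSQ.le
  · simp

end WeakContinuity

/-! ### Weak lower semicontinuity of the entropy -/

section LowerSemicontinuity

variable {μ : Measure ℝ}

/-- `maxTilt μ f N u` is a point at which `t ↦ t f(u) - α(t)` is maximal among `0` and the first `N`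
terms of a dense sequence. It depends measurably on `u` and is bounded for each `N`, so that it is
an admissible test function in `L²`. -/
noncomputable def maxTilt (μ : Measure ℝ) (f : unitInterval → ℝ) : ℕ → unitInterval → ℝ
  | 0, _ => 0
  | n + 1, u =>
    if maxTilt μ f n u * f u - logLaplace μ (maxTilt μ f n u)
        ≤ TopologicalSpace.denseSeq ℝ n * f u - logLaplace μ (TopologicalSpace.denseSeq ℝ n)
    then TopologicalSpace.denseSeq ℝ n else maxTilt μ f n u

theorem measurable_maxTilt (hα : Continuous (logLaplace μ)) {f : unitInterval → ℝ}
    (hf : Measurable f) (n : ℕ) : Measurable (maxTilt μ f n) := by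
  induction n with
  | zero => exact measurable_const
  | succ n ih =>
    refine Measurable.ite (measurableSet_le ?_ ?_) measurable_const ih
    · exact (ih.mul hf).sub (hα.measurable.comp ih)
    · exact (hf.const_mul _).sub measurable_const

theorem exists_abs_maxTilt_le (f : unitInterval → ℝ) (n : ℕ) :
    ∃ K : ℝ, ∀ u, |maxTilt μ f n u| ≤ K := by
  induction n with
  | zero => exact ⟨0, fun u => by simp [maxTilt]⟩
  | succ n ih =>
    obtain ⟨K, hK⟩ := ih
    refine ⟨max K |TopologicalSpace.denseSeq ℝ n|, fun u => ?_⟩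
    rw [maxTilt]
    split_ifs
    · exact le_max_right _ _
    · exact (hK u).trans (le_max_left _ _)

theorem monotone_maxTilt (f : unitInterval → ℝ) (u : unitInterval) :
    Monotone fun n => maxTilt μ f n u * f u - logLaplace μ (maxTilt μ f n u) := by
  refine monotone_nat_of_le_succ fun n => ?_
  simp only [maxTilt]
  split_ifs with h
  · exact h
  · exact le_rfl

theorem iSup_maxTilt (hα : Continuous (logLaplace μ)) (f : unitInterval → ℝ) (u : unitInterval) :
    ⨆ n, ENNReal.ofReal (maxTilt μ f n u * f u - logLaplace μ (maxTilt μ f n u))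
      = rateFn μ (f u) := by
  refine le_antisymm (iSup_le fun n => ofReal_le_rateFn _ _) (iSup_le fun t => ?_)
  have hclosed : IsClosed {t : ℝ | ENNReal.ofReal (t * f u - logLaplace μ t)
      ≤ ⨆ n, ENNReal.ofReal (maxTilt μ f n u * f u - logLaplace μ (maxTilt μ f n u))} :=
    isClosed_le (ENNReal.continuous_ofReal.comp (by fun_prop)) continuous_const
  have hdense := TopologicalSpace.denseRange_denseSeq ℝ
  refine hclosed.closure_subset_iff.2 ?_ (hdense t)
  rintro _ ⟨n, rfl⟩
  refine le_trans (ENNReal.ofReal_le_ofReal ?_) (le_iSup (fun n => ENNReal.ofReal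
    (maxTilt μ f n u * f u - logLaplace μ (maxTilt μ f n u))) (n + 1))
  simp only [maxTilt]
  split_ifs with h
  · exact le_rfl
  · exact (not_le.1 h).le

/-- The entropy is lower semicontinuous for weak convergence: it is a supremum of the affine
functionals `f ↦ ∫ (h f - α(h))` over bounded `h`. -/
theorem lintegral_rateFn_le_of_weakTendsto [IsProbabilityMeasure μ]
    (hα : Continuous (logLaplace μ)) {f : ℕ → unitInterval → ℝ} {g : unitInterval → ℝ}
    (hf : ∀ n, MemLp (f n) 2 volume) (hfm : ∀ n, Measurable (f n)) (hgm : Measurable g)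
    (hg : MemLp g 2 volume) (hw : WeakTendsto f g)
    {c : ℕ → ℝ} {C : ℝ} (hc : Tendsto c atTop (𝓝 C))
    (hfin : ∀ n, ∫⁻ u, rateFn μ (f n u) ≠ ⊤)
    (hfc : ∀ n, (∫⁻ u, rateFn μ (f n u)).toReal ≤ c n) :
    ∫⁻ u, rateFn μ (g u) ≤ ENNReal.ofReal C := by
  have hαbd : ∀ {h : unitInterval → ℝ} {K : ℝ}, Measurable h → (∀ u, |h u| ≤ K) →
      Integrable (fun u => logLaplace μ (h u)) := by
    intro h K hm hK
    obtain ⟨A, hA⟩ := (isCompact_Icc (a := -K) (b := K)).exists_bound_of_continuousOn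
      hα.continuousOn
    exact Integrable.of_bound (hα.measurable.comp hm).aestronglyMeasurable A
      (Eventually.of_forall fun u => hA _ (abs_le.1 (hK u)))
  have key : ∀ {h : unitInterval → ℝ} {K : ℝ}, Measurable h → (∀ u, |h u| ≤ K) →
      ∫ u, (h u * g u - logLaplace μ (h u)) ≤ C := by
    intro h K hm hK
    have hh2 : MemLp h 2 volume := MemLp.of_bound hm.aestronglyMeasurable K
      (Eventually.of_forall hK)
    have hαi := hαbd hm hK
    have hmul : ∀ {f : unitInterval → ℝ}, MemLp f 2 volume → Integrable fun u => h u * f u :=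
      fun hf => hh2.integrable_mul hf
    rw [integral_sub (hmul hg) hαi]
    refine le_of_tendsto_of_tendsto' ((hw h hh2).sub_const _) hc fun n => ?_
    rw [← integral_sub (hmul (hf n)) hαi]
    refine le_trans ?_ (hfc n)
    have hmeas : Measurable fun u => rateFn μ (f n u) := measurable_rateFn.comp (hfm n)
    rw [← integral_toReal hmeas.aemeasurable (ae_lt_top hmeas (hfin n))]
    refine integral_mono_ae ((hmul (hf n)).sub hαi)
      (integrable_toReal_of_lintegral_ne_top hmeas.aemeasurable (hfin n)) ?_
    filter_upwards [ae_lt_top hmeas (hfin n)] with u hu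
    exact fenchel_young hu.ne _
  have hvm : ∀ n, Measurable fun u => maxTilt μ g n u * g u - logLaplace μ (maxTilt μ g n u) :=
    fun n => ((measurable_maxTilt hα hgm n).mul hgm).sub
      (hα.measurable.comp (measurable_maxTilt hα hgm n))
  calc ∫⁻ u, rateFn μ (g u)
      = ∫⁻ u, ⨆ n, ENNReal.ofReal (maxTilt μ g n u * g u - logLaplace μ (maxTilt μ g n u)) := by
        simp only [iSup_maxTilt hα]
    _ = ⨆ n, ∫⁻ u, ENNReal.ofReal (maxTilt μ g n u * g u - logLaplace μ (maxTilt μ g n u)) :=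
        lintegral_iSup (fun n => (hvm n).ennreal_ofReal)
          fun m n hmn u => ENNReal.ofReal_le_ofReal (monotone_maxTilt g u hmn)
    _ ≤ ENNReal.ofReal C := by
        refine iSup_le fun n => ?_
        obtain ⟨K, hK⟩ := exists_abs_maxTilt_le (μ := μ) g n
        have hm := measurable_maxTilt hα hgm n
        have hh2 : MemLp (maxTilt μ g n) 2 volume := MemLp.of_bound hm.aestronglyMeasurable K
          (Eventually.of_forall hK)
        have hint : Integrable fun u =>
            maxTilt μ g n u * g u - logLaplace μ (maxTilt μ g n u) :=
          (hh2.integrable_mul hg).sub (hαbd hm hK)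
        rw [← ofReal_integral_eq_lintegral_ofReal hint]
        · exact ENNReal.ofReal_le_ofReal (key hm hK)
        · refine Eventually.of_forall fun u => ?_
          refine le_trans ?_ (monotone_maxTilt g u (Nat.zero_le n))
          simp [maxTilt, logLaplace, cgf_zero]

end LowerSemicontinuity

/-! ### Coercivity of the entropy -/

section Domain

variable {μ : Measure ℝ} [IsProbabilityMeasure μ]

theorem entropyTerm_eq (hexp : ∀ t : ℝ, Integrable (fun x => Real.exp (t * x)) μ)
    {f : unitInterval → ℝ} (hf : ∀ u, f u ∈ closure (meanRange μ)) :
    entropyTerm μ f = ∫⁻ u, rateFn μ (f u) :=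
  lintegral_congr fun u => tiltEntropy_tiltParam hexp (hf u)

/-- The entropy dominates the `p`-th power of the `L^p` norm with an arbitrarily small constant;
in particular functions of finite entropy belong to `L^p`. -/
theorem exists_eLpNorm_pow_le {k : ℕ} (hk : 1 ≤ k) {p : ℝ≥0∞}
    (hp : ((k + 1 : ℕ) : ℝ≥0∞) ≤ p) (htail : TailCondition μ p) {ε : ℝ} (hε : 0 < ε) :
    ∃ C : ℝ, ∀ f : unitInterval → ℝ, Measurable f → ∫⁻ u, rateFn μ (f u) ≠ ⊤ →
      MemLp f p volume ∧
      (eLpNorm f p volume).toReal ^ (k + 1) ≤ ε * (∫⁻ u, rateFn μ (f u)).toReal + C := by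
  have hp1 : 1 < p := by
    refine lt_of_lt_of_le ?_ hp
    exact_mod_cast (by omega : 1 < k + 1)
  have hexp := integrable_exp_of_tailCondition hp1.le htail
  by_cases htop : p = ⊤
  · subst htop
    rw [TailCondition, if_pos rfl] at htail
    obtain ⟨K, hK⟩ := htail
    have hK0 : 0 ≤ K := by
      obtain ⟨x, hx⟩ := hK.exists
      exact (abs_nonneg x).trans hx
    refine ⟨K ^ (k + 1), fun f hf hfin => ?_⟩
    have hbd : ∀ᵐ u, ‖f u‖ ≤ K := by
      filter_upwards [ae_lt_top (measurable_rateFn.comp hf) hfin] with u hu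
      have := closure_meanRange_subset hexp hK
        (mem_closure_meanRange_of_rateFn_ne_top hexp hu.ne)
      exact abs_le.2 this
    refine ⟨MemLp.of_bound hf.aestronglyMeasurable K hbd, ?_⟩
    have h1 : (eLpNorm f ⊤ volume).toReal ≤ K := by
      refine ENNReal.toReal_le_of_le_ofReal hK0 ?_
      simpa using eLpNorm_le_of_ae_bound (p := ⊤) hbd
    have h2 : (0 : ℝ) ≤ ε * (∫⁻ u, rateFn μ (f u)).toReal := by positivity
    have h3 : (eLpNorm f ⊤ volume).toReal ^ (k + 1) ≤ K ^ (k + 1) := by gcongr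
    linarith
  · obtain ⟨C, hC0, hC⟩ := rpow_le_rateFn_add hp1 htop htail (l := 1 / ε) (by positivity)
    set r := p.toReal with hr
    have hkr : ((k + 1 : ℕ) : ℝ) ≤ r := by
      have := ENNReal.toReal_mono htop hp
      rwa [ENNReal.toReal_natCast] at this
    have hr0 : 0 < r := lt_of_lt_of_le (by positivity) hkr
    refine ⟨1 + ε * C, fun f hf hfin => ?_⟩
    have hm : Measurable fun u => rateFn μ (f u) := measurable_rateFn.comp hf
    have hbd : ∀ᵐ u, ‖f u‖ ^ r ≤ ε * (rateFn μ (f u)).toReal + ε * C := by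
      filter_upwards [ae_lt_top hm hfin] with u hu
      have := hC (f u) hu.ne
      rw [Real.norm_eq_abs]
      calc |f u| ^ r = ε * (1 / ε * |f u| ^ r) := by field_simp
        _ ≤ ε * ((rateFn μ (f u)).toReal + C) := by gcongr
        _ = _ := by ring
    have hint : Integrable (fun u => ε * (rateFn μ (f u)).toReal + ε * C)
        (volume : Measure unitInterval) :=
      ((integrable_toReal_of_lintegral_ne_top hm.aemeasurable hfin).const_mul ε).add
        (integrable_const _)
    have hintr : Integrable (fun u => ‖f u‖ ^ r) (volume : Measure unitInterval) :=
      hint.mono' (hf.norm.pow_const r).aestronglyMeasurable (by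
        filter_upwards [hbd] with u hu
        rwa [Real.norm_of_nonneg (by positivity)])
    have hp0 : p ≠ 0 := (zero_lt_one.trans hp1).ne'
    have hL : MemLp f p volume :=
      (integrable_norm_rpow_iff hf.aestronglyMeasurable hp0 htop).1 hintr
    refine ⟨hL, ?_⟩
    set N := (eLpNorm f p volume).toReal with hN
    have hN0 : 0 ≤ N := ENNReal.toReal_nonneg
    have hNr : N ^ r = ∫ u, ‖f u‖ ^ r := by
      have h0 : 0 ≤ ∫ u, ‖f u‖ ^ r := integral_nonneg fun u => by positivity
      rw [hN, hL.eLpNorm_eq_integral_rpow_norm hp0 htop, ENNReal.toReal_ofReal (by positivity),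
        ← Real.rpow_mul h0, inv_mul_cancel₀ hr0.ne', Real.rpow_one]
    have h1 : N ^ r ≤ ε * (∫⁻ u, rateFn μ (f u)).toReal + ε * C := by
      rw [hNr, ← integral_toReal hm.aemeasurable (ae_lt_top hm hfin)]
      refine (integral_mono_ae hintr hint hbd).trans (le_of_eq ?_)
      rw [integral_add ((integrable_toReal_of_lintegral_ne_top hm.aemeasurable hfin).const_mul ε)
        (integrable_const _), integral_const_mul]
      simp
    have h2 : N ^ (k + 1) ≤ 1 + N ^ r := by
      rcases le_total N 1 with h | h
      · have h3 : N ^ (k + 1) ≤ 1 := pow_le_one₀ hN0 h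
        have h4 : 0 ≤ N ^ r := by positivity
        linarith
      · have h3 : N ^ ((k + 1 : ℕ) : ℝ) ≤ N ^ r := Real.rpow_le_rpow_of_exponent_le h hkr
        rw [Real.rpow_natCast] at h3
        linarith
    linarith

theorem one_lt_of_natCast_le {k : ℕ} (hk : 1 ≤ k) {p : ℝ≥0∞} (hp : ((k + 1 : ℕ) : ℝ≥0∞) ≤ p) :
    1 < p := by
  refine lt_of_lt_of_le ?_ hp
  exact_mod_cast (by omega : 1 < k + 1)

/-- Functions of finite entropy with values in `cl 𝒩` are competitors: the `L^p` bound in the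
definition of `ℒ` is automatic. -/
theorem mem_domain {k : ℕ} (hk : 1 ≤ k) {p : ℝ≥0∞}
    (hp : ((k + 1 : ℕ) : ℝ≥0∞) ≤ p) (htail : TailCondition μ p) {f : unitInterval → ℝ}
    (hf : Measurable f) (hcl : ∀ u, f u ∈ closure (meanRange μ))
    (hfin : ∫⁻ u, rateFn μ (f u) ≠ ⊤) : f ∈ {g ∈ funSpace μ p | entropyTerm μ g < ⊤} := by
  have hexp := integrable_exp_of_tailCondition (one_lt_of_natCast_le hk hp).le htail
  obtain ⟨C, hC⟩ := exists_eLpNorm_pow_le hk hp htail one_pos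
  refine ⟨⟨hf, hcl, (hC f hf hfin).1⟩, ?_⟩
  rw [entropyTerm_eq hexp hcl]
  exact hfin.lt_top

/-- The constants with finite entropy belong to the domain. -/
theorem const_mem_domain {k : ℕ} (hk : 1 ≤ k) {p : ℝ≥0∞}
    (hp : ((k + 1 : ℕ) : ℝ≥0∞) ≤ p) (htail : TailCondition μ p) {x : ℝ} (hx : rateFn μ x ≠ ⊤) :
    (fun _ => x) ∈ {g ∈ funSpace μ p | entropyTerm μ g < ⊤} := by
  have hexp := integrable_exp_of_tailCondition (one_lt_of_natCast_le hk hp).le htail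
  refine mem_domain hk hp htail measurable_const
    (fun _ => mem_closure_meanRange_of_rateFn_ne_top hexp hx) ?_
  simpa using hx

end Domain

/-! ### Existence of maximizers -/

section Existence

variable {μ : Measure ℝ} {k : ℕ} {H : SimpleGraph (Fin (k + 1))} [DecidableRel H.Adj]
  {W : unitInterval → unitInterval → ℝ} {p : ℝ≥0∞}

theorem objective_congr_ae {f g : unitInterval → ℝ} (h : f =ᵐ[volume] g) (θ B : ℝ) :
    objective μ H W θ B f = objective μ H W θ B g := by
  have h1 : interaction H W f = interaction H W g := by
    refine integral_congr_ae ?_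
    have := prod_eval_ae_eq (ι := Fin (k + 1)) (ν := (volume : Measure unitInterval))
      (F := fun _ => f) (F' := fun _ => g) fun _ => h
    filter_upwards [this] with x hx
    simp only [interactionIntegrand, hx]
  have h2 : entropyTerm μ f = entropyTerm μ g :=
    lintegral_congr_ae (h.mono fun u hu => by simp only [hu])
  rw [objective, objective, h1, h2, integral_congr_ae h]

variable [IsProbabilityMeasure μ]

theorem integrable_interactionIntegrand (hp : 1 < p) (hW : IsKernel H p W)
    {f : unitInterval → ℝ} (hf : MemLp f p volume) : Integrable (interactionIntegrand H W f) := by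
  have := holderTriple_conjExp hp.le
  exact integrable_mul_prod_eval (ν := (volume : Measure unitInterval))
    (zero_lt_one.trans hp).ne' (memLp_edgeProd hp hW) fun _ => hf

/-- The objective is bounded above by a constant minus half of the entropy. -/
theorem exists_objective_le (hk : 1 ≤ k) (hp : ((k + 1 : ℕ) : ℝ≥0∞) ≤ p)
    (htail : TailCondition μ p) (hW : IsKernel H p W) (θ B : ℝ) :
    ∃ C : ℝ, ∀ f ∈ {g ∈ funSpace μ p | entropyTerm μ g < ⊤},
      objective μ H W θ B f ≤ C - (entropyTerm μ f).toReal / 2 := by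
  have hp1 := one_lt_of_natCast_le hk hp
  have hexp := integrable_exp_of_tailCondition hp1.le htail
  have := holderTriple_conjExp hp1.le
  set nP := (eLpNorm (edgeProd H W) (conjExp p) volume).toReal with hnP
  have hnP0 : 0 ≤ nP := ENNReal.toReal_nonneg
  set A := |θ| * nP + |B| with hA
  have hA0 : 0 ≤ A := by positivity
  obtain ⟨C, hC⟩ := exists_eLpNorm_pow_le hk hp htail (ε := 1 / (2 * (A + 1))) (by positivity)
  refine ⟨A * C + |B|, fun f hf => ?_⟩
  obtain ⟨⟨hfm, hfcl, hfL⟩, hfin⟩ := hf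
  rw [objective]
  rw [entropyTerm_eq hexp hfcl] at hfin ⊢
  set E := (∫⁻ u, rateFn μ (f u)).toReal with hE
  have hE0 : 0 ≤ E := ENNReal.toReal_nonneg
  obtain ⟨-, hfC⟩ := hC f hfm hfin.ne
  set N := (eLpNorm f p volume).toReal with hN
  have hN0 : 0 ≤ N := ENNReal.toReal_nonneg
  have hG : |interaction H W f| ≤ nP * N ^ (k + 1) := by
    have := abs_integral_mul_prod_eval_le (ν := (volume : Measure unitInterval))
      (zero_lt_one.trans hp1).ne' (memLp_edgeProd hp1 hW)
      (F := fun _ : Fin (k + 1) => f) fun _ => hfL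
    rw [Finset.prod_const, Finset.card_univ, Fintype.card_fin] at this
    exact this
  have hI : |∫ u, f u| ≤ 1 + N ^ (k + 1) := by
    have h1 : |∫ u, f u| ≤ (eLpNorm f 1 volume).toReal := by
      rw [← Real.norm_eq_abs, eLpNorm_one_eq_lintegral_enorm, ← toReal_enorm]
      refine ENNReal.toReal_mono ?_ (enorm_integral_le_lintegral_enorm _)
      have := (hfL.mono_exponent hp1.le).2.ne
      rwa [eLpNorm_one_eq_lintegral_enorm] at this
    have h2 : (eLpNorm f 1 volume).toReal ≤ N :=
      ENNReal.toReal_mono hfL.2.ne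
        (eLpNorm_le_eLpNorm_of_exponent_le hp1.le hfm.aestronglyMeasurable)
    have h3 : N ≤ 1 + N ^ (k + 1) := by
      rcases le_total N 1 with h | h
      · have : 0 ≤ N ^ (k + 1) := by positivity
        linarith
      · have := le_self_pow₀ h (by omega : k + 1 ≠ 0)
        linarith
    linarith
  have h1 : θ * interaction H W f ≤ |θ| * (nP * N ^ (k + 1)) :=
    (le_abs_self _).trans (by rw [abs_mul]; gcongr)
  have h2 : B * ∫ u, f u ≤ |B| * (1 + N ^ (k + 1)) :=
    (le_abs_self _).trans (by rw [abs_mul]; gcongr)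
  have h3 : A * N ^ (k + 1) ≤ E / 2 + A * C := by
    have h4 : A * (1 / (2 * (A + 1)) * E) ≤ E / 2 := by
      have : A * (1 / (2 * (A + 1)) * E) = (A / (A + 1)) * (E / 2) := by field_simp
      rw [this]
      have h5 : A / (A + 1) ≤ 1 := by
        rw [div_le_one (by positivity)]; linarith
      exact mul_le_of_le_one_left (by positivity) h5
    have := mul_le_mul_of_nonneg_left hfC hA0
    linarith
  have h4 : A * N ^ (k + 1) = |θ| * (nP * N ^ (k + 1)) + |B| * N ^ (k + 1) := by rw [hA]; ring
  linarith

theorem weakTendsto_integral {f : ℕ → unitInterval → ℝ} {g : unitInterval → ℝ}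
    (hw : WeakTendsto f g) : Tendsto (fun n => ∫ u, f n u) atTop (𝓝 (∫ u, g u)) := by
  simpa using hw (fun _ => 1) (memLp_const 1)

/-- The direct method: a maximizing sequence has a weak limit in `L²`, along which the interaction
converges and the entropy does not increase. -/
theorem exists_isMaximizer (hk : 1 ≤ k) (hp : ((k + 1 : ℕ) : ℝ≥0∞) ≤ p)
    (htail : TailCondition μ p) (hW : IsKernel H p W) (θ B : ℝ) :
    ∃ f, IsMaximizer μ p H W θ B f := by
  have hp1 := one_lt_of_natCast_le hk hp
  have hp2 : 2 ≤ p := le_trans (by exact_mod_cast (by omega : 2 ≤ k + 1)) hp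
  have hexp := integrable_exp_of_tailCondition hp1.le htail
  have hα := continuous_logLaplace hexp
  have := holderTriple_conjExp hp1.le
  set D := {g ∈ funSpace μ p | entropyTerm μ g < ⊤} with hD
  set Φ := objective μ H W θ B with hΦ
  obtain ⟨C, hC⟩ := exists_objective_le (H := H) (W := W) hk hp htail hW θ B
  have hne : (Φ '' D).Nonempty :=
    ⟨_, _, const_mem_domain hk hp htail (rateFn_deriv_logLaplace_ne_top hexp 0), rfl⟩
  have hbdd : BddAbove (Φ '' D) := by
    refine ⟨C, ?_⟩
    rintro _ ⟨f, hf, rfl⟩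
    have := hC f hf
    have : 0 ≤ (entropyTerm μ f).toReal := ENNReal.toReal_nonneg
    linarith
  -- a maximizing sequence has bounded entropy, hence bounded `L^p` norm
  obtain ⟨s, hsmono, hslim, hs⟩ := exists_seq_tendsto_sSup hne hbdd
  choose f hfD hfs using hs
  have hent : ∀ n, entropyTerm μ (f n) = ∫⁻ u, rateFn μ (f n u) := fun n =>
    entropyTerm_eq hexp (hfD n).1.2.1
  have hfin : ∀ n, ∫⁻ u, rateFn μ (f n u) ≠ ⊤ := fun n => hent n ▸ (hfD n).2.ne
  set E₀ := 2 * (C - s 0) with hE₀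
  have hE : ∀ n, (∫⁻ u, rateFn μ (f n u)).toReal ≤ E₀ := by
    intro n
    have h1 := hC (f n) (hfD n)
    have h2 : Φ (f n) = s n := hfs n
    have h3 := hsmono (Nat.zero_le n)
    rw [hent n] at h1
    linarith
  obtain ⟨C₁, hC₁⟩ := exists_eLpNorm_pow_le hk hp htail one_pos
  set R := 1 + (E₀ + C₁) with hR
  have hfR : ∀ n, (eLpNorm (f n) p volume).toReal ≤ R := by
    intro n
    have h1 := (hC₁ (f n) (hfD n).1.1 (hfin n)).2
    have h2 := hE n
    set N := (eLpNorm (f n) p volume).toReal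
    have hN0 : 0 ≤ N := ENNReal.toReal_nonneg
    rcases le_total N 1 with h | h
    · have : 0 ≤ N ^ (k + 1) := by positivity
      linarith
    · have := le_self_pow₀ h (by omega : k + 1 ≠ 0)
      linarith
  have hL2 : ∀ {h : unitInterval → ℝ}, MemLp h p volume → MemLp h 2 volume := fun h =>
    h.mono_exponent hp2
  have hf2 : ∀ n, MemLp (f n) 2 volume := fun n => hL2 (hfD n).1.2.2
  obtain ⟨g, hgm, hg2, ψ, hψ, hw⟩ := exists_weakTendsto_subseq hf2 (R := ENNReal.ofReal R)
    ENNReal.ofReal_ne_top fun n => by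
      refine (eLpNorm_le_eLpNorm_of_exponent_le hp2 (hf2 n).1).trans ?_
      rw [← ENNReal.ofReal_toReal (hfD n).1.2.2.2.ne]
      exact ENNReal.ofReal_le_ofReal (hfR n)
  have hgfin : ∫⁻ u, rateFn μ (g u) ≠ ⊤ :=
    ((lintegral_rateFn_le_of_weakTendsto hα (fun n => hf2 (ψ n)) (fun n => (hfD (ψ n)).1.1) hgm
      hg2 hw tendsto_const_nhds (fun n => hfin (ψ n)) fun n => hE (ψ n)).trans_lt
        ENNReal.ofReal_lt_top).ne
  have hgp : MemLp g p volume := (hC₁ g hgm hgfin).1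
  have hG : Tendsto (fun n => interaction H W (f (ψ n))) atTop (𝓝 (interaction H W g)) :=
    tendsto_integral_mul_prod_eval hp2 (conjExp_ne_top hp1) (fun n => (hfD (ψ n)).1.2.2) hgp
      (R := max R (eLpNorm g p volume).toReal) (fun n => (hfR (ψ n)).trans (le_max_left _ _))
      (le_max_right _ _) hw (memLp_edgeProd hp1 hW)
  have hI := weakTendsto_integral hw
  set M := sSup (Φ '' D) with hM
  have hlim : Tendsto (fun n => θ * interaction H W (f (ψ n)) + B * (∫ u, f (ψ n) u) - s (ψ n))
      atTop (𝓝 (θ * interaction H W g + B * (∫ u, g u) - M)) :=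
    ((hG.const_mul θ).add (hI.const_mul B)).sub (hslim.comp hψ.tendsto_atTop)
  have hseq : ∀ n, (∫⁻ u, rateFn μ (f (ψ n) u)).toReal
      = θ * interaction H W (f (ψ n)) + B * (∫ u, f (ψ n) u) - s (ψ n) := by
    intro n
    have h1 : Φ (f (ψ n)) = s (ψ n) := hfs (ψ n)
    rw [hΦ, objective, hent] at h1
    linarith
  have hgE : ∫⁻ u, rateFn μ (g u)
      ≤ ENNReal.ofReal (θ * interaction H W g + B * (∫ u, g u) - M) :=
    lintegral_rateFn_le_of_weakTendsto hα (fun n => hf2 (ψ n)) (fun n => (hfD (ψ n)).1.1) hgm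
      hg2 hw hlim (fun n => hfin (ψ n)) fun n => (hseq n).le
  have hnn : 0 ≤ θ * interaction H W g + B * (∫ u, g u) - M :=
    ge_of_tendsto' hlim fun n => (hseq n).symm ▸ ENNReal.toReal_nonneg
  have hgE' := ENNReal.toReal_le_of_le_ofReal hnn hgE
  -- the weak limit takes values in `cl 𝒩` only almost everywhere
  classical
  let g' : unitInterval → ℝ := fun u =>
    if g u ∈ closure (meanRange μ) then g u else deriv (logLaplace μ) 0
  have hg'm : Measurable g' :=
    Measurable.ite (hgm isClosed_closure.measurableSet) hgm measurable_const
  have hgg' : g' =ᵐ[volume] g := by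
    filter_upwards [ae_lt_top (measurable_rateFn.comp hgm) hgfin] with u hu
    exact if_pos (mem_closure_meanRange_of_rateFn_ne_top hexp hu.ne)
  have hg'cl : ∀ u, g' u ∈ closure (meanRange μ) := by
    intro u
    by_cases h : g u ∈ closure (meanRange μ)
    · simp only [g', if_pos h, h]
    · simp only [g', if_neg h]
      exact subset_closure (deriv_logLaplace_mem_meanRange 0)
  have hg'e : ∫⁻ u, rateFn μ (g' u) = ∫⁻ u, rateFn μ (g u) :=
    lintegral_congr_ae (hgg'.mono fun u hu => by simp only [hu])
  refine ⟨g', mem_domain hk hp htail hg'm hg'cl (hg'e ▸ hgfin), fun h hh => ?_⟩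
  have h1 : Φ h ≤ M := le_csSup hbdd ⟨h, hh, rfl⟩
  have h2 : objective μ H W θ B g' = θ * interaction H W g + B * (∫ u, g u)
      - (∫⁻ u, rateFn μ (g u)).toReal := by
    rw [← hg'e, ← entropyTerm_eq hexp hg'cl, entropyTerm, objective_congr_ae hgg', objective,
      entropyTerm]
    congr 2
    exact lintegral_congr_ae (hgg'.mono fun u hu => by simp only [hu])
  change objective μ H W θ B h ≤ objective μ H W θ B g'
  rw [h2]
  have h3 : objective μ H W θ B h ≤ M := h1
  linarith

end Existence

/-! ### The first variation of the interaction -/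

section FirstVariation

variable {k : ℕ} {H : SimpleGraph (Fin (k + 1))} [DecidableRel H.Adj]
  {W : unitInterval → unitInterval → ℝ} {p : ℝ≥0∞}

theorem coe_piFinSuccAbove_symm_zero :
    ((MeasurableEquiv.piFinSuccAbove (fun _ : Fin (k + 1) => unitInterval) 0).symm :
      unitInterval × (Fin k → unitInterval) → Fin (k + 1) → unitInterval)
        = fun z => Fin.cons z.1 z.2 := by
  ext z a
  simp [MeasurableEquiv.piFinSuccAbove, Fin.insertNthEquiv]

theorem measurePreserving_cons :
    MeasurePreserving
      (fun z : unitInterval × (Fin k → unitInterval) =>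
        (Fin.cons z.1 z.2 : Fin (k + 1) → unitInterval)) := by
  have h := (volume_preserving_piFinSuccAbove (fun _ : Fin (k + 1) => unitInterval) 0).symm
  rwa [coe_piFinSuccAbove_symm_zero] at h

theorem measurableEmbedding_cons :
    MeasurableEmbedding
      (fun z : unitInterval × (Fin k → unitInterval) =>
        (Fin.cons z.1 z.2 : Fin (k + 1) → unitInterval)) := by
  have h := (MeasurableEquiv.piFinSuccAbove
    (fun _ : Fin (k + 1) => unitInterval) 0).symm.measurableEmbedding
  rwa [coe_piFinSuccAbove_symm_zero] at h

theorem integrable_cons {Q : (Fin (k + 1) → unitInterval) → ℝ} (hQ : Integrable Q) :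
    Integrable (fun z : unitInterval × (Fin k → unitInterval) => Q (Fin.cons z.1 z.2))
      (volume.prod volume) :=
  measurePreserving_cons.integrable_comp_of_integrable hQ

theorem integral_cons {Q : (Fin (k + 1) → unitInterval) → ℝ} (hQ : Integrable Q) :
    ∫ x, Q x = ∫ u, ∫ y : Fin k → unitInterval, Q (Fin.cons u y) := by
  rw [← measurePreserving_cons.integral_comp measurableEmbedding_cons]
  exact integral_prod _ (integrable_cons hQ)

theorem integrable_symTensor_mul_cons (hp : 1 < p) (hW : IsKernel H p W)
    {d f : unitInterval → ℝ} (hd : MemLp d p volume) (hf : MemLp f p volume) :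
    Integrable fun x : Fin (k + 1) → unitInterval =>
      symTensor H W x * (d (x 0) * ∏ a : Fin k, f (x a.succ)) := by
  have := holderTriple_conjExp hp.le
  have h := integrable_mul_prod_eval (ν := (volume : Measure unitInterval))
    (zero_lt_one.trans hp).ne' (memLp_symTensor hp hW)
    (F := (Fin.cons d fun _ => f : Fin (k + 1) → unitInterval → ℝ))
    (fun a => by refine Fin.cases ?_ (fun a => ?_) a <;> simpa)
  simp only [Fin.prod_univ_succ, Fin.cons_zero, Fin.cons_succ] at h
  exact h

theorem ae_integrable_fieldIntegrand (hp : 1 < p) (hW : IsKernel H p W)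
    {f : unitInterval → ℝ} (hf : MemLp f p volume) :
    ∀ᵐ u, Integrable (fieldIntegrand H W f u) := by
  have h := integrable_cons (integrable_symTensor_mul_cons hp hW (memLp_const (1 : ℝ)) hf)
  filter_upwards [h.prod_right_ae] with u hu
  simp only [Fin.cons_succ, one_mul] at hu
  exact hu

theorem aestronglyMeasurable_localField (hp : 1 < p) (hW : IsKernel H p W)
    {f : unitInterval → ℝ} (hf : MemLp f p volume) :
    AEStronglyMeasurable (localField H W f) volume := by
  have h := integrable_cons (integrable_symTensor_mul_cons hp hW (memLp_const (1 : ℝ)) hf)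
  have := h.1.integral_prod_right'
  simp only [Fin.cons_succ, one_mul] at this
  exact this

/-- The pairing of `d` with the local field, by Fubini's theorem in the first coordinate. -/
theorem integral_mul_localField (hp : 1 < p) (hW : IsKernel H p W)
    {d f : unitInterval → ℝ} (hd : MemLp d p volume) (hf : MemLp f p volume) :
    Integrable (fun u => d u * localField H W f u) ∧
    ∫ x : Fin (k + 1) → unitInterval, symTensor H W x * (d (x 0) * ∏ a : Fin k, f (x a.succ))
      = ∫ u, d u * localField H W f u := by
  have h := integrable_symTensor_mul_cons hp hW hd hf
  have h1 : ∀ u, ∫ y : Fin k → unitInterval, symTensor H W (Fin.cons u y)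
      * (d u * ∏ a, f (y a)) = d u * localField H W f u := by
    intro u
    rw [localField, ← integral_const_mul]
    refine integral_congr_ae (Eventually.of_forall fun y => ?_)
    simp only [fieldIntegrand]
    ring
  constructor
  · have h2 := (integrable_cons h).integral_prod_left
    simp only [Fin.cons_zero, Fin.cons_succ, h1] at h2
    exact h2
  · rw [integral_cons h]
    simp only [Fin.cons_zero, Fin.cons_succ, h1]

theorem integral_permute (σ : Equiv.Perm (Fin (k + 1))) {Q : (Fin (k + 1) → unitInterval) → ℝ}
    (hQ : Integrable Q) :
    ∫ x : Fin (k + 1) → unitInterval, Q (fun a => x (σ a)) = ∫ x, Q x := by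
  have hmp := measurePreserving_permute σ
  have := integral_map (f := Q) hmp.measurable.aemeasurable (hmp.map_eq.symm ▸ hQ.1)
  rw [hmp.map_eq] at this
  exact this.symm

/-- Against a symmetric function the edge product may be replaced by its symmetrisation. -/
theorem integral_symTensor_mul {Q : (Fin (k + 1) → unitInterval) → ℝ}
    (hQ : ∀ (σ : Equiv.Perm (Fin (k + 1))) x, Q (fun a => x (σ a)) = Q x)
    (hint : Integrable fun x => edgeProd H W x * Q x) :
    ∫ x, symTensor H W x * Q x = ∫ x, edgeProd H W x * Q x := by
  have h1 : ∀ (σ : Equiv.Perm (Fin (k + 1))) x,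
      edgeProd H W (fun a => x (σ a)) * Q x
        = (fun x => edgeProd H W x * Q x) (fun a => x (σ a)) := fun σ x => by simp only [hQ]
  have h2 : ∀ σ : Equiv.Perm (Fin (k + 1)),
      Integrable fun x => edgeProd H W (fun a => x (σ a)) * Q x := by
    intro σ
    simp only [h1]
    exact (measurePreserving_permute σ).integrable_comp_of_integrable hint
  have h3 : ∀ σ : Equiv.Perm (Fin (k + 1)),
      ∫ x, edgeProd H W (fun a => x (σ a)) * Q x = ∫ x, edgeProd H W x * Q x := by
    intro σ
    simp only [h1]
    exact integral_permute σ hint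
  simp only [symTensor, mul_assoc, Finset.sum_mul]
  rw [integral_const_mul, integral_finsetSum _ fun σ _ => h2 σ]
  simp only [h3, Finset.sum_const, Finset.card_univ, Fintype.card_perm, Fintype.card_fin,
    nsmul_eq_mul]
  field_simp

/-- The functional `G_W` of a one-parameter family `f + ε d` has derivative
`v ∫ d(u) (local field of f at u) du` at `ε = 0`. -/
theorem hasDerivAt_interaction (hp : 1 < p) (hW : IsKernel H p W)
    {d f : unitInterval → ℝ} (hd : MemLp d p volume) (hf : MemLp f p volume) :
    HasDerivAt (fun ε : ℝ => interaction H W fun u => f u + ε * d u)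
      (((k : ℝ) + 1) * ∫ u, d u * localField H W f u) 0 := by
  have := holderTriple_conjExp hp.le
  classical
  have hp0 := (zero_lt_one.trans hp).ne'
  let F : Finset (Fin (k + 1)) → Fin (k + 1) → unitInterval → ℝ := fun s a =>
    if a ∈ s then d else f
  have hF : ∀ s a, MemLp (F s a) p volume := by
    intro s a
    by_cases h : a ∈ s
    · simpa only [F, if_pos h] using hd
    · simpa only [F, if_neg h] using hf
  have hintP : ∀ s, Integrable fun x => edgeProd H W x * ∏ a, F s a (x a) := fun s =>
    integrable_mul_prod_eval (ν := (volume : Measure unitInterval)) hp0 (memLp_edgeProd hp hW)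
      (hF s)
  -- `G` is a polynomial in `ε`
  have hexpand : ∀ ε : ℝ, interaction H W (fun u => f u + ε * d u)
      = ∑ s : Finset (Fin (k + 1)), ε ^ s.card * ∫ x, edgeProd H W x * ∏ a, F s a (x a) := by
    intro ε
    have h1 : ∀ x, interactionIntegrand H W (fun u => f u + ε * d u) x
        = ∑ s : Finset (Fin (k + 1)), ε ^ s.card * (edgeProd H W x * ∏ a, F s a (x a)) := by
      intro x
      have h2 : ∏ a, (f (x a) + ε * d (x a))
          = ∑ s : Finset (Fin (k + 1)), ε ^ s.card * ∏ a, F s a (x a) := by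
        simp only [add_comm (f _)]
        rw [Finset.prod_add, Finset.powerset_univ]
        refine Finset.sum_congr rfl fun s _ => ?_
        rw [Finset.prod_mul_distrib, Finset.prod_const, mul_assoc]
        congr 1
        rw [← Finset.prod_mul_prod_compl s fun a => F s a (x a), Finset.compl_eq_univ_sdiff]
        congr 1
        · exact Finset.prod_congr rfl fun a ha => by simp only [F, if_pos ha]
        · exact Finset.prod_congr rfl fun a ha => by
            simp only [F, if_neg (Finset.mem_sdiff.1 ha).2]
      rw [interactionIntegrand, h2, Finset.mul_sum]
      exact Finset.sum_congr rfl fun s _ => by ring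
    rw [interaction]
    simp only [h1]
    rw [integral_finsetSum _ fun s _ => (hintP s).const_mul _]
    simp only [integral_const_mul]
  simp only [hexpand]
  have hder : HasDerivAt (fun ε : ℝ => ∑ s : Finset (Fin (k + 1)),
      ε ^ s.card * ∫ x, edgeProd H W x * ∏ a, F s a (x a))
      (∑ s : Finset (Fin (k + 1)), ((s.card : ℝ) * 0 ^ (s.card - 1))
        * ∫ x, edgeProd H W x * ∏ a, F s a (x a)) 0 :=
    HasDerivAt.fun_sum fun s _ => (hasDerivAt_pow s.card (0 : ℝ)).mul_const _
  convert hder using 1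
  -- only the singletons contribute to the derivative
  have hsing : ∑ s : Finset (Fin (k + 1)), ((s.card : ℝ) * 0 ^ (s.card - 1))
        * ∫ x, edgeProd H W x * ∏ a, F s a (x a)
      = ∑ a : Fin (k + 1), ∫ x, edgeProd H W x * ∏ b, F {a} b (x b) := by
    rw [← Finset.sum_subset (Finset.subset_univ (Finset.univ.powersetCard 1))]
    · rw [Finset.powersetCard_one, Finset.sum_map]
      simp
    · intro s _ hs
      have hs1 : s.card ≠ 1 := by simpa [Finset.mem_powersetCard] using hs
      rcases Nat.eq_zero_or_pos s.card with h | h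
      · simp [h]
      · rw [zero_pow (by omega)]; simp
  rw [hsing]
  let Q : Fin (k + 1) → (Fin (k + 1) → unitInterval) → ℝ := fun a x => ∏ b, F {a} b (x b)
  have hQperm : ∀ (σ : Equiv.Perm (Fin (k + 1))) a x, Q a (fun b => x (σ b)) = Q (σ a) x := by
    intro σ a x
    refine Fintype.prod_equiv σ _ _ fun b => ?_
    simp only [F, Finset.mem_singleton, EmbeddingLike.apply_eq_iff_eq]
  have hsum : ∑ a : Fin (k + 1), ∫ x, edgeProd H W x * Q a x
      = ∫ x, symTensor H W x * ∑ a, Q a x := by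
    rw [integral_symTensor_mul]
    · rw [← integral_finsetSum _ fun a _ => hintP {a}]
      simp only [Finset.mul_sum, Q]
    · intro σ x
      simp only [hQperm]
      exact Equiv.sum_comp σ fun a => Q a x
    · simp only [Finset.mul_sum]
      exact integrable_finsetSum _ fun a _ => hintP {a}
  have hQ0 : ∀ x, Q 0 x = d (x 0) * ∏ a : Fin k, f (x a.succ) := by
    intro x
    simp [Q, F, Fin.prod_univ_succ]
  have hSint : ∀ a, Integrable fun x => symTensor H W x * Q a x := fun a =>
    integrable_mul_prod_eval (ν := (volume : Measure unitInterval)) hp0 (memLp_symTensor hp hW)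
      (hF {a})
  have hSeq : ∀ a, ∫ x, symTensor H W x * Q a x = ∫ x, symTensor H W x * Q 0 x := by
    intro a
    have h1 : ∀ x, symTensor H W x * Q a x
        = (fun x => symTensor H W x * Q 0 x) (fun b => x (Equiv.swap 0 a b)) := by
      intro x
      simp only [hQperm, symTensor_permute, Equiv.swap_apply_left]
    simp only [h1]
    exact integral_permute (Equiv.swap 0 a) (hSint 0)
  change _ = ∑ a : Fin (k + 1), ∫ x, edgeProd H W x * Q a x
  rw [hsum]
  simp only [Finset.mul_sum]
  rw [integral_finsetSum _ fun a _ => hSint a]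
  simp only [hSeq, Finset.sum_const, Finset.card_univ, Fintype.card_fin, nsmul_eq_mul, hQ0]
  rw [(integral_mul_localField hp hW hd hf).2]
  push_cast
  ring

end FirstVariation

/-! ### The fixed point equation -/

section EulerLagrange

variable {μ : Measure ℝ}

theorem lintegral_rateFn_convex {f g : unitInterval → ℝ} (hf : Measurable f) (hg : Measurable g)
    {a b : ℝ} (ha : 0 ≤ a) (hb : 0 ≤ b) (hab : a + b = 1) :
    ∫⁻ u, rateFn μ (a * f u + b * g u)
      ≤ ENNReal.ofReal a * (∫⁻ u, rateFn μ (f u))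
        + ENNReal.ofReal b * ∫⁻ u, rateFn μ (g u) := by
  have hf' : Measurable fun u => rateFn μ (f u) := measurable_rateFn.comp hf
  have hg' : Measurable fun u => rateFn μ (g u) := measurable_rateFn.comp hg
  rw [← lintegral_const_mul (μ := (volume : Measure unitInterval)) _ hf',
    ← lintegral_const_mul (μ := (volume : Measure unitInterval)) _ hg',
    ← lintegral_add_left (hf'.const_mul _)]
  exact lintegral_mono fun u => rateFn_convex ha hb hab _ _

variable [IsProbabilityMeasure μ] {k : ℕ} {H : SimpleGraph (Fin (k + 1))} [DecidableRel H.Adj]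
  {W : unitInterval → unitInterval → ℝ} {p : ℝ≥0∞}

/-- The linearized problem: a maximizer `f` also maximizes `g ↦ ∫ (h g - γ(β(g)))`, where `h` is
the field generated by `f`. -/
theorem IsMaximizer.linearized (hk : 1 ≤ k) (hp : ((k + 1 : ℕ) : ℝ≥0∞) ≤ p)
    (htail : TailCondition μ p) (hW : IsKernel H p W) {θ B : ℝ} {f g : unitInterval → ℝ}
    (hf : IsMaximizer μ p H W θ B f) (hg : g ∈ {g ∈ funSpace μ p | entropyTerm μ g < ⊤}) :
    Integrable (fun u => (g u - f u) * (θ * ((k : ℝ) + 1) * localField H W f u + B)) ∧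
    ∫ u, (g u - f u) * (θ * ((k : ℝ) + 1) * localField H W f u + B)
      ≤ (∫⁻ u, rateFn μ (g u)).toReal - (∫⁻ u, rateFn μ (f u)).toReal := by
  have hp1 := one_lt_of_natCast_le hk hp
  have hexp := integrable_exp_of_tailCondition hp1.le htail
  obtain ⟨⟨⟨hfm, hfcl, hfL⟩, hffin⟩, hmax⟩ := hf
  obtain ⟨⟨hgm, hgcl, hgL⟩, hgfin⟩ := hg
  rw [entropyTerm_eq hexp hfcl] at hffin
  rw [entropyTerm_eq hexp hgcl] at hgfin
  set d : unitInterval → ℝ := fun u => g u - f u with hd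
  have hdL : MemLp d p volume := hgL.sub hfL
  have hdint : Integrable d := hdL.integrable hp1.le
  obtain ⟨hint, -⟩ := integral_mul_localField hp1 hW hdL hfL
  have hder := hasDerivAt_interaction hp1 hW hdL hfL
  have hrew : ∀ u, d u * (θ * ((k : ℝ) + 1) * localField H W f u + B)
      = θ * ((k : ℝ) + 1) * (d u * localField H W f u) + B * d u := fun u => by ring
  have hval : ∫ u, d u * (θ * ((k : ℝ) + 1) * localField H W f u + B)
      = θ * (((k : ℝ) + 1) * ∫ u, d u * localField H W f u) + B * ∫ u, d u := by
    simp only [hrew]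
    rw [integral_add (hint.const_mul _) (hdint.const_mul _), integral_const_mul,
      integral_const_mul]
    ring
  refine ⟨?_, ?_⟩
  · change Integrable fun u => d u * (θ * ((k : ℝ) + 1) * localField H W f u + B)
    simp only [hrew]
    exact (hint.const_mul _).add (hdint.const_mul _)
  change ∫ u, d u * (θ * ((k : ℝ) + 1) * localField H W f u + B) ≤ _
  rw [hval]
  set Ef := ∫⁻ u, rateFn μ (f u) with hEf
  set Eg := ∫⁻ u, rateFn μ (g u) with hEg
  have hcvx : Convex ℝ (closure (meanRange μ)) := (ordConnected_meanRange hexp).convex.closure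
  -- optimality against `(1 - ε) f + ε g`, divided by `ε`; the convexity of the entropy gives the
  -- right-hand side
  have hstep : ∀ ε ∈ Ioo (0 : ℝ) 1,
      θ * (ε⁻¹ * (interaction H W (fun u => f u + ε * d u)
        - interaction H W (fun u => f u + 0 * d u))) + B * ∫ u, d u ≤ Eg.toReal - Ef.toReal := by
    intro ε hε
    have hε0 := hε.1
    have hconv : ∀ u, f u + ε * d u = (1 - ε) * f u + ε * g u := fun u => by
      simp only [hd]; ring
    have hle : ∫⁻ u, rateFn μ (f u + ε * d u)
        ≤ ENNReal.ofReal (1 - ε) * Ef + ENNReal.ofReal ε * Eg := by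
      simp only [hconv]
      exact lintegral_rateFn_convex (μ := μ) (a := 1 - ε) (b := ε) hfm hgm (by linarith [hε.2])
        hε0.le (by ring)
    have htop : ENNReal.ofReal (1 - ε) * Ef + ENNReal.ofReal ε * Eg ≠ ⊤ :=
      ENNReal.add_ne_top.2 ⟨ENNReal.mul_ne_top ENNReal.ofReal_ne_top hffin.ne,
        ENNReal.mul_ne_top ENNReal.ofReal_ne_top hgfin.ne⟩
    have hcl : ∀ u, f u + ε * d u ∈ closure (meanRange μ) := by
      intro u
      rw [hconv]
      exact hcvx (hfcl u) (hgcl u) (by linarith [hε.2]) hε0.le (by ring)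
    have hmem := mem_domain (μ := μ) hk hp htail (f := fun u => f u + ε * d u)
      (hfm.add ((hgm.sub hfm).const_mul ε)) hcl (ne_top_of_le_ne_top htop hle)
    have h1 : objective μ H W θ B (fun u => f u + ε * d u) ≤ objective μ H W θ B f := hmax hmem
    have h2 := ENNReal.toReal_mono htop hle
    rw [ENNReal.toReal_add (ENNReal.mul_ne_top ENNReal.ofReal_ne_top hffin.ne)
      (ENNReal.mul_ne_top ENNReal.ofReal_ne_top hgfin.ne), ENNReal.toReal_mul, ENNReal.toReal_mul,
      ENNReal.toReal_ofReal (by linarith [hε.2]), ENNReal.toReal_ofReal hε0.le] at h2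
    simp only [objective] at h1
    rw [entropyTerm_eq hexp hfcl, entropyTerm_eq hexp hcl, ← hEf,
      integral_add (hfL.integrable hp1.le) (hdint.const_mul ε), integral_const_mul] at h1
    have h3 : (fun u => f u + 0 * d u) = f := by ext u; ring
    rw [h3]
    have h4 : ε * (θ * (ε⁻¹ * (interaction H W (fun u => f u + ε * d u) - interaction H W f))
        + B * ∫ u, d u) ≤ ε * (Eg.toReal - Ef.toReal) := by
      have : ε * (θ * (ε⁻¹ * (interaction H W (fun u => f u + ε * d u) - interaction H W f))
          + B * ∫ u, d u) = θ * (interaction H W (fun u => f u + ε * d u) - interaction H W f)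
            + ε * (B * ∫ u, d u) := by field_simp
      rw [this]
      nlinarith
    exact le_of_mul_le_mul_left h4 hε0
  have hlim := (hasDerivAt_iff_tendsto_slope_zero.1 hder)
  have hlim' : Tendsto (fun ε : ℝ => ε⁻¹ * (interaction H W (fun u => f u + ε * d u)
      - interaction H W (fun u => f u + 0 * d u))) (𝓝[>] 0)
      (𝓝 (((k : ℝ) + 1) * ∫ u, d u * localField H W f u)) := by
    have := hlim.mono_left (nhdsGT_le_nhdsNE (0 : ℝ))
    simpa only [zero_add, smul_eq_mul] using this
  refine le_of_tendsto ((hlim'.const_mul θ).add_const _) ?_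
  filter_upwards [Ioo_mem_nhdsGT (zero_lt_one' ℝ)] with ε hε using hstep ε hε

/-- The fixed point equation: compare a maximizer `f` with the function equal to `α'(h)` where
`|h| ≤ M` and to `f` elsewhere, and use the equality case of the Fenchel-Young inequality. -/
theorem IsMaximizer.fixedPoint (hk : 1 ≤ k) (hp : ((k + 1 : ℕ) : ℝ≥0∞) ≤ p)
    (htail : TailCondition μ p) (hW : IsKernel H p W) {θ B : ℝ} {f : unitInterval → ℝ}
    (hf : IsMaximizer μ p H W θ B f) :
    ∀ᵐ u, f u = deriv (logLaplace μ) (θ * ((k : ℝ) + 1) * localField H W f u + B) := by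
  have hp1 := one_lt_of_natCast_le hk hp
  have hexp := integrable_exp_of_tailCondition hp1.le htail
  have hα' := continuous_deriv_logLaplace hexp
  have hα := continuous_logLaplace hexp
  have hfm := hf.1.1.1
  have hfcl := hf.1.1.2.1
  have hffin : ∫⁻ u, rateFn μ (f u) ≠ ⊤ := by
    rw [← entropyTerm_eq hexp hfcl]; exact hf.1.2.ne
  have hflt := ae_lt_top (measurable_rateFn.comp hfm) hffin
  have hhm : AEStronglyMeasurable
      (fun u => θ * ((k : ℝ) + 1) * localField H W f u + B) volume :=
    ((aestronglyMeasurable_localField hp1 hW hf.1.1.2.2).const_mul _).add_const _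
  set h : unitInterval → ℝ := hhm.mk _ with hh
  have hm : Measurable h := hhm.stronglyMeasurable_mk.measurable
  have hae := hhm.ae_eq_mk
  have key : ∀ M : ℕ, ∀ᵐ u, |h u| ≤ M → f u = deriv (logLaplace μ) (h u) := by
    intro M
    classical
    let g : unitInterval → ℝ := fun u => if |h u| ≤ M then deriv (logLaplace μ) (h u) else f u
    have hgm : Measurable g := Measurable.ite (measurableSet_le (measurable_norm.comp hm)
      measurable_const) (hα'.measurable.comp hm) hfm
    have hgcl : ∀ u, g u ∈ closure (meanRange μ) := by
      intro u
      by_cases hu : |h u| ≤ M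
      · simp only [g, if_pos hu]
        exact subset_closure (deriv_logLaplace_mem_meanRange _)
      · simp only [g, if_neg hu]
        exact hfcl u
    obtain ⟨A, hA⟩ := (isCompact_Icc (a := -(M : ℝ)) (b := M)).exists_bound_of_continuousOn
      (f := fun t => t * deriv (logLaplace μ) t - logLaplace μ t)
      ((continuous_id.mul hα').sub hα).continuousOn
    have hgle : ∀ u, rateFn μ (g u) ≤ ENNReal.ofReal A + rateFn μ (f u) := by
      intro u
      by_cases hu : |h u| ≤ M
      · simp only [g, if_pos hu]
        rw [rateFn_deriv_logLaplace hexp]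
        exact le_trans (ENNReal.ofReal_le_ofReal ((le_abs_self _).trans (hA _ (abs_le.1 hu))))
          le_self_add
      · simp only [g, if_neg hu]
        exact le_add_self
    have hgfin : ∫⁻ u, rateFn μ (g u) ≠ ⊤ := by
      refine ne_top_of_le_ne_top ?_ (lintegral_mono hgle)
      rw [lintegral_add_left measurable_const]
      exact ENNReal.add_ne_top.2 ⟨by simp, hffin⟩
    have hglt := ae_lt_top (measurable_rateFn.comp hgm) hgfin
    obtain ⟨hint, hle⟩ := hf.linearized hk hp htail hW (mem_domain hk hp htail hgm hgcl hgfin)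
    have hcongr : (fun u => (g u - f u) * (θ * ((k : ℝ) + 1) * localField H W f u + B))
        =ᵐ[volume] fun u => (g u - f u) * h u := by
      filter_upwards [hae] with u hu
      rw [hu]
    rw [integral_congr_ae hcongr] at hle
    have hint' := hint.congr hcongr
    have hgmr : Measurable fun u => rateFn μ (g u) := measurable_rateFn.comp hgm
    have hfmr : Measurable fun u => rateFn μ (f u) := measurable_rateFn.comp hfm
    have hgi := integrable_toReal_of_lintegral_ne_top hgmr.aemeasurable hgfin
    have hfi := integrable_toReal_of_lintegral_ne_top hfmr.aemeasurable hffin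
    rw [← integral_toReal hgmr.aemeasurable hglt, ← integral_toReal hfmr.aemeasurable hflt] at hle
    -- the gain of `g` over `f` is pointwise nonnegative and has nonpositive integral
    let G : unitInterval → ℝ := fun u =>
      (g u - f u) * h u - ((rateFn μ (g u)).toReal - (rateFn μ (f u)).toReal)
    have hGi : Integrable G := hint'.sub (hgi.sub hfi)
    have hGeq : ∀ u, |h u| ≤ M → G u = (rateFn μ (f u)).toReal
        - (h u * f u - logLaplace μ (h u)) := by
      intro u hu
      simp only [G, g, if_pos hu]
      rw [toReal_rateFn_deriv_logLaplace hexp]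
      ring
    have hG0 : 0 ≤ᵐ[volume] G := by
      filter_upwards [hflt] with u hu
      by_cases hM : |h u| ≤ M
      · rw [hGeq u hM]
        have := fenchel_young (μ := μ) hu.ne (h u)
        simp only [Pi.zero_apply]
        linarith
      · simp [G, g, if_neg hM]
    have hGint : ∫ u, G u ≤ 0 := by
      have : ∫ u, G u = (∫ u, (g u - f u) * h u)
          - ((∫ u, (rateFn μ (g u)).toReal) - ∫ u, (rateFn μ (f u)).toReal) := by
        simp only [G]
        rw [← integral_sub hgi hfi]
        exact integral_sub hint' (hgi.sub hfi)
      linarith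
    have hGz := (integral_eq_zero_iff_of_nonneg_ae hG0 hGi).1
      (le_antisymm hGint (integral_nonneg_of_ae hG0))
    filter_upwards [hGz, hflt] with u hu hfu hM
    rw [hGeq u hM] at hu
    refine eq_deriv_logLaplace_of_fenchel_young_eq hexp hfu.ne ?_
    simp only [Pi.zero_apply] at hu
    linarith
  filter_upwards [ae_all_iff.2 key, hae] with u hu hu'
  obtain ⟨M, hM⟩ := exists_nat_ge |h u|
  rw [hu']
  exact hu M hM

end EulerLagrange

/-! ### Positive kernels of constant degree -/

section Positivity

variable {k : ℕ} {H : SimpleGraph (Fin (k + 1))} [DecidableRel H.Adj]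
  {W : unitInterval → unitInterval → ℝ} {p : ℝ≥0∞} {c : ℝ}

theorem ae_edgeProd_pos (hpos : ∀ᵐ z : unitInterval × unitInterval, 0 < W z.1 z.2) :
    ∀ᵐ x, 0 < edgeProd H W x := by
  have h2 : ∀ e : Fin (k + 1) × Fin (k + 1),
      ∀ᵐ x : Fin (k + 1) → unitInterval, e.1 < e.2 → 0 < W (x e.1) (x e.2) := by
    intro e
    by_cases he : e.1 < e.2
    · have := (measurePreserving_eval_pair (ν := (volume : Measure unitInterval))
        he.ne).quasiMeasurePreserving.ae hpos
      filter_upwards [this] with x hx _ using hx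
    · exact Eventually.of_forall fun x h => absurd h he
  filter_upwards [ae_all_iff.2 h2] with x hx
  exact Finset.prod_pos fun e he => hx e (Finset.mem_filter.1 he).2.1

theorem ae_symTensor_pos (hpos : ∀ᵐ z : unitInterval × unitInterval, 0 < W z.1 z.2) :
    ∀ᵐ x, 0 < symTensor H W x := by
  have h1 : ∀ σ : Equiv.Perm (Fin (k + 1)),
      ∀ᵐ x : Fin (k + 1) → unitInterval, 0 < edgeProd H W (fun a => x (σ a)) := fun σ =>
    (measurePreserving_permute σ).quasiMeasurePreserving.ae (ae_edgeProd_pos hpos)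
  filter_upwards [ae_all_iff.2 h1] with x hx
  exact mul_pos (by positivity) (Finset.sum_pos (fun σ _ => hx σ) Finset.univ_nonempty)

/-- Integrating out all coordinates but one replaces `Sym[W]` by the constant `c`. -/
theorem integral_symTensor_mul_eval (hp : 1 < p) (hW : IsKernel H p W) (hc : IsPosRegular H W c)
    {φ : unitInterval → ℝ} (hφ : Integrable φ) (a : Fin (k + 1)) :
    Integrable (fun x => symTensor H W x * φ (x a)) ∧
      ∫ x, symTensor H W x * φ (x a) = c * ∫ u, φ u := by
  have hS : Integrable (symTensor H W) := (memLp_symTensor hp hW).integrable (one_le_conjExp p)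
  have hSc := integrable_cons hS
  have hnorm : ∀ᵐ u, ∫ y : Fin k → unitInterval, ‖symTensor H W (Fin.cons u y)‖ = c := by
    have h1 : ∀ᵐ z : unitInterval × (Fin k → unitInterval), 0 < symTensor H W (Fin.cons z.1 z.2) :=
      measurePreserving_cons.quasiMeasurePreserving.ae (ae_symTensor_pos hc.1)
    filter_upwards [Measure.ae_ae_of_ae_prod h1, hc.2] with u hu hcu
    rw [← hcu, symDegree]
    refine integral_congr_ae ?_
    filter_upwards [hu] with y hy
    exact Real.norm_of_nonneg hy.le
  have h0 : Integrable (fun x => symTensor H W x * φ (x 0)) := by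
    have hmeas : AEStronglyMeasurable (fun x : Fin (k + 1) → unitInterval =>
        symTensor H W x * φ (x 0)) volume :=
      hS.1.mul (hφ.1.comp_measurePreserving
        (measurePreserving_eval (fun _ : Fin (k + 1) => (volume : Measure unitInterval)) 0))
    have h2 : Integrable (fun z : unitInterval × (Fin k → unitInterval) =>
        symTensor H W (Fin.cons z.1 z.2) * φ z.1) (volume.prod volume) := by
      have hm' := hmeas.comp_measurePreserving (measurePreserving_cons (k := k))
      refine (integrable_prod_iff hm').2 ⟨?_, ?_⟩
      · filter_upwards [hSc.prod_right_ae] with u hu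
        exact hu.mul_const (φ u)
      · refine (hφ.norm.const_mul c).congr ?_
        filter_upwards [hnorm] with u hu
        simp only [Function.comp, Fin.cons_zero, norm_mul]
        rw [integral_mul_const, hu]
    exact (measurePreserving_cons.integrable_comp_emb measurableEmbedding_cons).1 h2
  have h0' : ∫ x, symTensor H W x * φ (x 0) = c * ∫ u, φ u := by
    rw [integral_cons h0, ← integral_const_mul]
    refine integral_congr_ae ?_
    filter_upwards [hc.2] with u hu
    simp only [Fin.cons_zero]
    rw [integral_mul_const, ← hu, symDegree]
  have hperm : ∀ x, symTensor H W x * φ (x a)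
      = (fun x => symTensor H W x * φ (x 0)) (fun b => x (Equiv.swap 0 a b)) := by
    intro x
    simp only [symTensor_permute, Equiv.swap_apply_left]
  simp only [hperm]
  exact ⟨(measurePreserving_permute _).integrable_comp_of_integrable h0,
    (integral_permute _ h0).trans h0'⟩

theorem integral_edgeProd (hp : 1 < p) (hW : IsKernel H p W) (hc : IsPosRegular H W c) :
    ∫ x, edgeProd H W x = c := by
  have h1 := (integral_symTensor_mul_eval hp hW hc (integrable_const (1 : ℝ)) 0).2
  have h2 := integral_symTensor_mul (H := H) (W := W) (Q := fun _ => 1) (fun _ _ => rfl)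
    (by simpa using (memLp_edgeProd hp hW).integrable (one_le_conjExp p))
  simp only [mul_one] at h1 h2
  rw [← h2, h1]
  simp

/-- The degree `c` is the integral of the positive edge product. -/
theorem IsPosRegular.pos (hp : 1 < p) (hW : IsKernel H p W) (hc : IsPosRegular H W c) : 0 < c := by
  rw [← integral_edgeProd hp hW hc,
    integral_pos_iff_support_of_nonneg_ae ((ae_edgeProd_pos hc.1).mono fun x hx => hx.le)
      ((memLp_edgeProd hp hW).integrable (one_le_conjExp p))]
  have h1 : ∀ᵐ x, x ∈ Function.support (edgeProd H W) :=
    (ae_edgeProd_pos hc.1).mono fun x hx => hx.ne'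
  refine pos_iff_ne_zero.2 fun h0 => ?_
  obtain ⟨x, hx, hx'⟩ := (h1.and (measure_eq_zero_iff_ae_notMem.1 h0)).exists
  exact hx' hx

end Positivity

/-! ### Constant functions -/

section ConstantFunctions

variable {μ : Measure ℝ} [IsProbabilityMeasure μ] {k : ℕ} {H : SimpleGraph (Fin (k + 1))}
  [DecidableRel H.Adj] {W : unitInterval → unitInterval → ℝ} {p : ℝ≥0∞} {c : ℝ}

theorem objective_const (hk : 1 ≤ k) (hp : ((k + 1 : ℕ) : ℝ≥0∞) ≤ p)
    (htail : TailCondition μ p) (hW : IsKernel H p W) (hc : IsPosRegular H W c) (θ B : ℝ) {x : ℝ}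
    (hx : rateFn μ x ≠ ⊤) :
    objective μ H W θ B (fun _ => x)
      = θ * (c * x ^ (k + 1)) + B * x - (rateFn μ x).toReal := by
  have hp1 := one_lt_of_natCast_le hk hp
  have hexp := integrable_exp_of_tailCondition hp1.le htail
  have h1 : interaction H W (fun _ => x) = c * x ^ (k + 1) := by
    simp only [interaction, interactionIntegrand, Finset.prod_const, Finset.card_univ,
      Fintype.card_fin]
    rw [integral_mul_const, integral_edgeProd hp1 hW hc]
  rw [objective, h1, entropyTerm_eq hexp fun _ => mem_closure_meanRange_of_rateFn_ne_top hexp hx]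
  simp

theorem const_fixedPoint (hk : 1 ≤ k) (hp : ((k + 1 : ℕ) : ℝ≥0∞) ≤ p)
    (htail : TailCondition μ p) (hW : IsKernel H p W) (hc : IsPosRegular H W c) {θ B : ℝ}
    {f : unitInterval → ℝ} (hf : IsMaximizer μ p H W θ B f) {x : ℝ} (hx : ∀ᵐ u, f u = x) :
    x = deriv (logLaplace μ) (θ * ((k : ℝ) + 1) * c * x ^ k + B) := by
  have hfield : ∀ u, localField H W f u = symDegree H W u * x ^ k := by
    intro u
    rw [localField, symDegree, ← integral_mul_const]
    refine integral_congr_ae ?_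
    have h1 := prod_eval_ae_eq (ι := Fin k) (ν := (volume : Measure unitInterval))
      (F := fun _ => f) (F' := fun _ _ => x) fun _ => hx
    filter_upwards [h1] with y hy
    simp only [fieldIntegrand, hy, Finset.prod_const, Finset.card_univ, Fintype.card_fin]
  obtain ⟨u, ⟨h1, h2⟩, h3⟩ := ((hx.and (hf.fixedPoint hk hp htail hW)).and hc.2).exists
  rw [h1, hfield, h3] at h2
  rw [mul_assoc]
  exact h2

end ConstantFunctions

/-! ### Stochastic non-negativity -/

section Reflection

variable {μ : Measure ℝ}

/-- A point strictly between a point of `cl 𝒩` and the mean `α'(0)` lies in `𝒩`. -/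
theorem mem_meanRange_of_between (hexp : ∀ t : ℝ, Integrable (fun x => Real.exp (t * x)) μ)
    {x : ℝ} (hx : x ∈ closure (meanRange μ)) {ε : ℝ} (hε : ε ∈ Ioo (0 : ℝ) 1)
    (hxm : x ≠ deriv (logLaplace μ) 0) :
    (1 - ε) * x + ε * deriv (logLaplace μ) 0 ∈ meanRange μ := by
  have hm := deriv_logLaplace_mem_meanRange (μ := μ) 0
  set m := deriv (logLaplace μ) 0
  set s := (1 - ε) * x + ε * m with hs
  have hscl : s ∈ closure (meanRange μ) :=
    (ordConnected_meanRange hexp).convex.closure hx (subset_closure hm) (by linarith [hε.2])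
      hε.1.le (by ring)
  by_contra hsN
  have h1 : s - x = ε * (m - x) := by rw [hs]; ring
  have h2 : m - s = (1 - ε) * (m - x) := by rw [hs]; ring
  have h3 : 0 < 1 - ε := by linarith [hε.2]
  rcases isLUB_or_isGLB_of_mem_closure_meanRange hexp hscl hsN with h | h
  · have h4 : m ≤ s := h.1 hm
    have h5 : x ≤ s := closure_minimal (fun y hy => h.1 hy) isClosed_Iic hx
    rcases lt_or_gt_of_ne hxm with h6 | h6
    · nlinarith
    · nlinarith [mul_pos hε.1 (sub_pos.2 h6)]
  · have h4 : s ≤ m := h.1 hm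
    have h5 : s ≤ x := closure_minimal (fun y hy => h.1 hy) isClosed_Ici hx
    rcases lt_or_gt_of_ne hxm with h6 | h6
    · nlinarith [mul_pos hε.1 (sub_pos.2 h6)]
    · nlinarith

variable [IsProbabilityMeasure μ]

/-- Stochastic non-negativity bounds the entropy at `|x|` by the entropy at `x`; the end points of
`𝒩` are reached by lower semicontinuity. -/
theorem StochNonneg.rateFn_abs_le (hexp : ∀ t : ℝ, Integrable (fun x => Real.exp (t * x)) μ)
    (hs : StochNonneg μ) {x : ℝ} (hx : rateFn μ x ≠ ⊤) : rateFn μ |x| ≤ rateFn μ x := by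
  rcases le_or_gt 0 x with h0 | h0
  · rw [abs_of_nonneg h0]
  rw [abs_of_neg h0]
  have hN : ∀ y : ℝ, y < 0 → y ∈ meanRange μ → rateFn μ (-y) ≤ rateFn μ y := by
    intro y hy hyN
    obtain ⟨h1, h2⟩ := hs (-y) (neg_pos.2 hy) (by rwa [neg_neg])
    rwa [neg_neg, tiltEntropy_tiltParam hexp (subset_closure h1),
      tiltEntropy_tiltParam hexp (subset_closure hyN)] at h2
  by_cases hxm : x = deriv (logLaplace μ) 0
  · exact hN x h0 (hxm ▸ deriv_logLaplace_mem_meanRange 0)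
  have hcl := mem_closure_meanRange_of_rateFn_ne_top hexp hx
  set m := deriv (logLaplace μ) 0 with hm
  let ε : ℕ → ℝ := fun n => 1 / ((n : ℝ) + 1)
  have hεlim : Tendsto ε atTop (𝓝 0) := tendsto_one_div_add_atTop_nhds_zero_nat
  have hslim : Tendsto (fun n => (1 - ε n) * x + ε n * m) atTop (𝓝 x) := by
    have := ((tendsto_const_nhds (x := (1 : ℝ))).sub hεlim).mul_const x
    simpa using this.add (hεlim.mul_const m)
  have hclosed : IsClosed {y | rateFn μ y ≤ rateFn μ x} :=
    lowerSemicontinuous_rateFn.isClosed_preimage _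
  refine hclosed.mem_of_tendsto hslim.neg ?_
  filter_upwards [hslim.eventually_lt_const h0, eventually_gt_atTop 0] with n hn hn0
  have hε : ε n ∈ Ioo (0 : ℝ) 1 := by
    have : (0 : ℝ) < n := by exact_mod_cast hn0
    refine ⟨by positivity, ?_⟩
    rw [div_lt_one (by positivity)]
    linarith
  refine (hN _ hn (mem_meanRange_of_between hexp hcl hε hxm)).trans ?_
  refine (rateFn_convex (by linarith [hε.2]) hε.1.le (by ring) _ _).trans ?_
  rw [rateFn_mean hexp, mul_zero, add_zero]
  refine mul_le_of_le_one_left zero_le ?_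
  rw [ENNReal.ofReal_le_one]
  linarith [hε.1]

/-- For `n` even or `μ` stochastically non-negative, a point `x` of finite entropy is dominated by
some `y ≥ x` with `y ^ n = |x| ^ n` and no larger entropy. -/
theorem exists_dominating_point (hexp : ∀ t : ℝ, Integrable (fun x => Real.exp (t * x)) μ) {n : ℕ}
    (h : Even n ∨ StochNonneg μ) {x : ℝ} (hx : rateFn μ x ≠ ⊤) :
    ∃ y, rateFn μ y ≤ rateFn μ x ∧ x ≤ y ∧ y ^ n = |x| ^ n := by
  rcases h with h | h
  · exact ⟨x, le_rfl, le_rfl, (h.pow_abs x).symm⟩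
  · exact ⟨|x|, h.rateFn_abs_le hexp hx, le_abs_self x, rfl⟩

end Reflection

/-! ### Replica symmetry -/

section ReplicaSymmetry

/-- The inequality of arithmetic and geometric means for `n = k + 1` real numbers. -/
theorem prod_le_mean_abs_pow {k : ℕ} (z : Fin (k + 1) → ℝ) :
    ∏ a, z a ≤ (1 / ((k : ℝ) + 1)) * ∑ a, |z a| ^ (k + 1) := by
  have hk : ((k : ℝ) + 1) ≠ 0 := by positivity
  have h := Real.geom_mean_le_arith_mean_weighted Finset.univ
    (fun _ : Fin (k + 1) => 1 / ((k : ℝ) + 1)) (fun a => |z a| ^ (k + 1))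
    (fun _ _ => by positivity) (by simp [hk]) (fun _ _ => by positivity)
  rw [← Finset.mul_sum] at h
  refine le_trans ?_ h
  calc ∏ a, z a ≤ |∏ a, z a| := le_abs_self _
    _ = ∏ a, |z a| := Finset.abs_prod _ _
    _ = _ := by
      refine Finset.prod_congr rfl fun a _ => ?_
      rw [← Real.rpow_natCast, ← Real.rpow_mul (abs_nonneg _)]
      push_cast
      rw [mul_one_div_cancel hk, Real.rpow_one]

/-- If the equality case of the arithmetic-geometric mean inequality holds for almost all tuples of
values of `f`, then `f` is constant: two distinct points `a`, `b` in the support of the law of `f`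
would satisfy `|a| = |b|`, and then the equality would fail for the signs. -/
theorem ae_const_of_prod_eq_mean {k : ℕ} (hk : 1 ≤ k) {f : unitInterval → ℝ} (hf : Measurable f)
    (h : ∀ᵐ x : Fin (k + 1) → unitInterval,
      ∏ a, f (x a) = (1 / ((k : ℝ) + 1)) * ∑ a, |f (x a)| ^ (k + 1)) :
    ∃ r : ℝ, ∀ᵐ u, f u = r := by
  set ν := (volume : Measure unitInterval).map f with hν
  have hνp : IsProbabilityMeasure ν := Measure.isProbabilityMeasure_map hf.aemeasurable
  have hkpos : (0 : ℝ) < (k : ℝ) + 1 := by positivity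
  have hsupp : ∀ z : Fin (k + 1) → ℝ, (∀ a, z a ∈ ν.support) →
      ∏ a, z a = (1 / ((k : ℝ) + 1)) * ∑ a, |z a| ^ (k + 1) := by
    intro z hz
    by_contra hne
    have hopen : IsOpen {w : Fin (k + 1) → ℝ |
        ∏ a, w a ≠ (1 / ((k : ℝ) + 1)) * ∑ a, |w a| ^ (k + 1)} :=
      isOpen_ne_fun (by fun_prop) (by fun_prop)
    obtain ⟨ε, hε, hball⟩ := Metric.isOpen_iff.1 hopen z hne
    have hnull : volume (Set.pi univ fun a : Fin (k + 1) => f ⁻¹' Metric.ball (z a) ε) = 0 := by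
      refine measure_mono_null (fun x hx => ?_) h
      have : (fun a => f (x a)) ∈ Metric.ball z ε := by
        rw [ball_pi _ hε]
        exact fun a _ => hx a (mem_univ a)
      exact hball this
    rw [volume_pi_pi, Finset.prod_eq_zero_iff] at hnull
    obtain ⟨a, -, ha⟩ := hnull
    rw [← Measure.map_apply hf Metric.isOpen_ball.measurableSet] at ha
    exact ((Measure.mem_support_iff_forall _).1 (hz a) _ (Metric.ball_mem_nhds _ hε)).ne' ha
  obtain ⟨a, ha⟩ := Measure.nonempty_support (μ := ν) (IsProbabilityMeasure.ne_zero ν)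
  have huniq : ∀ b ∈ ν.support, b = a := by
    intro b hb
    -- the equality case for the tuple `(s, t, …, t)`
    have hcons : ∀ {s t : ℝ}, s ∈ ν.support → t ∈ ν.support →
        ((k : ℝ) + 1) * (s * t ^ k) = |s| ^ (k + 1) + k * |t| ^ (k + 1) := by
      intro s t hs ht
      have := hsupp (Fin.cons s fun _ => t) (fun i => by
        refine Fin.cases ?_ (fun _ => ?_) i <;> simpa)
      simp only [Fin.prod_univ_succ, Fin.sum_univ_succ, Fin.cons_zero, Fin.cons_succ,
        Finset.prod_const, Finset.sum_const, Finset.card_univ, Fintype.card_fin,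
        nsmul_eq_mul] at this
      rw [this]
      field_simp
    have hab := hcons ha hb
    have hba := hcons hb ha
    have haa := hcons ha ha
    have h1 : a * b ^ k + b * a ^ k = |a| ^ (k + 1) + |b| ^ (k + 1) := by
      have : ((k : ℝ) + 1) * (a * b ^ k + b * a ^ k)
          = ((k : ℝ) + 1) * (|a| ^ (k + 1) + |b| ^ (k + 1)) := by linarith
      exact mul_left_cancel₀ hkpos.ne' this
    have h2 : a * b ^ k ≤ |a| * |b| ^ k := by
      rw [← abs_pow, ← abs_mul]; exact le_abs_self _
    have h3 : b * a ^ k ≤ |b| * |a| ^ k := by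
      rw [← abs_pow, ← abs_mul]; exact le_abs_self _
    have h4 : (|a| - |b|) * (|a| ^ k - |b| ^ k) ≤ 0 := by
      have : (|a| - |b|) * (|a| ^ k - |b| ^ k)
          = |a| ^ (k + 1) + |b| ^ (k + 1) - (|a| * |b| ^ k + |b| * |a| ^ k) := by ring
      linarith
    have h5 : |a| = |b| := by
      by_contra hne
      rcases lt_or_gt_of_ne hne with hlt | hlt
      · have := pow_lt_pow_left₀ hlt (abs_nonneg a) (by omega : k ≠ 0)
        nlinarith
      · have := pow_lt_pow_left₀ hlt (abs_nonneg b) (by omega : k ≠ 0)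
        nlinarith
    rw [← h5] at hba
    have h6 : b * a ^ k = a * a ^ k := mul_left_cancel₀ hkpos.ne' (hba.trans haa.symm)
    by_cases ha0 : a = 0
    · rw [ha0] at h5 ⊢
      simpa using h5.symm
    · exact mul_right_cancel₀ (pow_ne_zero k ha0) h6
  refine ⟨a, ?_⟩
  have h1 : ∀ᵐ y ∂ν, y ∈ ν.support := Measure.support_mem_ae
  exact (ae_of_ae_map hf.aemeasurable h1).mono fun u hu => huniq _ hu

variable {μ : Measure ℝ} [IsProbabilityMeasure μ] {k : ℕ} {H : SimpleGraph (Fin (k + 1))}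
  [DecidableRel H.Adj] {W : unitInterval → unitInterval → ℝ} {p : ℝ≥0∞} {c : ℝ}

theorem interaction_eq_integral_symTensor (hp : 1 < p) (hW : IsKernel H p W)
    {f : unitInterval → ℝ} (hf : MemLp f p volume) :
    interaction H W f = ∫ x, symTensor H W x * ∏ a, f (x a) :=
  (integral_symTensor_mul (fun σ x => Equiv.prod_comp σ fun a => f (x a))
    (integrable_interactionIntegrand hp hW hf)).symm

/-- Replica symmetry: every maximizer `f` is a.e. constant. No constant beats `f`, which
after integration bounds `c ∫ |f| ^ v` by `G_W(f)`; the arithmetic-geometric mean inequality gives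
the opposite bound, so that its equality case holds for almost all tuples of values of `f`. -/
theorem IsMaximizer.ae_const (hk : 1 ≤ k) (hp : ((k + 1 : ℕ) : ℝ≥0∞) ≤ p)
    (htail : TailCondition μ p) (hpar : Even (k + 1) ∨ StochNonneg μ) (hW : IsKernel H p W)
    (hc : IsPosRegular H W c) {θ B : ℝ} (hθ : 0 ≤ θ) (hB : 0 ≤ B) {f : unitInterval → ℝ}
    (hf : IsMaximizer μ p H W θ B f) : ∃ r : ℝ, ∀ᵐ u, f u = r := by
  have hp1 := one_lt_of_natCast_le hk hp
  have hexp := integrable_exp_of_tailCondition hp1.le htail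
  rcases hθ.eq_or_lt with hθ0 | hθ0
  · refine ⟨deriv (logLaplace μ) B, ?_⟩
    filter_upwards [hf.fixedPoint hk hp htail hW] with u hu
    simpa [← hθ0] using hu
  have hfm := hf.1.1.1
  have hfL := hf.1.1.2.2
  have hffin : ∫⁻ u, rateFn μ (f u) ≠ ⊤ := by
    rw [← entropyTerm_eq hexp hf.1.1.2.1]; exact hf.1.2.ne
  have hcpos := hc.pos hp1 hW
  have hfr : Measurable fun u => rateFn μ (f u) := measurable_rateFn.comp hfm
  have hflt := ae_lt_top hfr hffin
  have hri := integrable_toReal_of_lintegral_ne_top hfr.aemeasurable hffin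
  have hfi : Integrable f := hfL.integrable hp1.le
  have hpow : Integrable fun u => |f u| ^ (k + 1) := by
    have := (hfL.mono_exponent hp).integrable_norm_pow (by omega)
    simpa using this
  -- pointwise, the integrand is dominated by the objective of a constant function
  have hpt : ∀ᵐ u, θ * (c * |f u| ^ (k + 1)) + B * f u - (rateFn μ (f u)).toReal
      ≤ objective μ H W θ B f := by
    filter_upwards [hflt] with u hu
    obtain ⟨y, hy1, hy2, hy3⟩ := exists_dominating_point hexp hpar hu.ne
    have hytop : rateFn μ y ≠ ⊤ := ne_top_of_le_ne_top hu.ne hy1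
    have h1 : objective μ H W θ B (fun _ => y) ≤ objective μ H W θ B f :=
      hf.2 (const_mem_domain hk hp htail hytop)
    rw [objective_const hk hp htail hW hc θ B hytop, hy3] at h1
    have h2 := ENNReal.toReal_mono hu.ne hy1
    have h3 := mul_le_mul_of_nonneg_left hy2 hB
    linarith
  have hint1 : ∫ u, (θ * (c * |f u| ^ (k + 1)) + B * f u - (rateFn μ (f u)).toReal)
      ≤ objective μ H W θ B f := by
    have h1 : Integrable fun u => θ * (c * |f u| ^ (k + 1)) + B * f u - (rateFn μ (f u)).toReal :=
      (((hpow.const_mul c).const_mul θ).add (hfi.const_mul B)).sub hri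
    refine (integral_mono_ae h1 (integrable_const (objective μ H W θ B f)) hpt).trans ?_
    simp
  have hint2 : ∫ u, (θ * (c * |f u| ^ (k + 1)) + B * f u - (rateFn μ (f u)).toReal)
      = θ * (c * ∫ u, |f u| ^ (k + 1)) + B * (∫ u, f u) - (∫⁻ u, rateFn μ (f u)).toReal := by
    have h1 : Integrable fun u => θ * (c * |f u| ^ (k + 1)) := (hpow.const_mul c).const_mul θ
    have h2 : Integrable fun u => B * f u := hfi.const_mul B
    have h3 : Integrable fun u => θ * (c * |f u| ^ (k + 1)) + B * f u := h1.add h2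
    rw [integral_sub h3 hri, integral_add h1 h2, integral_const_mul, integral_const_mul,
      integral_const_mul, integral_toReal hfr.aemeasurable hflt]
  have hle : c * ∫ u, |f u| ^ (k + 1) ≤ interaction H W f := by
    rw [hint2, objective, entropyTerm_eq hexp hf.1.1.2.1] at hint1
    have : θ * (c * ∫ u, |f u| ^ (k + 1)) ≤ θ * interaction H W f := by linarith
    exact le_of_mul_le_mul_left this hθ0
  -- the defect in the arithmetic-geometric mean inequality integrates to zero
  have hterm : ∀ a : Fin (k + 1), Integrable (fun x => symTensor H W x * |f (x a)| ^ (k + 1)) ∧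
      ∫ x, symTensor H W x * |f (x a)| ^ (k + 1) = c * ∫ u, |f u| ^ (k + 1) := fun a =>
    integral_symTensor_mul_eval hp1 hW hc hpow a
  have := holderTriple_conjExp hp1.le
  have hprodi : Integrable fun x => symTensor H W x * ∏ a, f (x a) :=
    integrable_mul_prod_eval (ν := (volume : Measure unitInterval)) (zero_lt_one.trans hp1).ne'
      (memLp_symTensor hp1 hW) fun _ => hfL
  have hmeani : Integrable fun x => symTensor H W x *
      ((1 / ((k : ℝ) + 1)) * ∑ a, |f (x a)| ^ (k + 1)) := by
    have : ∀ x : Fin (k + 1) → unitInterval,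
        symTensor H W x * ((1 / ((k : ℝ) + 1)) * ∑ a, |f (x a)| ^ (k + 1))
          = (1 / ((k : ℝ) + 1)) * ∑ a, symTensor H W x * |f (x a)| ^ (k + 1) := by
      intro x; rw [← Finset.mul_sum]; ring
    simp only [this]
    exact (integrable_finsetSum _ fun a _ => (hterm a).1).const_mul _
  have hmean : ∫ x, symTensor H W x * ((1 / ((k : ℝ) + 1)) * ∑ a, |f (x a)| ^ (k + 1))
      = c * ∫ u, |f u| ^ (k + 1) := by
    have : ∀ x : Fin (k + 1) → unitInterval,
        symTensor H W x * ((1 / ((k : ℝ) + 1)) * ∑ a, |f (x a)| ^ (k + 1))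
          = (1 / ((k : ℝ) + 1)) * ∑ a, symTensor H W x * |f (x a)| ^ (k + 1) := by
      intro x; rw [← Finset.mul_sum]; ring
    simp only [this]
    rw [integral_const_mul, integral_finsetSum _ fun a _ => (hterm a).1]
    simp only [(hterm _).2, Finset.sum_const, Finset.card_univ, Fintype.card_fin, nsmul_eq_mul]
    push_cast
    field_simp
  have hnn : 0 ≤ᵐ[volume] fun x => symTensor H W x *
      ((1 / ((k : ℝ) + 1)) * ∑ a, |f (x a)| ^ (k + 1)) - symTensor H W x * ∏ a, f (x a) := by
    filter_upwards [ae_symTensor_pos (H := H) hc.1] with x hx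
    have := mul_le_mul_of_nonneg_left (prod_le_mean_abs_pow fun a => f (x a)) hx.le
    simpa using this
  have hzero : ∫ x, (symTensor H W x * ((1 / ((k : ℝ) + 1)) * ∑ a, |f (x a)| ^ (k + 1))
      - symTensor H W x * ∏ a, f (x a)) = 0 := by
    refine le_antisymm ?_ (integral_nonneg_of_ae hnn)
    rw [integral_sub hmeani hprodi, hmean, ← interaction_eq_integral_symTensor hp1 hW hfL]
    linarith
  have hae := (integral_eq_zero_iff_of_nonneg_ae hnn (hmeani.sub hprodi)).1 hzero
  refine ae_const_of_prod_eq_mean hk hfm ?_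
  filter_upwards [hae, ae_symTensor_pos (H := H) hc.1] with x hx hpos
  simp only [Pi.zero_apply] at hx
  exact (mul_left_cancel₀ hpos.ne' (sub_eq_zero.1 hx)).symm

end ReplicaSymmetry

/-! ### Base measures on a bounded interval -/

section BoundedSupport

variable {μ : Measure ℝ} [IsProbabilityMeasure μ]

/-- If `μ` is supported on `[-1,1]`, then `α''(s) → 0` as `s → ∞`: with `S = sup 𝒩` the variance of
`μ_s` is at most `E (S - X)² ≤ 2 E (S - X) = 2 (S - α'(s))`. -/
theorem exists_deriv_deriv_logLaplace_le
    (hexp : ∀ t : ℝ, Integrable (fun x => Real.exp (t * x)) μ)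
    (hsupp : ∀ᵐ x ∂μ, x ∈ Icc (-1 : ℝ) 1) {ε : ℝ} (hε : 0 < ε) :
    ∃ T : ℝ, ∀ s, T ≤ s → deriv (deriv (logLaplace μ)) s ≤ ε := by
  have habs : ∀ᵐ x ∂μ, |x| ≤ 1 := hsupp.mono fun x hx => abs_le.2 hx
  have hbdd : BddAbove (meanRange μ) := ⟨1, by
    rintro _ ⟨t, rfl⟩
    exact (abs_le.1 (abs_deriv_logLaplace_le hexp habs t)).2⟩
  have hne : (meanRange μ).Nonempty := ⟨_, deriv_logLaplace_mem_meanRange 0⟩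
  set S := sSup (meanRange μ) with hS
  have hlub : IsLUB (meanRange μ) S := isLUB_csSup hne hbdd
  have hS1 : S ≤ 1 := hlub.2 (by
    rintro _ ⟨t, rfl⟩
    exact (abs_le.1 (abs_deriv_logLaplace_le hexp habs t)).2)
  have hle := ae_le_of_mem_upperBounds hexp hlub.1
  obtain ⟨_, ⟨T, rfl⟩, hT⟩ := exists_lt_of_lt_csSup hne (by linarith : S - ε / 2 < S)
  refine ⟨T, fun s hs => ?_⟩
  have := isProbabilityMeasure_expTilt hexp s
  have hac : expTilt μ s ≪ μ := tilted_absolutelyContinuous _ _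
  have hint := integrable_expTilt hexp s
  have hmeas : AEStronglyMeasurable (fun x : ℝ => x) (expTilt μ s) :=
    measurable_id.aestronglyMeasurable
  have hlin : Integrable (fun x : ℝ => 2 * (S - x)) (expTilt μ s) :=
    ((integrable_const S).sub hint).const_mul 2
  calc deriv (deriv (logLaplace μ)) s
      = variance (fun x : ℝ => S - x) (expTilt μ s) := by
        rw [variance_const_sub hmeas, variance_expTilt hexp]
    _ ≤ ∫ x, (S - x) ^ 2 ∂(expTilt μ s) :=
        variance_le_expectation_sq (aestronglyMeasurable_const.sub hmeas)
    _ ≤ ∫ x, 2 * (S - x) ∂(expTilt μ s) := by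
        refine integral_mono_of_nonneg (Eventually.of_forall fun x => sq_nonneg _) hlin ?_
        filter_upwards [hac.ae_le hle, hac.ae_le hsupp] with x hx1 hx2
        nlinarith [hx2.1]
    _ = 2 * (S - deriv (logLaplace μ) s) := by
        rw [integral_const_mul, integral_sub (integrable_const S) hint, integral_expTilt hexp]
        simp
    _ ≤ ε := by
        have := monotone_deriv_logLaplace hexp hs
        linarith

/-- The scalar fixed point equation has at most one solution when the field `B` is large: the
right-hand side is then a contraction, because `α''` is small near `B`. -/
theorem exists_fixedPoint_unique
    (hexp : ∀ t : ℝ, Integrable (fun x => Real.exp (t * x)) μ)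
    (hsupp : ∀ᵐ x ∂μ, x ∈ Icc (-1 : ℝ) 1) {b : ℝ} (hb : 0 ≤ b) (k : ℕ) :
    ∃ B₀ : ℝ, ∀ B : ℝ, B₀ < B → ∀ x y : ℝ,
      x = deriv (logLaplace μ) (b * x ^ k + B) → y = deriv (logLaplace μ) (b * y ^ k + B) →
        x = y := by
  have habs : ∀ᵐ x ∂μ, |x| ≤ 1 := hsupp.mono fun x hx => abs_le.2 hx
  obtain ⟨T, hT⟩ := exists_deriv_deriv_logLaplace_le hexp hsupp
    (ε := 1 / (2 * (b * k + 1))) (by positivity)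
  refine ⟨T + b, fun B hB x y hx hy => ?_⟩
  have hx1 : |x| ≤ 1 := hx ▸ abs_deriv_logLaplace_le hexp habs _
  have hy1 : |y| ≤ 1 := hy ▸ abs_deriv_logLaplace_le hexp habs _
  have hmem : ∀ z : ℝ, |z| ≤ 1 → b * z ^ k + B ∈ Ici T := by
    intro z hz
    have h1 : |z ^ k| ≤ 1 := by rw [abs_pow]; exact pow_le_one₀ (abs_nonneg z) hz
    have h2 := (abs_le.1 h1).1
    rw [mem_Ici]
    nlinarith
  have hlip := Convex.norm_image_sub_le_of_norm_deriv_le (f := deriv (logLaplace μ))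
    (s := Ici T) (C := 1 / (2 * (b * k + 1)))
    (fun s _ => (analyticAt_logLaplace hexp s).deriv.differentiableAt)
    (fun s hs => by
      rw [Real.norm_of_nonneg]
      · exact hT s hs
      · rw [← variance_expTilt hexp s]; exact variance_nonneg _ _)
    (convex_Ici T) (hmem y hy1) (hmem x hx1)
  rw [← hx, ← hy, Real.norm_eq_abs, Real.norm_eq_abs, add_sub_add_right_eq_sub, ← mul_sub, abs_mul,
    abs_of_nonneg hb] at hlip
  have hpow : |x ^ k - y ^ k| ≤ |x - y| * k := by
    refine (abs_pow_sub_pow_le x y k).trans ?_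
    refine mul_le_of_le_one_right (by positivity) (pow_le_one₀ (by positivity) (max_le hx1 hy1))
  have h1 : |x - y| ≤ 1 / (2 * (b * k + 1)) * (b * (|x - y| * k)) := by
    refine hlip.trans ?_
    gcongr
  have h2 : 1 / (2 * (b * k + 1)) * (b * (|x - y| * k)) ≤ |x - y| / 2 := by
    have h3 : 1 / (2 * (b * k + 1)) * (b * (|x - y| * k))
        = (b * k / (b * k + 1)) * (|x - y| / 2) := by field_simp
    rw [h3]
    refine mul_le_of_le_one_left (by positivity) ?_
    rw [div_le_one (by positivity)]
    linarith
  have h4 : |x - y| ≤ 0 := by linarith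
  exact sub_eq_zero.1 (abs_eq_zero.1 (le_antisymm h4 (abs_nonneg _)))

/-- For a centred `μ` on `[-1,1]`, Hoeffding's lemma `α(t) ≤ t² / 2` gives `γ(β(x)) ≥ x² / 2`. -/
theorem sq_div_two_le_rateFn (hexp : ∀ t : ℝ, Integrable (fun x => Real.exp (t * x)) μ)
    (hsupp : ∀ᵐ x ∂μ, x ∈ Icc (-1 : ℝ) 1) (h0 : deriv (logLaplace μ) 0 = 0) {x : ℝ}
    (hx : rateFn μ x ≠ ⊤) : x ^ 2 / 2 ≤ (rateFn μ x).toReal := by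
  have hmean : ∫ y, id y ∂μ = 0 := by
    have := deriv_cgf_zero (X := id) (μ := μ) (mem_interior_integrableExpSet hexp 0)
    rw [probReal_univ, div_one] at this
    rw [← this]
    exact h0
  have hsub := hasSubgaussianMGF_of_mem_Icc_of_integral_eq_zero (X := id) aemeasurable_id hsupp
    hmean
  have h1 : logLaplace μ x ≤ x ^ 2 / 2 := by
    have h2 := hsub.cgf_le x
    have h3 : (((‖(1 : ℝ) - -1‖₊ / 2) ^ 2 : NNReal) : ℝ) = 1 := by
      norm_num
    rw [h3, one_mul] at h2
    exact h2
  have := fenchel_young hx x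
  nlinarith

end BoundedSupport

/-! ### The critical coupling -/

section PhaseTransition

variable {μ : Measure ℝ} [IsProbabilityMeasure μ] {k : ℕ} {H : SimpleGraph (Fin (k + 1))}
  [DecidableRel H.Adj] {W : unitInterval → unitInterval → ℝ} {p : ℝ≥0∞} {c : ℝ}

/-- The essential value of an almost everywhere constant maximizer has finite entropy. -/
theorem IsMaximizer.rateFn_ne_top (hexp : ∀ t : ℝ, Integrable (fun x => Real.exp (t * x)) μ)
    {θ B : ℝ} {f : unitInterval → ℝ} (hf : IsMaximizer μ p H W θ B f) {r : ℝ}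
    (hr : ∀ᵐ u, f u = r) : rateFn μ r ≠ ⊤ := by
  have h1 := hf.1.2
  rw [entropyTerm_eq hexp hf.1.1.2.1,
    lintegral_congr_ae (hr.mono fun u hu => by simp only [hu] :
      (fun u => rateFn μ (f u)) =ᵐ[volume] fun _ => rateFn μ r)] at h1
  simpa using h1.ne

/-- The couplings `θ ≥ 0` at which no constant beats the zero function. -/
def subcriticalCouplings (μ : Measure ℝ) (k : ℕ) (c : ℝ) : Set ℝ :=
  {θ | 0 ≤ θ ∧ ∀ x, rateFn μ x ≠ ⊤ → θ * (c * x ^ (k + 1)) ≤ (rateFn μ x).toReal}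

theorem subcriticalCouplings_bddAbove (hexp : ∀ t : ℝ, Integrable (fun x => Real.exp (t * x)) μ)
    (hμ : ∀ a : ℝ, μ ≠ Measure.dirac a) (h0 : deriv (logLaplace μ) 0 = 0) (k : ℕ)
    (hc : 0 < c) : BddAbove (subcriticalCouplings μ k c) := by
  have hx : 0 < deriv (logLaplace μ) 1 := by
    rw [← h0]; exact strictMono_deriv_logLaplace hexp hμ one_pos
  set x := deriv (logLaplace μ) 1 with hxdef
  refine ⟨(rateFn μ x).toReal / (c * x ^ (k + 1)), fun θ hθ => ?_⟩
  rw [le_div_iff₀ (by positivity)]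
  exact hθ.2 x (rateFn_deriv_logLaplace_ne_top hexp 1)

/-- Hoeffding's bound `x² / 2 ≤ γ(β(x))` makes `1 / (2 c)` subcritical. -/
theorem mem_subcriticalCouplings (hexp : ∀ t : ℝ, Integrable (fun x => Real.exp (t * x)) μ)
    (hsupp : ∀ᵐ x ∂μ, x ∈ Icc (-1 : ℝ) 1) (h0 : deriv (logLaplace μ) 0 = 0) (hk : 1 ≤ k)
    (hc : 0 < c) : 1 / (2 * c) ∈ subcriticalCouplings μ k c := by
  refine ⟨by positivity, fun x hx => ?_⟩
  have habs : ∀ᵐ x ∂μ, |x| ≤ 1 := hsupp.mono fun x hx => abs_le.2 hx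
  have hx1 : |x| ≤ 1 := abs_le.2 (closure_meanRange_subset hexp habs
    (mem_closure_meanRange_of_rateFn_ne_top hexp hx))
  have h1 : x ^ (k + 1) ≤ x ^ 2 := by
    calc x ^ (k + 1) ≤ |x ^ (k + 1)| := le_abs_self _
      _ = |x| ^ (k + 1) := abs_pow _ _
      _ ≤ |x| ^ 2 := pow_le_pow_of_le_one (abs_nonneg x) hx1 (by omega)
      _ = x ^ 2 := sq_abs x
  have h2 := sq_div_two_le_rateFn hexp hsupp h0 hx
  have h3 : 1 / (2 * c) * (c * x ^ (k + 1)) = x ^ (k + 1) / 2 := by field_simp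
  rw [h3]
  linarith

theorem rateFn_zero (hk : 1 ≤ k) (hp : ((k + 1 : ℕ) : ℝ≥0∞) ≤ p)
    (htail : TailCondition μ p) (h0 : deriv (logLaplace μ) 0 = 0) : rateFn μ 0 = 0 := by
  have h := rateFn_mean (μ := μ)
    (integrable_exp_of_tailCondition (one_lt_of_natCast_le hk hp).le htail)
  rwa [h0] at h

theorem objective_zero (hk : 1 ≤ k) (hp : ((k + 1 : ℕ) : ℝ≥0∞) ≤ p)
    (htail : TailCondition μ p) (hW : IsKernel H p W) (hc : IsPosRegular H W c)
    (h0 : deriv (logLaplace μ) 0 = 0) (θ : ℝ) : objective μ H W θ 0 (fun _ => 0) = 0 := by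
  have h1 := rateFn_zero hk hp htail h0
  rw [objective_const hk hp htail hW hc θ 0 (by simp [h1]), h1]
  simp

/-- Below the critical coupling the zero function is the only maximizer. -/
theorem isMaximizer_zero_of_lt (hk : 1 ≤ k) (hp : ((k + 1 : ℕ) : ℝ≥0∞) ≤ p)
    (htail : TailCondition μ p) (hpar : Even (k + 1) ∨ StochNonneg μ) (hW : IsKernel H p W)
    (hc : IsPosRegular H W c) (h0 : deriv (logLaplace μ) 0 = 0) {θ θ' : ℝ} (hθ : 0 ≤ θ)
    (hθθ' : θ < θ') (hθ' : θ' ∈ subcriticalCouplings μ k c) :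
    IsMaximizer μ p H W θ 0 (fun _ => 0) ∧
      ∀ g, IsMaximizer μ p H W θ 0 g → ∀ᵐ u, g u = 0 := by
  have hp1 := one_lt_of_natCast_le hk hp
  have hexp := integrable_exp_of_tailCondition hp1.le htail
  have hcpos := hc.pos hp1 hW
  have hr0 := rateFn_zero hk hp htail h0
  have hstrict : ∀ x, rateFn μ x ≠ ⊤ → 0 < x ^ (k + 1) →
      θ * (c * x ^ (k + 1)) < (rateFn μ x).toReal := by
    intro x hx hpos
    refine lt_of_lt_of_le ?_ (hθ'.2 x hx)
    gcongr
  have hle : ∀ x, rateFn μ x ≠ ⊤ → θ * (c * x ^ (k + 1)) ≤ (rateFn μ x).toReal := by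
    intro x hx
    rcases lt_or_ge 0 (x ^ (k + 1)) with h | h
    · exact (hstrict x hx h).le
    · refine le_trans ?_ ENNReal.toReal_nonneg
      exact mul_nonpos_of_nonneg_of_nonpos hθ (mul_nonpos_of_nonneg_of_nonpos hcpos.le h)
  have hval : ∀ g, IsMaximizer μ p H W θ 0 g → ∀ r, (∀ᵐ u, g u = r) →
      objective μ H W θ 0 g = θ * (c * r ^ (k + 1)) - (rateFn μ r).toReal := by
    intro g hg r hr
    rw [objective_congr_ae (g := fun _ => r) hr,
      objective_const hk hp htail hW hc θ 0 (hg.rateFn_ne_top hexp hr)]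
    ring
  have hzero := objective_zero (H := H) (W := W) hk hp htail hW hc h0 θ
  have hmem : (fun _ => (0 : ℝ)) ∈ {g ∈ funSpace μ p | entropyTerm μ g < ⊤} :=
    const_mem_domain hk hp htail (by simp [hr0])
  constructor
  · obtain ⟨f, hf⟩ := exists_isMaximizer (H := H) (W := W) hk hp htail hW θ 0
    obtain ⟨r, hr⟩ := hf.ae_const hk hp htail hpar hW hc hθ le_rfl
    refine ⟨hmem, fun g hg => ?_⟩
    have h1 : objective μ H W θ 0 g ≤ objective μ H W θ 0 f := hf.2 hg
    have h2 := hval f hf r hr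
    have h3 := hle r (hf.rateFn_ne_top hexp hr)
    change objective μ H W θ 0 g ≤ objective μ H W θ 0 fun _ => 0
    rw [hzero]
    linarith
  · intro g hg
    obtain ⟨r, hr⟩ := hg.ae_const hk hp htail hpar hW hc hθ le_rfl
    have hrtop := hg.rateFn_ne_top hexp hr
    have h1 : objective μ H W θ 0 (fun _ => 0) ≤ objective μ H W θ 0 g := hg.2 hmem
    rw [hzero, hval g hg r hr] at h1
    have h2 : r ^ (k + 1) ≤ 0 := by
      by_contra! h
      linarith [hstrict r hrtop h]
    have h3 : θ * (c * r ^ (k + 1)) ≤ 0 :=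
      mul_nonpos_of_nonneg_of_nonpos hθ (mul_nonpos_of_nonneg_of_nonpos hcpos.le h2)
    have h4 : r = 0 := by
      rw [← h0]
      refine eq_deriv_logLaplace_of_fenchel_young_eq hexp hrtop ?_
      rw [logLaplace_zero]
      linarith
    rwa [h4] at hr

/-- Above the critical coupling some constant beats the zero function. -/
theorem not_isMaximizer_zero (hk : 1 ≤ k) (hp : ((k + 1 : ℕ) : ℝ≥0∞) ≤ p)
    (htail : TailCondition μ p) (hW : IsKernel H p W) (hc : IsPosRegular H W c)
    (h0 : deriv (logLaplace μ) 0 = 0) {θ : ℝ} (hθ : 0 ≤ θ)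
    (hθS : θ ∉ subcriticalCouplings μ k c) : ¬ IsMaximizer μ p H W θ 0 (fun _ => 0) := by
  intro hmax
  refine hθS ⟨hθ, fun x hx => ?_⟩
  have h1 : objective μ H W θ 0 (fun _ => x) ≤ objective μ H W θ 0 (fun _ => 0) :=
    hmax.2 (const_mem_domain hk hp htail hx)
  rw [objective_zero hk hp htail hW hc h0, objective_const hk hp htail hW hc θ 0 hx] at h1
  linarith

end PhaseTransition

end MultilinearGibbs

theorem theorem5
    (μ : Measure ℝ) [IsProbabilityMeasure μ] (hμ : ∀ a : ℝ, μ ≠ Measure.dirac a)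
    -- the number of vertices is `v = k + 1 ≥ 2`
    (k : ℕ) (hk : 1 ≤ k)
    (p : ℝ≥0∞) (hp : ((k + 1 : ℕ) : ℝ≥0∞) ≤ p) (htail : TailCondition μ p) :
    -- (i) well-posedness, existence of maximizers, and the fixed point equation
    (∀ (H : SimpleGraph (Fin (k + 1))) [DecidableRel H.Adj]
        (W : unitInterval → unitInterval → ℝ), IsKernel H p W →
      (∀ f ∈ funSpace μ p, Integrable (interactionIntegrand H W f) ∧
        ∀ᵐ x, Integrable (fieldIntegrand H W f x)) ∧
      ∀ θ B : ℝ,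
        (∃ f, IsMaximizer μ p H W θ B f) ∧
        ∀ f, IsMaximizer μ p H W θ B f →
          ∀ᵐ x, f x = deriv (logLaplace μ) (θ * ((k : ℝ) + 1) * localField H W f x + B)) ∧
    -- (ii) replica symmetry and the scalar fixed point equation
    (Even (k + 1) ∨ StochNonneg μ →
      ∀ (H : SimpleGraph (Fin (k + 1))) [DecidableRel H.Adj]
        (W : unitInterval → unitInterval → ℝ) (c : ℝ), IsKernel H p W → IsPosRegular H W c →
      ∀ θ B : ℝ, 0 ≤ θ → 0 ≤ B →
        ∀ f, IsMaximizer μ p H W θ B f →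
          (∃ x : ℝ, ∀ᵐ u, f u = x) ∧
          ∀ x : ℝ, (∀ᵐ u, f u = x) →
            x = deriv (logLaplace μ) (θ * ((k : ℝ) + 1) * c * x ^ k + B)) ∧
    -- (iii)(a) uniqueness for a large field; the threshold does not depend on `H` and `W`
    (Even (k + 1) ∨ StochNonneg μ → (∀ᵐ x ∂μ, x ∈ Icc (-1 : ℝ) 1) →
      ∀ θ c : ℝ, 0 ≤ θ → ∃ B₀ : ℝ,
        ∀ (H : SimpleGraph (Fin (k + 1))) [DecidableRel H.Adj]
          (W : unitInterval → unitInterval → ℝ), IsKernel H p W → IsPosRegular H W c →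
        ∀ B : ℝ, B₀ < B →
          ∃ f, IsMaximizer μ p H W θ B f ∧
            ∀ g, IsMaximizer μ p H W θ B g → ∀ᵐ u, g u = f u) ∧
    -- (iii)(b) the sharp phase transition at zero field
    (Even (k + 1) ∨ StochNonneg μ → (∀ᵐ x ∂μ, x ∈ Icc (-1 : ℝ) 1) →
      deriv (logLaplace μ) 0 = 0 →
      ∀ c : ℝ, ∃ θc : ℝ, 0 < θc ∧
        ∀ (H : SimpleGraph (Fin (k + 1))) [DecidableRel H.Adj]
          (W : unitInterval → unitInterval → ℝ), IsKernel H p W → IsPosRegular H W c →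
        (∀ θ : ℝ, 0 ≤ θ → θ < θc →
          IsMaximizer μ p H W θ 0 (fun _ => 0) ∧
            ∀ g, IsMaximizer μ p H W θ 0 g → ∀ᵐ u, g u = 0) ∧
        (∀ θ : ℝ, θc < θ → ¬ IsMaximizer μ p H W θ 0 (fun _ => 0))) := by
  have hp1 := one_lt_of_natCast_le hk hp
  have hexp := integrable_exp_of_tailCondition hp1.le htail
  refine ⟨?_, ?_, ?_, ?_⟩
  · intro H _ W hW
    exact ⟨fun f hf => ⟨integrable_interactionIntegrand hp1 hW hf.2.2,
        ae_integrable_fieldIntegrand hp1 hW hf.2.2⟩,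
      fun θ B => ⟨exists_isMaximizer hk hp htail hW θ B,
        fun f hf => hf.fixedPoint hk hp htail hW⟩⟩
  · intro hpar H _ W c hW hc θ B hθ hB f hf
    exact ⟨hf.ae_const hk hp htail hpar hW hc hθ hB,
      fun x hx => const_fixedPoint hk hp htail hW hc hf hx⟩
  · intro hpar hsupp θ c hθ
    rcases le_or_gt c 0 with hc0 | hc0
    -- the degree `c` of a positive kernel is positive, so this case is void
    · exact ⟨0, fun H _ W hW hc => absurd (hc.pos hp1 hW) hc0.not_gt⟩
    obtain ⟨B₀, hB₀⟩ := exists_fixedPoint_unique hexp hsupp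
      (b := θ * ((k : ℝ) + 1) * c) (by positivity) k
    refine ⟨max B₀ 0, fun H _ W hW hc B hB => ?_⟩
    obtain ⟨f, hf⟩ := exists_isMaximizer (H := H) (W := W) hk hp htail hW θ B
    have hBpos : 0 ≤ B := ((le_max_right _ _).trans_lt hB).le
    obtain ⟨r, hr⟩ := hf.ae_const hk hp htail hpar hW hc hθ hBpos
    refine ⟨f, hf, fun g hg => ?_⟩
    obtain ⟨s, hs⟩ := hg.ae_const hk hp htail hpar hW hc hθ hBpos
    have hrs := hB₀ B ((le_max_left _ _).trans_lt hB) s r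
      (const_fixedPoint hk hp htail hW hc hg hs) (const_fixedPoint hk hp htail hW hc hf hr)
    filter_upwards [hr, hs] with u hu hu'
    rw [hu, hu', hrs]
  · intro hpar hsupp h0 c
    rcases le_or_gt c 0 with hc0 | hc0
    -- void as above, and any positive `θ_c` will do
    · exact ⟨1, one_pos, fun H _ W hW hc => absurd (hc.pos hp1 hW) hc0.not_gt⟩
    -- the critical coupling is `sSup (subcriticalCouplings μ k c)`
    have hbdd := subcriticalCouplings_bddAbove hexp hμ h0 k hc0
    have hmem := mem_subcriticalCouplings hexp hsupp h0 hk hc0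
    have hpos : 0 < sSup (subcriticalCouplings μ k c) :=
      lt_of_lt_of_le (by positivity) (le_csSup hbdd hmem)
    refine ⟨sSup (subcriticalCouplings μ k c), hpos, fun H _ W hW hc => ⟨?_, ?_⟩⟩
    · intro θ hθ hlt
      obtain ⟨θ', hθ', hlt'⟩ := exists_lt_of_lt_csSup ⟨_, hmem⟩ hlt
      exact isMaximizer_zero_of_lt hk hp htail hpar hW hc h0 hθ hlt' hθ'
    · intro θ hlt
      refine not_isMaximizer_zero hk hp htail hW hc h0 (hpos.trans hlt).le fun hθ => ?_
      exact absurd (le_csSup hbdd hθ) hlt.not_ge
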